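/- Let $\zeta_0,\zeta_1,\dots$ be i.i.d. standard complex Gaussian random variables (density $\pi^{-1}e^{-|z|^2}$ on $\mathbb C$), let $f_0(z)=\sum_{j\ge 0}\zeta_j z^j/\sqrt{j!}$ be the Gaussian entire function, and for $n\ge 0$ let $f_n=\frac{1}{\sqrt{n!}}(\partial_z-\bar z)^n f_0$, where $\partial_z=\frac12(\partial_x-i\partial_y)$. Let $\mathcal Z_{f_n}=\{z\in\mathbb C: f_n(z)=0\}$. For $n\ge 0$ let $\rho_n$ be the continuous density with respect to Lebesgue measure of $\mathbb E\big[\sum_{a\in\mathcal Z_{f_n}}\delta_a\big]$, and for $n\ge0$, $k\ge 1$ let $\rho^{(2)}_{n,n+k}(z,w)$ be the density with respect to Lebesgue measure on $\mathbb C^2$, continuous on $\{z\neq w\}$, of $\mathbb E\big[\sum_{a\in\mathcal Z_{f_n}}\delta_a\otimes\sum_{b\in\mathcal Z_{f_{n+k}}}\delta_b\big]$. These densities exist and $\rho_n>0$. Put $$g_{n,n+k}(z,w)=\frac{\rho^{(2)}_{n,n+k}(z,w)}{\rho_n(z)\,\rho_{n+k}(w)}\quad (z\ne w).$$ Then for all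 $n\ge 0$, $k\ge 1$ and $z\in\mathbb C$ the limit $g_{n,n+k}(z,z):=\lim_{w\to z,\,w\neq z}g_{n,n+k}(z,w)$ exists, and for every $n\ge 0$ $$g_{n,n+1}(z,z)=\frac{n(n+2)}{\left(n+\frac12+\frac1{4n+2}\right)\left(n+\frac32+\frac1{4n+6}\right)}<1,$$ $$g_{n,n+2}(z,z)=\frac{n^2+3n+1+\frac{2}{3(n^2+3n+1)}\left\{\frac{n^4(n+2)^2}{(2n+1)^2}+\frac{(n+1)^2(n+3)^4}{(2n+5)^2}\right\}}{\left(n+\frac12+\frac1{4n+2}\right)\left(n+\frac52+\frac1{4n+10}\right)}>1,$$ $$g_{n,n+k}(z,z)=1\qquad(k\ge 3).$$ As $n\to\infty$, $$g_{n,n+1}(z,z)=1-\frac{5}{4n^2}+O(n^{-3}),\qquad g_{n,n+2}(z,z)=\frac43+\frac{1}{12n^2}+O(n^{-3}).$$ Thus the short-range correlations display repulsion for $k=1$, attraction for $k=2$, and none for $k\ge3$. -/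

import Mathlib

open Filter Topology MeasureTheory ProbabilityTheory
open scoped ENNReal ComplexConjugate

noncomputable section

/-- The standard complex Gaussian law `N_ℂ(0,1)`: density `π⁻¹ exp(-|z|²)` with respect to
Lebesgue measure on `ℂ`. -/
def stdComplexGaussian : Measure ℂ :=
  (volume : Measure ℂ).withDensity fun z => ENNReal.ofReal (Real.pi⁻¹ * Real.exp (-‖z‖ ^ 2))

/-- The Wirtinger derivative `∂_z = (∂_x - i ∂_y) / 2`. -/
def wirtingerDz (f : ℂ → ℂ) (z : ℂ) : ℂ :=
  (fderiv ℝ f z 1 - Complex.I * fderiv ℝ f z Complex.I) / 2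

/-- The Landau-level raising operator `∂_z - z̄`. -/
def landauRaise (f : ℂ → ℂ) (z : ℂ) : ℂ :=
  wirtingerDz f z - conj z * f z

/-- The Gaussian entire function with coefficients `ζ`: `f₀(z) = ∑_k ζ_k z^k / √(k!)`. -/
def gaussianEntire {Ω : Type*} (ζ : ℕ → Ω → ℂ) (ω : Ω) (z : ℂ) : ℂ :=
  ∑' k : ℕ, ζ k ω * (z ^ k / (Real.sqrt (k.factorial : ℝ) : ℂ))

/-- `f_n = (n!)^{-1/2} (∂_z - z̄)^n f₀`. -/
def landauGaussian {Ω : Type*} (ζ : ℕ → Ω → ℂ) (n : ℕ) (ω : Ω) (z : ℂ) : ℂ :=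
  (Real.sqrt (n.factorial : ℝ) : ℂ)⁻¹ * (landauRaise^[n] (gaussianEntire ζ ω)) z

/-- The number of zeros of `f` in `S`. -/
def zeroCount (f : ℂ → ℂ) (S : Set ℂ) : ℝ≥0∞ :=
  (({a : ℂ | a ∈ S ∧ f a = 0}.encard : ℕ∞) : ℝ≥0∞)

/-- The number of pairs `(a, b) ∈ S` with `f a = 0` and `g b = 0`, that is, the mass of `S` under
`∑_{a ∈ Z_f} δ_a ⊗ ∑_{b ∈ Z_g} δ_b`. -/
def zeroPairCount (f g : ℂ → ℂ) (S : Set (ℂ × ℂ)) : ℝ≥0∞ :=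
  (({p : ℂ × ℂ | p ∈ S ∧ f p.1 = 0 ∧ g p.2 = 0}.encard : ℕ∞) : ℝ≥0∞)

/-- `ρ` is the (continuous version of the) one-point intensity of the zero set of the random
function `f`: the density of `E[∑_{a ∈ Z_f} δ_a]` with respect to Lebesgue measure. -/
structure IsOnePointIntensity {Ω : Type*} [MeasurableSpace Ω] (P : Measure Ω)
    (f : Ω → ℂ → ℂ) (ρ : ℂ → ℝ) : Prop where
  continuous : Continuous ρ
  nonneg : ∀ z, 0 ≤ ρ z
  aemeasurable_count : ∀ S : Set ℂ, MeasurableSet S → AEMeasurable (fun ω => zeroCount (f ω) S) P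
  lintegral_count : ∀ S : Set ℂ, MeasurableSet S →
    ∫⁻ ω, zeroCount (f ω) S ∂P = ∫⁻ z in S, ENNReal.ofReal (ρ z)

/-- `ρ` is the two-point intensity of the pair of zero sets of `f` and `g`, in the version that is
continuous off the diagonal (a density is determined only almost everywhere; continuity determines
its values at all `(z, w)` with `z ≠ w`): the density of
`E[∑_{a ∈ Z_f} δ_a ⊗ ∑_{b ∈ Z_g} δ_b]` with respect to Lebesgue measure on `ℂ × ℂ`. -/
structure IsTwoPointIntensity {Ω : Type*} [MeasurableSpace Ω] (P : Measure Ω)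
    (f g : Ω → ℂ → ℂ) (ρ : ℂ × ℂ → ℝ) : Prop where
  continuousOn : ContinuousOn ρ {p : ℂ × ℂ | p.1 ≠ p.2}
  nonneg : ∀ p, 0 ≤ ρ p
  aemeasurable_count : ∀ S : Set (ℂ × ℂ), MeasurableSet S →
    AEMeasurable (fun ω => zeroPairCount (f ω) (g ω) S) P
  lintegral_count : ∀ S : Set (ℂ × ℂ), MeasurableSet S →
    ∫⁻ ω, zeroPairCount (f ω) (g ω) S ∂P = ∫⁻ p in S, ENNReal.ofReal (ρ p)

/-- The normalized pair correlation `g(z,w) = ρ⁽²⁾(z,w) / (ρ_f(z) ρ_g(w))` formed from the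
intensities. -/
def normalizedPairCorrelation (ρf ρg : ℂ → ℝ) (ρfg : ℂ × ℂ → ℝ) (z w : ℂ) : ℝ :=
  ρfg (z, w) / (ρf z * ρg w)

end

noncomputable section

section Counting

theorem encard_toENNReal_eq_count {α : Type*} (s : Set α) :
    ((s.encard : ℕ∞) : ℝ≥0∞) = @Measure.count α ⊤ s := by
  let _ : MeasurableSpace α := ⊤
  exact (Measure.count_apply (MeasurableSpace.measurableSet_top)).symm

theorem encard_toENNReal_iUnion {α : Type*} {t : ℕ → Set α}
    (ht : Pairwise (Function.onFun Disjoint t)) :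
    (((⋃ n, t n).encard : ℕ∞) : ℝ≥0∞) = ∑' n, (((t n).encard : ℕ∞) : ℝ≥0∞) := by
  simp only [encard_toENNReal_eq_count]
  exact @measure_iUnion ℕ α ⊤ _ _ t ht fun _ => MeasurableSpace.measurableSet_top

theorem encard_toENNReal_union {α : Type*} {s t : Set α} (h : Disjoint s t) :
    (((s ∪ t).encard : ℕ∞) : ℝ≥0∞) = (s.encard : ℕ∞) + (t.encard : ℕ∞) := by
  rw [Set.encard_union_eq h]; simp

end Counting

section AreaFormula

variable {E : Type*} [NormedAddCommGroup E] [NormedSpace ℝ E] [FiniteDimensional ℝ E]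
  [MeasurableSpace E] [BorelSpace E]

theorem encard_fiber_of_injOn {α β : Type*} {f : α → β} {s : Set α} (hf : Set.InjOn f s) (y : β) :
    (({x | x ∈ s ∧ f x = y}.encard : ℕ∞) : ℝ≥0∞) = (f '' s).indicator 1 y := by
  by_cases hy : y ∈ f '' s
  · obtain ⟨x, hx, rfl⟩ := hy
    have : {z | z ∈ s ∧ f z = f x} = {x} := by
      ext z
      exact ⟨fun h => hf h.1 hx h.2, fun h => by rw [Set.mem_singleton_iff.1 h]; exact ⟨hx, rfl⟩⟩
    rw [this, Set.indicator_of_mem (Set.mem_image_of_mem f hx)]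
    simp
  · have : {z | z ∈ s ∧ f z = y} = ∅ := by
      ext z
      simp only [Set.mem_ofPred_eq, Set.mem_empty_iff_false, iff_false]
      rintro ⟨h1, h2⟩
      exact hy ⟨z, h1, h2⟩
    rw [this, Set.indicator_of_notMem hy]
    simp

theorem lintegral_encard_fiber_mul_of_injOn (μ : Measure E) [μ.IsAddHaarMeasure] {f : E → E}
    {s : Set E} (hs : MeasurableSet s) (hf : ∀ x ∈ s, DifferentiableAt ℝ f x) (hinj : Set.InjOn f s)
    (g : E → ℝ≥0∞) :
    ∫⁻ y, (({x | x ∈ s ∧ f x = y}.encard : ℕ∞) : ℝ≥0∞) * g y ∂μ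
      = ∫⁻ x in s, ENNReal.ofReal |(fderiv ℝ f x).det| * g (f x) ∂μ := by
  have hd : ∀ x ∈ s, HasFDerivWithinAt f (fderiv ℝ f x) s x := fun x hx =>
    (hf x hx).hasFDerivAt.hasFDerivWithinAt
  rw [← lintegral_image_eq_lintegral_abs_det_fderiv_mul μ hs hd hinj g,
    ← lintegral_indicator (measurable_image_of_fderivWithin hs hd hinj)]
  refine lintegral_congr fun y => ?_
  rw [encard_fiber_of_injOn hinj]
  by_cases hy : y ∈ f '' s
  · simp [hy]
  · simp [hy]

theorem exists_partition_injOn {f : E → E} {s : Set E} (hs : MeasurableSet s)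
    (hf : ∀ x ∈ s, DifferentiableAt ℝ f x) (hdet : ∀ x ∈ s, (fderiv ℝ f x).det ≠ 0) :
    ∃ t : ℕ → Set E, Pairwise (Function.onFun Disjoint t) ∧ (∀ n, MeasurableSet (t n)) ∧
      (⋃ n, t n) = s ∧ ∀ n, Set.InjOn f (t n) := by
  classical
  rcases s.eq_empty_or_nonempty with rfl | hne
  · exact ⟨fun _ => ∅, fun _ _ _ => by simp [Function.onFun], by simp, by simp, by simp⟩
  have hd : ∀ x ∈ s, HasFDerivWithinAt f (fderiv ℝ f x) s x := fun x hx =>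
    (hf x hx).hasFDerivAt.hasFDerivWithinAt
  have key : ∀ A : E →L[ℝ] E, ∃ r : NNReal, r ≠ 0 ∧ (A.det ≠ 0 → ∀ u : Set E,
      ApproximatesLinearOn f A u r → Set.InjOn f u) := by
    intro A
    by_cases hA : A.det = 0
    · exact ⟨1, one_ne_zero, fun h => absurd hA h⟩
    · set B := A.toContinuousLinearEquivOfDetNeZero hA with hB
      rcases subsingleton_or_nontrivial E with hE | hE
      · exact ⟨1, one_ne_zero, fun _ u _ => Set.injOn_of_injective (Function.injective_of_subsingleton f)⟩
      have hpos : 0 < ‖(B.symm : E →L[ℝ] E)‖₊⁻¹ := by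
        have := B.symm.nnnorm_symm_pos
        have := B.nnnorm_symm_pos
        positivity
      refine ⟨‖(B.symm : E →L[ℝ] E)‖₊⁻¹ / 2, (half_pos hpos).ne', fun _ u hu => ?_⟩
      have hu' : ApproximatesLinearOn f (B : E →L[ℝ] E) u (‖(B.symm : E →L[ℝ] E)‖₊⁻¹ / 2) := by
        rw [hB, ContinuousLinearMap.coe_toContinuousLinearEquivOfDetNeZero]
        exact hu
      exact hu'.injOn (Or.inr (half_lt_self hpos))
  choose r hr0 hr using key
  obtain ⟨t, A, hdisj, hmeas, hcov, happ, hA⟩ :=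
    exists_partition_approximatesLinearOn_of_hasFDerivWithinAt f s (fderiv ℝ f) hd r hr0
  refine ⟨fun n => s ∩ t n, ?_, fun n => hs.inter (hmeas n), ?_, fun n => ?_⟩
  · intro i j hij
    exact (hdisj hij).mono Set.inter_subset_right Set.inter_subset_right
  · rw [← Set.inter_iUnion]; exact Set.inter_eq_left.2 hcov
  · obtain ⟨y, hy, hAy⟩ := hA hne n
    exact hr (A n) (by rw [hAy]; exact hdet y hy) _ (happ n)

/-- The area formula with multiplicity. -/
theorem lintegral_encard_fiber_mul (μ : Measure E) [μ.IsAddHaarMeasure] {f : E → E}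
    {s : Set E} (hs : MeasurableSet s) (hf : ∀ x ∈ s, DifferentiableAt ℝ f x)
    {g : E → ℝ≥0∞} (hg : Measurable g) :
    ∫⁻ y, (({x | x ∈ s ∧ f x = y}.encard : ℕ∞) : ℝ≥0∞) * g y ∂μ
      = ∫⁻ x in s, ENNReal.ofReal |(fderiv ℝ f x).det| * g (f x) ∂μ := by
  set Z : Set E := {x | (fderiv ℝ f x).det = 0} with hZ
  have hZm : MeasurableSet Z :=
    (ContinuousLinearMap.continuous_det.measurable.comp (measurable_fderiv ℝ f))
      (measurableSet_singleton 0)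
  have hnull : μ (f '' (s ∩ Z)) = 0 :=
    addHaar_image_eq_zero_of_det_fderivWithin_eq_zero μ (f' := fderiv ℝ f)
      (fun x hx => (hf x hx.1).hasFDerivAt.hasFDerivWithinAt) fun x hx => hx.2
  obtain ⟨t, hdisj, hmeas, hcov, hinj⟩ := exists_partition_injOn (f := f) (hs.diff hZm)
    (fun x hx => hf x hx.1) (fun x hx => hx.2)
  have htd : ∀ n, ∀ x ∈ t n, DifferentiableAt ℝ f x := fun n x hx =>
    hf x (hcov ▸ Set.mem_iUnion_of_mem n hx : x ∈ s \ Z).1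
  have hd : ∀ n, ∀ x ∈ t n, HasFDerivWithinAt f (fderiv ℝ f x) (t n) x := fun n x hx =>
    (htd n x hx).hasFDerivAt.hasFDerivWithinAt
  have hfib : ∀ᵐ y ∂μ, (({x | x ∈ s ∧ f x = y}.encard : ℕ∞) : ℝ≥0∞) * g y
      = ∑' n, (({x | x ∈ t n ∧ f x = y}.encard : ℕ∞) : ℝ≥0∞) * g y := by
    filter_upwards [measure_eq_zero_iff_ae_notMem.1 hnull] with y hy
    rw [ENNReal.tsum_mul_right]
    congr 1
    rw [← encard_toENNReal_iUnion]
    · congr 2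
      ext x
      simp only [Set.mem_ofPred_eq, Set.mem_iUnion, exists_and_right]
      rw [← Set.mem_iUnion, hcov]
      refine ⟨fun h => ⟨⟨h.1, fun hx => hy ⟨x, ⟨h.1, hx⟩, h.2⟩⟩, h.2⟩, fun h => ⟨h.1.1, h.2⟩⟩
    · intro i j hij
      exact (hdisj hij).mono (fun x hx => hx.1) (fun x hx => hx.1)
  have hind : ∀ n, ∀ y, (({x | x ∈ t n ∧ f x = y}.encard : ℕ∞) : ℝ≥0∞)
      = (f '' (t n)).indicator 1 y := fun n y => encard_fiber_of_injOn (hinj n) y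
  rw [lintegral_congr_ae hfib, lintegral_tsum]
  · rw [← Set.inter_union_sdiff s Z, lintegral_union (hs.diff hZm)
      (Set.disjoint_sdiff_right.mono_left Set.inter_subset_right)]
    have h0 : ∫⁻ x in s ∩ Z, ENNReal.ofReal |(fderiv ℝ f x).det| * g (f x) ∂μ = 0 := by
      rw [setLIntegral_congr_fun (g := fun _ => 0) (hs.inter hZm)]
      · simp
      · intro x hx
        have : (fderiv ℝ f x).det = 0 := hx.2
        simp [this]
    rw [h0, zero_add, ← hcov, lintegral_iUnion hmeas hdisj]
    exact tsum_congr fun n => lintegral_encard_fiber_mul_of_injOn μ (hmeas n) (htd n) (hinj n) g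
  · intro n
    refine (Measurable.mul ?_ hg).aemeasurable
    simp only [hind]
    exact measurable_one.indicator (measurable_image_of_fderivWithin (hmeas n) (hd n) (hinj n))

end AreaFormula

section KacRice

variable {E : Type*} [NormedAddCommGroup E] [NormedSpace ℝ E] [FiniteDimensional ℝ E]
  [MeasurableSpace E] [BorelSpace E] {R : Type*} [MeasurableSpace R]

/-- The value `-(A t)⁻¹ (h r t)` of `η` for which `A t η + h r t = 0`. -/
def affineZero (A : E →L[ℝ] E) (b : E) : E := -(Ring.inverse A) b

theorem isUnit_of_det_ne_zero {A : E →L[ℝ] E} (hA : A.det ≠ 0) : IsUnit A := by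
  refine ⟨ContinuousLinearEquiv.toUnit (A.toContinuousLinearEquivOfDetNeZero hA), ?_⟩
  ext x
  simp [ContinuousLinearEquiv.toUnit]

theorem apply_ringInverse {A : E →L[ℝ] E} (hA : A.det ≠ 0) (x : E) : A (Ring.inverse A x) = x := by
  have := Ring.mul_inverse_cancel A (isUnit_of_det_ne_zero hA)
  exact congrArg (fun L : E →L[ℝ] E => L x) this

theorem ringInverse_apply {A : E →L[ℝ] E} (hA : A.det ≠ 0) (x : E) : Ring.inverse A (A x) = x := by
  have := Ring.inverse_mul_cancel A (isUnit_of_det_ne_zero hA)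
  exact congrArg (fun L : E →L[ℝ] E => L x) this

theorem apply_affineZero {A : E →L[ℝ] E} (hA : A.det ≠ 0) (b : E) : A (affineZero A b) + b = 0 := by
  simp [affineZero, apply_ringInverse hA]

theorem affineZero_eq_iff {A : E →L[ℝ] E} (hA : A.det ≠ 0) (b η : E) :
    affineZero A b = η ↔ A η + b = 0 := by
  constructor
  · rintro rfl
    exact apply_affineZero hA b
  · intro h
    rw [affineZero, ← neg_eq_of_add_eq_zero_right h, map_neg, neg_neg, ringInverse_apply hA]

theorem measurable_ringInverse : Measurable (Ring.inverse : (E →L[ℝ] E) → E →L[ℝ] E) := by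
  have ho : IsOpen {A : E →L[ℝ] E | IsUnit A} := Units.isOpen
  have hc : ContinuousOn (Ring.inverse : (E →L[ℝ] E) → E →L[ℝ] E) {A | IsUnit A} := by
    rintro _ ⟨u, rfl⟩
    exact (NormedRing.inverse_continuousAt u).continuousWithinAt
  classical
  have : (Ring.inverse : (E →L[ℝ] E) → E →L[ℝ] E)
      = Set.piecewise {A | IsUnit A} Ring.inverse (fun _ => 0) := by
    ext1 A
    by_cases hA : IsUnit A
    · simp [Set.piecewise, hA]
    · simp [Set.piecewise, hA, Ring.inverse_non_unit]
  rw [this]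
  exact hc.measurable_piecewise continuousOn_const ho.measurableSet

theorem measurable_affineZero {α : Type*} [MeasurableSpace α] {A : α → E →L[ℝ] E} {b : α → E}
    (hA : Measurable A) (hb : Measurable b) : Measurable fun x => affineZero (A x) (b x) := by
  have h1 : Measurable fun x => Ring.inverse (A x) := measurable_ringInverse.comp hA
  have h2 : Continuous fun y : (E →L[ℝ] E) × E => y.1 y.2 :=
    isBoundedBilinearMap_apply.continuous
  exact (h2.measurable.comp (h1.prodMk hb)).neg

theorem differentiableAt_affineZero {A : E → E →L[ℝ] E} {b : E → E} {t : E}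
    (hA : DifferentiableAt ℝ A t) (hdet : (A t).det ≠ 0) (hb : DifferentiableAt ℝ b t) :
    DifferentiableAt ℝ (fun t => affineZero (A t) (b t)) t := by
  obtain ⟨u, hu⟩ := isUnit_of_det_ne_zero hdet
  have h1 : DifferentiableAt ℝ (Ring.inverse : (E →L[ℝ] E) → E →L[ℝ] E) (A t) := by
    rw [← hu]; exact differentiableAt_inverse u.isUnit
  exact ((h1.comp t hA).clm_apply hb).neg

theorem abs_det_fderiv_affineZero {A : E → E →L[ℝ] E} {b : E → E} {t : E}
    (hA : DifferentiableAt ℝ A t) (hdet : (A t).det ≠ 0) (hb : DifferentiableAt ℝ b t) :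
    |(fderiv ℝ (fun s => A s (affineZero (A t) (b t)) + b s) t).det| * |(A t).det|⁻¹
      = |(fderiv ℝ (fun s => affineZero (A s) (b s)) t).det| := by
  set ψ : E → E := fun s => affineZero (A s) (b s) with hψ
  have hd := (differentiableAt_affineZero hA hdet hb).hasFDerivAt
  have h1 : HasFDerivAt (fun s => A s (ψ s) + b s)
      ((A t).comp (fderiv ℝ ψ t) + (fderiv ℝ A t).flip (ψ t) + fderiv ℝ b t) t :=
    (hA.hasFDerivAt.clm_apply hd).add hb.hasFDerivAt
  have h2 : HasFDerivAt (fun s => A s (ψ s) + b s) (0 : E →L[ℝ] E) t := by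
    have hne : ∀ᶠ s in 𝓝 t, (A s).det ≠ 0 :=
      (ContinuousLinearMap.continuous_det.continuousAt.comp hA.continuousAt).eventually_ne hdet
    refine (hasFDerivAt_const (0 : E) t).congr_of_eventuallyEq ?_
    filter_upwards [hne] with s hs using apply_affineZero hs _
  have h3 : HasFDerivAt (fun s => A s (ψ t) + b s)
      ((fderiv ℝ A t).flip (ψ t) + fderiv ℝ b t) t := by
    have := (hA.hasFDerivAt.clm_apply (hasFDerivAt_const (ψ t) t)).add hb.hasFDerivAt
    simp only [ContinuousLinearMap.comp_zero, zero_add] at this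
    exact this
  have h4 : (fderiv ℝ A t).flip (ψ t) + fderiv ℝ b t = (A t).comp (-fderiv ℝ ψ t) := by
    have := h1.unique h2
    rw [ContinuousLinearMap.comp_neg, eq_neg_iff_add_eq_zero, ← this]
    abel
  have h5 : (fderiv ℝ (fun s => A s (ψ t) + b s) t) = (A t).comp (-fderiv ℝ ψ t) := by
    rw [h3.fderiv, h4]
  have h6 : |(-fderiv ℝ ψ t).det| = |(fderiv ℝ ψ t).det| := by
    have : (((-fderiv ℝ ψ t : E →L[ℝ] E)) : E →ₗ[ℝ] E) = (-1 : ℝ) • (fderiv ℝ ψ t : E →ₗ[ℝ] E) := by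
      ext x; simp
    rw [ContinuousLinearMap.det, this, LinearMap.det_smul, abs_mul, abs_pow]
    simp [ContinuousLinearMap.det]
  have h7 : ((A t).comp (-fderiv ℝ ψ t)).det = (A t).det * (-fderiv ℝ ψ t).det :=
    LinearMap.det_comp _ _
  rw [h5, h7, abs_mul, h6]
  have : |(A t).det| ≠ 0 := abs_ne_zero.2 hdet
  field_simp

/-- A Kac–Rice formula: the expected number of zeros of an affine function of a random vector
with a density, with coefficients depending on the point and on independent randomness. -/
theorem lintegral_encard_zeros_prod (μ : Measure E) [μ.IsAddHaarMeasure] (ν : Measure R) [SFinite ν]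
    {p : E → ℝ≥0∞} (hp : Measurable p) (hp' : ∀ x, p x < ∞)
    {A : E → E →L[ℝ] E} {h : R → E → E} {S : Set E} (hS : MeasurableSet S)
    (hAm : Measurable A) (hhm : Measurable fun x : R × E => h x.1 x.2)
    (hA : ∀ t ∈ S, DifferentiableAt ℝ A t) (hdet : ∀ t ∈ S, (A t).det ≠ 0)
    (hh : ∀ r, ∀ t ∈ S, DifferentiableAt ℝ (h r) t)
    {D : E → R → E → ℝ≥0∞} (hDm : Measurable fun x : E × R × E => D x.1 x.2.1 x.2.2)
    (hD : ∀ η r, ∀ t ∈ S, A t η + h r t = 0 →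
      D η r t = ENNReal.ofReal |(fderiv ℝ (fun t => A t η + h r t) t).det|)
    (hcount : AEMeasurable (fun x : E × R =>
      (({t | t ∈ S ∧ A t x.1 + h x.2 t = 0}.encard : ℕ∞) : ℝ≥0∞)) ((μ.withDensity p).prod ν)) :
    ∫⁻ x, (({t | t ∈ S ∧ A t x.1 + h x.2 t = 0}.encard : ℕ∞) : ℝ≥0∞) ∂((μ.withDensity p).prod ν)
      = ∫⁻ t in S, ∫⁻ r, D (affineZero (A t) (h r t)) r t * ENNReal.ofReal |(A t).det|⁻¹ *
          p (affineZero (A t) (h r t)) ∂ν ∂μ := by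
  rw [lintegral_prod_symm _ hcount]
  have key : ∀ r, ∫⁻ η, (({t | t ∈ S ∧ A t η + h r t = 0}.encard : ℕ∞) : ℝ≥0∞) ∂(μ.withDensity p)
      = ∫⁻ t in S, D (affineZero (A t) (h r t)) r t * ENNReal.ofReal |(A t).det|⁻¹ *
          p (affineZero (A t) (h r t)) ∂μ := by
    intro r
    rw [lintegral_withDensity_eq_lintegral_mul_non_measurable μ hp (ae_of_all _ hp')]
    have e1 : ∀ η, {t | t ∈ S ∧ A t η + h r t = 0}
        = {t | t ∈ S ∧ (fun t => affineZero (A t) (h r t)) t = η} := by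
      intro η
      ext t
      exact and_congr_right fun ht => (affineZero_eq_iff (hdet t ht) _ _).symm
    calc _ = ∫⁻ η, (({t | t ∈ S ∧ (fun t => affineZero (A t) (h r t)) t = η}.encard : ℕ∞) : ℝ≥0∞)
          * p η ∂μ := by
          refine lintegral_congr fun η => ?_
          rw [← e1, mul_comm]; rfl
      _ = _ := by
          rw [lintegral_encard_fiber_mul μ hS
            (fun t ht => differentiableAt_affineZero (hA t ht) (hdet t ht) (hh r t ht)) hp]
          refine setLIntegral_congr_fun hS fun t ht => ?_
          rw [hD _ _ t ht (apply_affineZero (hdet t ht) _), ← ENNReal.ofReal_mul (abs_nonneg _),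
            abs_det_fderiv_affineZero (hA t ht) (hdet t ht) (hh r t ht)]
  simp only [key]
  have hm1 : Measurable fun x : R × E => affineZero (A x.2) (h x.1 x.2) :=
    measurable_affineZero (hAm.comp measurable_snd) hhm
  rw [lintegral_lintegral_swap]
  refine Measurable.aemeasurable (Measurable.mul (Measurable.mul ?_ ?_) (hp.comp hm1))
  · exact hDm.comp (hm1.prodMk measurable_id)
  · exact (((ContinuousLinearMap.continuous_det.measurable.comp
      (hAm.comp measurable_snd))).norm.inv).ennreal_ofReal

theorem lintegral_comp_affine (μ : Measure E) [μ.IsAddHaarMeasure] {A : E →L[ℝ] E}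
    (hA : A.det ≠ 0) (b : E) {f : E → ℝ≥0∞} (hf : Measurable f) :
    ∫⁻ η, f (A η + b) ∂μ = ENNReal.ofReal |A.det|⁻¹ * ∫⁻ x, f x ∂μ := by
  have h1 : μ.map A = ENNReal.ofReal |A.det|⁻¹ • μ := by
    rw [← abs_inv]
    exact Measure.map_linearMap_addHaar_eq_smul_addHaar μ (f := (A : E →ₗ[ℝ] E)) hA
  have h2 : ∫⁻ η, f (A η + b) ∂μ = ∫⁻ x, f (x + b) ∂(μ.map A) :=
    (lintegral_map (hf.comp (measurable_id.add_const b)) A.continuous.measurable).symm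
  rw [h2, h1, lintegral_smul_measure, lintegral_add_right_eq_self]
  rfl

theorem lintegral_affineZero_of_bounded (μ : Measure E) [μ.IsAddHaarMeasure] (ν : Measure R)
    [IsProbabilityMeasure ν] {p q : E → ℝ} (hp : Continuous p) (hp0 : ∀ x, 0 ≤ p x)
    {C : ℝ} (hpC : ∀ x, p x ≤ C) (hq : Continuous q)
    [IsProbabilityMeasure (μ.withDensity fun x => ENNReal.ofReal (p x))]
    {A : E →L[ℝ] E} (hA : A.det ≠ 0) {h : R → E} (hh : Measurable h)
    {G : E → R → ℝ} (hGm : Measurable fun x : E × R => G x.1 x.2) (hG0 : ∀ η r, 0 ≤ G η r)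
    {N : ℝ} (hGN : ∀ η r, G η r ≤ N) (hGc : ∀ r, Continuous fun η => G η r)
    (hind : IndepFun (fun x : E × R => A x.1 + h x.2) (fun x : E × R => G x.1 x.2)
      ((μ.withDensity fun x => ENNReal.ofReal (p x)).prod ν))
    (hlaw : ((μ.withDensity fun x => ENNReal.ofReal (p x)).prod ν).map
      (fun x : E × R => A x.1 + h x.2) = μ.withDensity fun x => ENNReal.ofReal (q x)) :
    ∫⁻ r, ENNReal.ofReal (G (affineZero A (h r)) r) * ENNReal.ofReal |A.det|⁻¹ *
        ENNReal.ofReal (p (affineZero A (h r))) ∂ν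
      = ENNReal.ofReal (q 0) * ∫⁻ x, ENNReal.ofReal (G x.1 x.2)
          ∂((μ.withDensity fun x => ENNReal.ofReal (p x)).prod ν) := by
  set γ := μ.withDensity fun x => ENNReal.ofReal (p x) with hγ
  set c := ∫⁻ x, ENNReal.ofReal (G x.1 x.2) ∂(γ.prod ν) with hc
  have hcfin : c ≠ ∞ := by
    refine ne_of_lt (lt_of_le_of_lt (lintegral_mono (g := fun _ => ENNReal.ofReal N) fun x =>
      ENNReal.ofReal_le_ofReal (hGN _ _)) ?_)
    simp
  have hN : 0 ≤ N := by
    obtain ⟨r⟩ : Nonempty R := nonempty_of_isProbabilityMeasure ν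
    exact (hG0 0 r).trans (hGN 0 r)
  have hC : 0 ≤ C := (hp0 0).trans (hpC 0)
  set B := Ring.inverse A with hB
  have hBA : ∀ x, B (A x) = x := ringInverse_apply hA
  set ξ : E → R → E := fun x r => B (x - h r) with hξ
  have hξm : Measurable fun y : R × E => ξ y.2 y.1 :=
    B.continuous.measurable.comp (measurable_snd.sub (hh.comp measurable_fst))
  have hξc : ∀ r, Continuous fun x => ξ x r := fun r =>
    B.continuous.comp (continuous_id.sub continuous_const)
  set I : E → R → ℝ := fun x r => G (ξ x r) r * |A.det|⁻¹ * p (ξ x r) with hI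
  have hI0 : ∀ x r, 0 ≤ I x r := fun x r =>
    mul_nonneg (mul_nonneg (hG0 _ _) (inv_nonneg.2 (abs_nonneg _))) (hp0 _)
  have hIm : Measurable fun y : R × E => I y.2 y.1 :=
    ((hGm.comp (hξm.prodMk measurable_fst)).mul_const _).mul (hp.measurable.comp hξm)
  have hIb : ∀ x r, ‖I x r‖ ≤ N * |A.det|⁻¹ * C := fun x r => by
    rw [Real.norm_of_nonneg (hI0 x r)]
    exact mul_le_mul (mul_le_mul_of_nonneg_right (hGN _ _) (by positivity)) (hpC _) (hp0 _)
      (by positivity)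
  have hImx : ∀ x, Measurable (I x) := fun x => hIm.comp (measurable_id.prodMk measurable_const)
  have hIint : ∀ x, Integrable (I x) ν := fun x =>
    (integrable_const (N * |A.det|⁻¹ * C)).mono' (hImx x).aestronglyMeasurable
      (ae_of_all _ (hIb x))
  set Φ : E → ℝ≥0∞ := fun x => ∫⁻ r, ENNReal.ofReal (I x r) ∂ν with hΦ
  have hΦeq : Φ = fun x => ENNReal.ofReal (∫ r, I x r ∂ν) := by
    ext1 x
    rw [hΦ, ofReal_integral_eq_lintegral_ofReal (hIint x) (ae_of_all _ (hI0 x))]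
  have hΦc : Continuous Φ := by
    rw [hΦeq]
    refine ENNReal.continuous_ofReal.comp (continuous_of_dominated
      (bound := fun _ => N * |A.det|⁻¹ * C) (fun x => (hImx x).aestronglyMeasurable)
      (fun x => ae_of_all _ (hIb x)) (integrable_const _) (ae_of_all _ fun r => ?_))
    exact (((hGc r).comp (hξc r)).mul continuous_const).mul (hp.comp (hξc r))
  have hqc : Continuous fun x => ENNReal.ofReal (q x) * c :=
    (ENNReal.continuous_mul_const hcfin).comp (ENNReal.continuous_ofReal.comp hq)
  have hae : Φ =ᵐ[μ] fun x => ENNReal.ofReal (q x) * c := by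
    refine ae_eq_of_forall_setLIntegral_eq_of_sigmaFinite hΦc.measurable hqc.measurable
      fun T hT _ => ?_
    have hFm : Measurable fun x : E × R => A x.1 + h x.2 :=
      (A.continuous.measurable.comp measurable_fst).add (hh.comp measurable_snd)
    have hTm : Measurable (T.indicator (1 : E → ℝ≥0∞)) := measurable_one.indicator hT
    have e1 : ∫⁻ x in T, ENNReal.ofReal (q x) * c ∂μ
        = ∫⁻ x, T.indicator 1 (A x.1 + h x.2) * ENNReal.ofReal (G x.1 x.2) ∂(γ.prod ν) := by
      rw [lintegral_mul_const _ hq.measurable.ennreal_ofReal]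
      have := lintegral_mul_eq_lintegral_mul_lintegral_of_indepFun (hTm.comp hFm)
        hGm.ennreal_ofReal (hind.comp hTm ENNReal.measurable_ofReal)
      refine Eq.trans ?_ this.symm
      congr 1
      have h2 := lintegral_map (μ := γ.prod ν) hTm hFm
      rw [hlaw, lintegral_indicator_one hT, withDensity_apply _ hT] at h2
      exact h2
    rw [e1, lintegral_prod_symm' (fun x : E × R =>
      T.indicator 1 (A x.1 + h x.2) * ENNReal.ofReal (G x.1 x.2))
      ((hTm.comp hFm).mul hGm.ennreal_ofReal)]
    have e2 : ∀ r, ∫⁻ η, T.indicator 1 (A η + h r) * ENNReal.ofReal (G η r) ∂γ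
        = ∫⁻ x in T, ENNReal.ofReal (I x r) ∂μ := by
      intro r
      have hξr : Measurable fun x => ξ x r := (hξc r).measurable
      have hGr : Measurable fun η => G η r := (hGc r).measurable
      rw [hγ, lintegral_withDensity_eq_lintegral_mul _ hp.measurable.ennreal_ofReal
        (g := fun η => T.indicator 1 (A η + h r) * ENNReal.ofReal (G η r))
        ((hTm.comp (A.continuous.measurable.add_const _)).mul hGr.ennreal_ofReal)]
      have h3 := lintegral_comp_affine μ hA (h r)
        (f := fun x => ENNReal.ofReal (p (ξ x r)) *
          (T.indicator 1 x * ENNReal.ofReal (G (ξ x r) r)))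
        ((hp.measurable.comp hξr).ennreal_ofReal.mul (hTm.mul (hGr.comp hξr).ennreal_ofReal))
      simp only [hξ, add_sub_cancel_right, hBA] at h3
      refine Eq.trans h3 ?_
      rw [← lintegral_indicator hT, ← lintegral_const_mul]
      · refine lintegral_congr fun x => ?_
        by_cases hx : x ∈ T
        · simp only [Set.indicator_of_mem hx, hI, hξ, Pi.one_apply, one_mul]
          rw [ENNReal.ofReal_mul (mul_nonneg (hG0 _ _) (by positivity)),
            ENNReal.ofReal_mul (hG0 _ _)]
          ring
        · simp [hx]
      · exact ((hp.measurable.comp hξr).ennreal_ofReal.mul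
          (hTm.mul (hGr.comp hξr).ennreal_ofReal))
    simp only [e2]
    rw [hΦ, lintegral_lintegral_swap]
    exact (hIm.comp measurable_swap).ennreal_ofReal.aemeasurable
  have h0 := congrFun ((Continuous.ae_eq_iff_eq μ hΦc hqc).1 hae) 0
  rw [← h0, hΦ]
  refine lintegral_congr fun r => ?_
  simp only [hI, hξ, zero_sub, map_neg]
  rw [ENNReal.ofReal_mul (mul_nonneg (hG0 _ _) (by positivity)), ENNReal.ofReal_mul (hG0 _ _)]
  rfl

/-- Evaluation of the conditional expectation in the Kac–Rice formula when the integrand can be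
chosen independent of the field. -/
theorem lintegral_affineZero_eq (μ : Measure E) [μ.IsAddHaarMeasure] (ν : Measure R)
    [IsProbabilityMeasure ν] {p q : E → ℝ} (hp : Continuous p) (hp0 : ∀ x, 0 ≤ p x)
    {C : ℝ} (hpC : ∀ x, p x ≤ C) (hq : Continuous q)
    [IsProbabilityMeasure (μ.withDensity fun x => ENNReal.ofReal (p x))]
    {A : E →L[ℝ] E} (hA : A.det ≠ 0) {h : R → E} (hh : Measurable h)
    {G : E → R → ℝ} (hGm : Measurable fun x : E × R => G x.1 x.2) (hG0 : ∀ η r, 0 ≤ G η r)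
    (hGc : ∀ r, Continuous fun η => G η r)
    (hind : IndepFun (fun x : E × R => A x.1 + h x.2) (fun x : E × R => G x.1 x.2)
      ((μ.withDensity fun x => ENNReal.ofReal (p x)).prod ν))
    (hlaw : ((μ.withDensity fun x => ENNReal.ofReal (p x)).prod ν).map
      (fun x : E × R => A x.1 + h x.2) = μ.withDensity fun x => ENNReal.ofReal (q x)) :
    ∫⁻ r, ENNReal.ofReal (G (affineZero A (h r)) r) * ENNReal.ofReal |A.det|⁻¹ *
        ENNReal.ofReal (p (affineZero A (h r))) ∂ν
      = ENNReal.ofReal (q 0) * ∫⁻ x, ENNReal.ofReal (G x.1 x.2)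
          ∂((μ.withDensity fun x => ENNReal.ofReal (p x)).prod ν) := by
  set γ := μ.withDensity fun x => ENNReal.ofReal (p x) with hγ
  have htrunc : ∀ x : ℝ, 0 ≤ x →
      (⨆ n : ℕ, ENNReal.ofReal (min x n)) = ENNReal.ofReal x := by
    intro x hx
    refine le_antisymm (iSup_le fun n => ENNReal.ofReal_le_ofReal (min_le_left _ _)) ?_
    obtain ⟨n, hn⟩ := exists_nat_ge x
    exact le_iSup_of_le n (by rw [min_eq_left hn])
  have hmono : ∀ x : ℝ, Monotone fun n : ℕ => ENNReal.ofReal (min x n) := fun x m n hmn =>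
    ENNReal.ofReal_le_ofReal (min_le_min_left _ (Nat.cast_le.2 hmn))
  have haz : Measurable fun r => affineZero A (h r) := measurable_affineZero measurable_const hh
  have key : ∀ n : ℕ, _ := fun n => lintegral_affineZero_of_bounded μ ν hp hp0 hpC hq hA hh
    (G := fun η r => min (G η r) n) (hGm.min measurable_const)
    (fun η r => le_min (hG0 _ _) (Nat.cast_nonneg n)) (fun η r => min_le_right _ _)
    (fun r => (hGc r).min continuous_const)
    (hind.comp measurable_id (measurable_id.min measurable_const)) hlaw
  have l1 : (⨆ n : ℕ, ∫⁻ x : E × R, ENNReal.ofReal (min (G x.1 x.2) n) ∂(γ.prod ν))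
      = ∫⁻ x, ENNReal.ofReal (G x.1 x.2) ∂(γ.prod ν) := by
    rw [← lintegral_iSup (fun n => (hGm.min measurable_const).ennreal_ofReal)
      (fun m n hmn x => hmono _ hmn)]
    exact lintegral_congr fun x => htrunc _ (hG0 _ _)
  have hGz : Measurable fun r => G (affineZero A (h r)) r := hGm.comp (haz.prodMk measurable_id)
  have l2 : (⨆ n : ℕ, ∫⁻ r, ENNReal.ofReal (min (G (affineZero A (h r)) r) n) *
      ENNReal.ofReal |A.det|⁻¹ * ENNReal.ofReal (p (affineZero A (h r))) ∂ν)
      = ∫⁻ r, ENNReal.ofReal (G (affineZero A (h r)) r) * ENNReal.ofReal |A.det|⁻¹ *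
        ENNReal.ofReal (p (affineZero A (h r))) ∂ν := by
    rw [← lintegral_iSup (f := fun (n : ℕ) r => ENNReal.ofReal (min (G (affineZero A (h r)) r) n) *
      ENNReal.ofReal |A.det|⁻¹ * ENNReal.ofReal (p (affineZero A (h r)))) (fun n => ((hGz.min measurable_const).ennreal_ofReal.mul_const _).mul
      (hp.measurable.comp haz).ennreal_ofReal)
      (fun m n hmn r => by
        dsimp only
        gcongr)]
    refine lintegral_congr fun r => ?_
    rw [← htrunc _ (hG0 _ _), ENNReal.iSup_mul, ENNReal.iSup_mul]
  rw [← l1, ← l2, ENNReal.mul_iSup]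
  exact iSup_congr key

end KacRice

section CountMeasurability

variable {α T V : Type*} [MeasurableSpace α] [MetricSpace T] [ProperSpace T]
  [NormedAddCommGroup V] [MeasurableSpace V] [BorelSpace V]

theorem measurableSet_exists_zero_mem {F : α → T → V} (hc : ∀ a, Continuous (F a))
    (hm : ∀ t, Measurable fun a => F a t) {K : Set T} (hK : IsCompact K) :
    MeasurableSet {a | ∃ t ∈ K, F a t = 0} := by
  rcases K.eq_empty_or_nonempty with rfl | hne
  · simp
  have : Nonempty K := hne.to_subtype
  set d := TopologicalSpace.denseSeq K with hd
  have hdense : DenseRange d := TopologicalSpace.denseRange_denseSeq K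
  have : {a | ∃ t ∈ K, F a t = 0} = ⋂ n : ℕ, ⋃ k : ℕ, {a | ‖F a (d k)‖ < 1 / ((n : ℝ) + 1)} := by
    ext a
    simp only [Set.mem_iInter, Set.mem_iUnion, Set.mem_ofPred_eq]
    constructor
    · rintro ⟨t, ht, h0⟩ n
      have hcK : Continuous fun x : K => ‖F a x‖ := ((hc a).comp continuous_subtype_val).norm
      have ho : IsOpen {x : K | ‖F a x‖ < 1 / ((n : ℝ) + 1)} := isOpen_lt hcK continuous_const
      obtain ⟨k, hk⟩ := hdense.exists_mem_open ho
        ⟨⟨t, ht⟩, by simp only [Set.mem_ofPred_eq, h0, norm_zero]; positivity⟩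
      exact ⟨k, hk⟩
    · intro h
      obtain ⟨t, ht, hmin⟩ := hK.exists_isMinOn hne ((hc a).norm.continuousOn (s := K))
      refine ⟨t, ht, ?_⟩
      rw [← norm_le_zero_iff]
      refine le_of_forall_pos_lt_add fun ε hε => ?_
      obtain ⟨n, hn⟩ := exists_nat_one_div_lt hε
      obtain ⟨k, hk⟩ := h n
      have := hmin (d k).2
      simp only [Set.mem_ofPred_eq] at this
      linarith
  rw [this]
  exact MeasurableSet.iInter fun n => MeasurableSet.iUnion fun k =>
    measurableSet_lt (hm _).norm measurable_const

theorem exists_disjoint_closedBalls {U : Set T} (hU : IsOpen U) [Nonempty T] (u : Finset T)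
    (hu : ∀ x ∈ u, x ∈ U) :
    ∃ f : T → ℕ × ℚ, (∀ x ∈ u, x ∈ Metric.closedBall (TopologicalSpace.denseSeq T (f x).1) (f x).2 ∧
        Metric.closedBall (TopologicalSpace.denseSeq T (f x).1) (f x).2 ⊆ U) ∧
      ∀ x ∈ u, ∀ y ∈ u, x ≠ y →
        Disjoint (Metric.closedBall (TopologicalSpace.denseSeq T (f x).1) ((f x).2 : ℝ))
          (Metric.closedBall (TopologicalSpace.denseSeq T (f y).1) (f y).2) := by
  have hev : ∀ᶠ δ : ℝ in 𝓝[>] 0, ∀ x ∈ u, Metric.closedBall x δ ⊆ U ∧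
      ∀ y ∈ u, x ≠ y → 2 * δ < dist x y := by
    rw [Filter.eventually_all_finset]
    intro x hx
    refine Filter.Eventually.and ?_ ?_
    · obtain ⟨ε, hε, hεU⟩ := Metric.isOpen_iff.1 hU x (hu x hx)
      filter_upwards [Ioo_mem_nhdsGT hε] with δ hδ
      exact (Metric.closedBall_subset_ball hδ.2).trans hεU
    · rw [Filter.eventually_all_finset]
      intro y hy
      by_cases hxy : x = y
      · exact Filter.Eventually.of_forall fun δ h => absurd hxy h
      · filter_upwards [Ioo_mem_nhdsGT (half_pos (dist_pos.2 hxy))] with δ hδ _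
        linarith [hδ.2]
  obtain ⟨δ, hδ, hδ0⟩ := (hev.and self_mem_nhdsWithin).exists
  have hδ0 : 0 < δ := hδ0
  obtain ⟨q, hq0, hq⟩ := exists_rat_btwn (half_pos hδ0)
  have hk : ∀ x : T, ∃ k : ℕ, dist x (TopologicalSpace.denseSeq T k) < q := fun x => by
    obtain ⟨k, hk⟩ := (TopologicalSpace.denseRange_denseSeq T).exists_dist_lt x hq0
    exact ⟨k, hk⟩
  choose k hk using hk
  have hsub : ∀ x, Metric.closedBall (TopologicalSpace.denseSeq T (k x)) (q : ℝ)
      ⊆ Metric.closedBall x δ := fun x => by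
    refine Metric.closedBall_subset_closedBall' ?_
    have := hk x
    rw [dist_comm] at this
    linarith
  refine ⟨fun x => (k x, q), fun x hx => ⟨(hk x).le, (hsub x).trans (hδ x hx).1⟩, ?_⟩
  intro x hx y hy hxy
  refine (Metric.closedBall_disjoint_closedBall ?_).mono (hsub x) (hsub y)
  linarith [(hδ x hx).2 y hy hxy]

/-- The number of zeros in an open set of a random continuous function is measurable. -/
theorem measurable_encard_zeros [Nonempty T] {F : α → T → V} (hc : ∀ a, Continuous (F a))
    (hm : ∀ t, Measurable fun a => F a t) {U : Set T} (hU : IsOpen U) :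
    Measurable fun a => (({t | t ∈ U ∧ F a t = 0}.encard : ℕ∞) : ℝ≥0∞) := by
  classical
  set b : ℕ × ℚ → Set T := fun x => Metric.closedBall (TopologicalSpace.denseSeq T x.1) (x.2 : ℝ)
    with hb
  have key : ∀ n : ℕ, {a | (n : ℕ∞) ≤ {t | t ∈ U ∧ F a t = 0}.encard}
      = ⋃ s ∈ {s : Finset (ℕ × ℚ) | s.card = n ∧ (∀ x ∈ s, b x ⊆ U) ∧
          ∀ x ∈ s, ∀ y ∈ s, x ≠ y → Disjoint (b x) (b y)},
        ⋂ x ∈ s, {a | ∃ t ∈ b x, F a t = 0} := by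
    intro n
    ext a
    simp only [Set.mem_iUnion, Set.mem_iInter, Set.mem_ofPred_eq, exists_prop]
    constructor
    · intro h
      obtain ⟨v, hvs, hv⟩ := Set.exists_subset_encard_eq h
      have hvfin : v.Finite := Set.finite_of_encard_eq_coe hv
      set u := hvfin.toFinset with hu
      have hus : ∀ x ∈ u, x ∈ U ∧ F a x = 0 := fun x hx => hvs (by simpa [hu] using hx)
      obtain ⟨f, hf1, hf2⟩ := exists_disjoint_closedBalls hU u fun x hx => (hus x hx).1
      have hfinj : Set.InjOn f u := by
        intro x hx y hy hxy
        by_contra hne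
        have := hf2 x hx y hy hne
        rw [hxy] at this
        exact Set.disjoint_left.1 this (hxy ▸ (hf1 x hx).1) (hxy ▸ (hf1 x hx).1)
      refine ⟨u.image f, ⟨?_, ?_, ?_⟩, ?_⟩
      · rw [Finset.card_image_of_injOn hfinj]
        have : (u.card : ℕ∞) = n := by
          rw [← hv, ← Set.encard_coe_eq_coe_finsetCard, hu, Set.Finite.coe_toFinset]
        exact_mod_cast this
      · intro x hx
        obtain ⟨y, hy, rfl⟩ := Finset.mem_image.1 hx
        exact (hf1 y hy).2
      · intro x hx y hy hxy
        obtain ⟨x', hx', rfl⟩ := Finset.mem_image.1 hx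
        obtain ⟨y', hy', rfl⟩ := Finset.mem_image.1 hy
        exact hf2 x' hx' y' hy' fun h => hxy (by rw [h])
      · intro x hx
        obtain ⟨y, hy, rfl⟩ := Finset.mem_image.1 hx
        exact ⟨y, (hf1 y hy).1, (hus y hy).2⟩
    · rintro ⟨s, ⟨hcard, hsU, hdisj⟩, hz⟩
      choose! g hg using hz
      have hginj : Set.InjOn g s := by
        intro x hx y hy hxy
        by_contra hne
        exact Set.disjoint_left.1 (hdisj x hx y hy hne) (hg x hx).1 (hxy ▸ (hg y hy).1)
      have hsub : (g '' (s : Set (ℕ × ℚ))) ⊆ {t | t ∈ U ∧ F a t = 0} := by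
        rintro _ ⟨x, hx, rfl⟩
        exact ⟨hsU x hx (hg x hx).1, (hg x hx).2⟩
      refine le_trans (le_of_eq ?_) (Set.encard_le_encard hsub)
      rw [hginj.encard_image, Set.encard_coe_eq_coe_finsetCard, hcard]
  have hmeas : ∀ n : ℕ, MeasurableSet {a | (n : ℕ∞) ≤ {t | t ∈ U ∧ F a t = 0}.encard} := by
    intro n
    rw [key]
    refine MeasurableSet.biUnion (Set.to_countable _) fun s _ => ?_
    exact Finset.measurableSet_biInter _ fun x _ =>
      measurableSet_exists_zero_mem hc hm (isCompact_closedBall _ _)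
  have hmain : Measurable fun a => ({t | t ∈ U ∧ F a t = 0}.encard : ℕ∞) := by
    refine measurable_to_countable' fun x => ?_
    induction x using ENat.recTopCoe with
    | top =>
      have : (fun a => ({t | t ∈ U ∧ F a t = 0}.encard : ℕ∞)) ⁻¹' {⊤}
          = ⋂ n : ℕ, {a | (n : ℕ∞) ≤ {t | t ∈ U ∧ F a t = 0}.encard} := by
        ext a
        simp only [Set.mem_preimage, Set.mem_singleton_iff, Set.mem_iInter, Set.mem_ofPred_eq]
        exact ENat.eq_top_iff_forall_ge
      rw [this]
      exact MeasurableSet.iInter hmeas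
    | coe n =>
      have : (fun a => ({t | t ∈ U ∧ F a t = 0}.encard : ℕ∞)) ⁻¹' {(n : ℕ∞)}
          = {a | (n : ℕ∞) ≤ {t | t ∈ U ∧ F a t = 0}.encard} \
            {a | ((n + 1 : ℕ) : ℕ∞) ≤ {t | t ∈ U ∧ F a t = 0}.encard} := by
        ext a
        simp only [Set.mem_preimage, Set.mem_singleton_iff, Set.mem_sdiff, Set.mem_ofPred_eq,
          Nat.cast_add, Nat.cast_one, ENat.add_one_le_iff (ENat.natCast_ne_top n), not_lt]
        exact ⟨fun h => ⟨h.ge, h.le⟩, fun h => le_antisymm h.2 h.1⟩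
      rw [this]
      exact (hmeas n).diff (hmeas (n + 1))
  exact Measurable.of_discrete.comp hmain

end CountMeasurability

section Globalization

variable {Ω T : Type*} [MeasurableSpace Ω] [TopologicalSpace T]
  [MeasurableSpace T] [BorelSpace T]

theorem lintegral_encard_inter_of_subset (P : Measure Ω) (μ : Measure T) {Z : Ω → Set T}
    {ρ : T → ℝ≥0∞} {N : Set T} (hN : IsOpen N) (hfin : ∫⁻ t in N, ρ t ∂μ ≠ ∞)
    (hloc : ∀ U ⊆ N, IsOpen U → AEMeasurable (fun ω => (((U ∩ Z ω).encard : ℕ∞) : ℝ≥0∞)) P ∧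
      ∫⁻ ω, (((U ∩ Z ω).encard : ℕ∞) : ℝ≥0∞) ∂P = ∫⁻ t in U, ρ t ∂μ) (S : Set T)
    (hS : MeasurableSet S) :
    AEMeasurable (fun ω => (((S ∩ N ∩ Z ω).encard : ℕ∞) : ℝ≥0∞)) P ∧
      ∫⁻ ω, (((S ∩ N ∩ Z ω).encard : ℕ∞) : ℝ≥0∞) ∂P = ∫⁻ t in S ∩ N, ρ t ∂μ := by
  obtain ⟨hNm, hNi⟩ := hloc N subset_rfl hN
  have hNae : ∀ᵐ ω ∂P, (((N ∩ Z ω).encard : ℕ∞) : ℝ≥0∞) < ∞ :=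
    ae_lt_top' hNm (by rw [hNi]; exact hfin)
  induction S, hS using MeasurableSpace.induction_on_inter
    (BorelSpace.measurable_eq (α := T))
    isPiSystem_isOpen with
  | empty => simp
  | basic U hU => exact hloc _ Set.inter_subset_right (IsOpen.inter hU hN)
  | compl S hS ih =>
    obtain ⟨ihm, ihi⟩ := ih
    have hadd : ∀ ω, (((S ∩ N ∩ Z ω).encard : ℕ∞) : ℝ≥0∞) + ((Sᶜ ∩ N ∩ Z ω).encard : ℕ∞)
        = ((N ∩ Z ω).encard : ℕ∞) := by
      intro ω
      rw [← encard_toENNReal_union]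
      · congr 2
        ext x
        simp only [Set.mem_union, Set.mem_inter_iff, Set.mem_compl_iff]
        tauto
      · exact Set.disjoint_left.2 fun x hx hx' => hx'.1.1 hx.1.1
    have hae : (fun ω => (((Sᶜ ∩ N ∩ Z ω).encard : ℕ∞) : ℝ≥0∞))
        =ᵐ[P] fun ω => (((N ∩ Z ω).encard : ℕ∞) : ℝ≥0∞) - ((S ∩ N ∩ Z ω).encard : ℕ∞) := by
      filter_upwards [hNae] with ω hω
      refine ENNReal.eq_sub_of_add_eq (ne_of_lt (lt_of_le_of_lt ?_ hω)) (by rw [add_comm]; exact hadd ω)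
      rw [← hadd ω]
      exact le_self_add
    have hm : AEMeasurable (fun ω => (((Sᶜ ∩ N ∩ Z ω).encard : ℕ∞) : ℝ≥0∞)) P :=
      (hNm.sub ihm).congr hae.symm
    refine ⟨hm, ?_⟩
    have h1 : ∫⁻ ω, (((S ∩ N ∩ Z ω).encard : ℕ∞) : ℝ≥0∞) ∂P
        + ∫⁻ ω, (((Sᶜ ∩ N ∩ Z ω).encard : ℕ∞) : ℝ≥0∞) ∂P = ∫⁻ t in N, ρ t ∂μ := by
      rw [← lintegral_add_left' ihm, ← hNi]
      exact lintegral_congr hadd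
    have h2 : ∫⁻ t in S ∩ N, ρ t ∂μ + ∫⁻ t in Sᶜ ∩ N, ρ t ∂μ = ∫⁻ t in N, ρ t ∂μ := by
      have := lintegral_inter_add_sdiff (μ := μ) ρ N hS
      rw [Set.inter_comm N S, Set.sdiff_eq, Set.inter_comm N] at this
      exact this
    have hf : ∫⁻ t in S ∩ N, ρ t ∂μ ≠ ∞ :=
      ne_top_of_le_ne_top hfin (lintegral_mono_set Set.inter_subset_right)
    rw [ihi, ← h2] at h1
    exact (ENNReal.add_right_inj hf).1 h1
  | iUnion f hd hf ih =>
    have hadd : ∀ ω, ((((⋃ i, f i) ∩ N ∩ Z ω).encard : ℕ∞) : ℝ≥0∞)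
        = ∑' i, (((f i ∩ N ∩ Z ω).encard : ℕ∞) : ℝ≥0∞) := by
      intro ω
      rw [← encard_toENNReal_iUnion]
      · rw [Set.iUnion_inter, Set.iUnion_inter]
      · intro i j hij
        exact (hd hij).mono (fun x hx => hx.1.1) (fun x hx => hx.1.1)
    simp only [hadd]
    refine ⟨AEMeasurable.tsum fun i => (ih i).1, ?_⟩
    rw [lintegral_tsum fun i => (ih i).1, Set.iUnion_inter,
      lintegral_iUnion (fun i => (hf i).inter hN.measurableSet)]
    · exact tsum_congr fun i => (ih i).2
    · intro i j hij
      exact (hd hij).mono Set.inter_subset_left Set.inter_subset_left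

/-- If the intensity of a random set is known on small open sets, then it is known on all Borel
sets. -/
theorem lintegral_encard_inter_of_local [SecondCountableTopology T] [Nonempty T] (P : Measure Ω) (μ : Measure T)
    {Z : Ω → Set T} {ρ : T → ℝ≥0∞}
    (hloc : ∀ t : T, ∃ N : Set T, IsOpen N ∧ t ∈ N ∧ ∫⁻ t in N, ρ t ∂μ ≠ ∞ ∧
      ∀ U ⊆ N, IsOpen U → AEMeasurable (fun ω => (((U ∩ Z ω).encard : ℕ∞) : ℝ≥0∞)) P ∧
      ∫⁻ ω, (((U ∩ Z ω).encard : ℕ∞) : ℝ≥0∞) ∂P = ∫⁻ t in U, ρ t ∂μ) {S : Set T}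
    (hS : MeasurableSet S) :
    AEMeasurable (fun ω => (((S ∩ Z ω).encard : ℕ∞) : ℝ≥0∞)) P ∧
      ∫⁻ ω, (((S ∩ Z ω).encard : ℕ∞) : ℝ≥0∞) ∂P = ∫⁻ t in S, ρ t ∂μ := by
  choose N hNo hNt hNf hN using hloc
  obtain ⟨s, hsc, hs⟩ := TopologicalSpace.countable_cover_nhds
    fun t => (hNo t).mem_nhds (hNt t)
  have hsne : s.Nonempty := by
    by_contra hemp
    rw [Set.not_nonempty_iff_eq_empty] at hemp
    obtain ⟨t⟩ := (inferInstance : Nonempty T)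
    have : t ∈ ⋃ x ∈ s, N x := hs ▸ Set.mem_univ t
    simp [hemp] at this
  obtain ⟨e, rfl⟩ := hsc.exists_eq_range hsne
  set M := disjointed fun i => N (e i) with hM
  have hMm : ∀ i, MeasurableSet (M i) := fun i =>
    MeasurableSet.disjointed (fun i => (hNo (e i)).measurableSet) i
  have hMd : Pairwise (Function.onFun Disjoint M) := disjoint_disjointed _
  have hMu : ⋃ i, M i = Set.univ := by
    rw [hM, iUnion_disjointed, ← hs, Set.biUnion_range]
  have hMN : ∀ i, M i ⊆ N (e i) := fun i => disjointed_subset _ i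
  have hSeq : S = ⋃ i, S ∩ M i ∩ N (e i) := by
    ext x
    obtain ⟨i, hi⟩ := Set.mem_iUnion.1 (hMu ▸ Set.mem_univ x : x ∈ ⋃ i, M i)
    simp only [Set.mem_iUnion, Set.mem_inter_iff]
    exact ⟨fun h => ⟨i, ⟨h, hi⟩, hMN i hi⟩, fun ⟨j, hj⟩ => hj.1.1⟩
  have hdis : Pairwise (Function.onFun Disjoint fun i => S ∩ M i ∩ N (e i)) := fun i j hij =>
    (hMd hij).mono (fun x hx => hx.1.2) (fun x hx => hx.1.2)
  have hadd : ∀ ω, (((S ∩ Z ω).encard : ℕ∞) : ℝ≥0∞)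
      = ∑' i, (((S ∩ M i ∩ N (e i) ∩ Z ω).encard : ℕ∞) : ℝ≥0∞) := by
    intro ω
    rw [← encard_toENNReal_iUnion, ← Set.iUnion_inter, ← hSeq]
    intro i j hij
    exact (hdis hij).mono Set.inter_subset_left Set.inter_subset_left
  have hl := fun i => lintegral_encard_inter_of_subset P μ (hNo (e i)) (hNf (e i)) (hN (e i))
    (S ∩ M i) (hS.inter (hMm i))
  simp only [hadd]
  refine ⟨AEMeasurable.tsum fun i => (hl i).1, ?_⟩
  rw [lintegral_tsum fun i => (hl i).1]
  conv_rhs => rw [hSeq]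
  rw [lintegral_iUnion (fun i => (hS.inter (hMm i)).inter (hNo (e i)).measurableSet) hdis]
  exact tsum_congr fun i => (hl i).2

end Globalization

/-- The weight `R ^ j / √(j!)`. -/
def growth (R j : ℕ) : ℝ := (R : ℝ) ^ j / √(j.factorial : ℝ)

theorem growth_nonneg (R j : ℕ) : 0 ≤ growth R j := by unfold growth; positivity

theorem growth_mono {R R' : ℕ} (h : R ≤ R') (j : ℕ) : growth R j ≤ growth R' j := by
  unfold growth; gcongr

theorem growth_le_exp (R j : ℕ) : growth R j ≤ Real.exp ((R : ℝ) ^ 2) := by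
  have h1 : growth R j ^ 2 ≤ Real.exp ((R : ℝ) ^ 2) := by
    have := Real.pow_div_factorial_le_exp ((R : ℝ) ^ 2) (by positivity) j
    rw [growth, div_pow, Real.sq_sqrt (by positivity), ← pow_mul, mul_comm j 2, pow_mul]
    exact this
  have h2 : (1 : ℝ) ≤ Real.exp ((R : ℝ) ^ 2) := Real.one_le_exp (by positivity)
  nlinarith [growth_nonneg R j]

theorem growth_mul (K R j : ℕ) : growth (K * R) j = (K : ℝ) ^ j * growth R j := by
  simp only [growth, Nat.cast_mul, mul_pow, mul_div_assoc]

theorem summable_growth (R : ℕ) : Summable (growth R) := by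
  have h : ∀ j, growth R j ≤ Real.exp (((2 * R : ℕ) : ℝ) ^ 2) * (1 / 2) ^ j := by
    intro j
    have h1 := growth_le_exp (2 * R) j
    have h2 : growth R j = growth (2 * R) j * (1 / 2) ^ j := by
      rw [growth_mul, mul_comm, ← mul_assoc, ← mul_pow]; norm_num
    rw [h2]
    gcongr
  exact Summable.of_nonneg_of_le (growth_nonneg R) h
    ((summable_geometric_of_lt_one (by norm_num) (by norm_num)).mul_left _)

/-- The coefficient functions of `f_n = ∑ j, ζ_j φ_{n,j}`. -/
def landauCoeff : ℕ → ℕ → ℂ → ℂ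
  | 0, j, z => z ^ j / (√(j.factorial : ℝ) : ℂ)
  | n + 1, j, z => ((√(j : ℝ) : ℂ) * landauCoeff n (j - 1) z - conj z * landauCoeff n j z) /
      (√((n : ℝ) + 1) : ℂ)

theorem ofReal_sqrt_mul_self {x : ℝ} (hx : 0 ≤ x) : (√x : ℂ) * (√x : ℂ) = (x : ℂ) := by
  rw [← Complex.ofReal_mul, Real.mul_self_sqrt hx]

theorem ofReal_sqrt_succ_ne_zero (n : ℕ) : (√((n : ℝ) + 1) : ℂ) ≠ 0 := by
  rw [Complex.ofReal_ne_zero]; positivity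

theorem sqrt_mul_landauCoeff_succ (n j : ℕ) (z : ℂ) :
    (√((n : ℝ) + 1) : ℂ) * landauCoeff (n + 1) j z
      = (√(j : ℝ) : ℂ) * landauCoeff n (j - 1) z - conj z * landauCoeff n j z := by
  rw [landauCoeff, mul_div_cancel₀ _ (ofReal_sqrt_succ_ne_zero n)]

theorem sqrt_mul_landauCoeff_pred (n j : ℕ) (z : ℂ) :
    (√(j : ℝ) : ℂ) * landauCoeff n (j - 1) z
      = (√((n : ℝ) + 1) : ℂ) * landauCoeff (n + 1) j z + conj z * landauCoeff n j z := by
  rw [sqrt_mul_landauCoeff_succ]; ring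

theorem norm_landauCoeff_le_poly {R : ℕ} (hR : 1 ≤ R) {z : ℂ} (hz : ‖z‖ ≤ R) (n j : ℕ) :
    ‖landauCoeff n j z‖ ≤ ((j : ℝ) + R) ^ n * growth R j := by
  have hR' : (1 : ℝ) ≤ R := by exact_mod_cast hR
  induction n generalizing j with
  | zero =>
    simp only [landauCoeff, pow_zero, one_mul, growth, norm_div, norm_pow, Complex.norm_real,
      Real.norm_eq_abs, abs_of_nonneg (Real.sqrt_nonneg _)]
    gcongr
  | succ n ih =>
    have hden : (1 : ℝ) ≤ √((n : ℝ) + 1) := by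
      rw [Real.one_le_sqrt]; linarith [(Nat.cast_nonneg n : (0 : ℝ) ≤ n)]
    have h1 : ‖(√(j : ℝ) : ℂ) * landauCoeff n (j - 1) z‖ ≤ j * (((j : ℝ) + R) ^ n * growth R j) := by
      rcases j with _ | j
      · simp
      · rw [norm_mul, Complex.norm_real, Real.norm_eq_abs, abs_of_nonneg (Real.sqrt_nonneg _)]
        have hg : √((j + 1 : ℕ) : ℝ) * growth R j ≤ ((j + 1 : ℕ) : ℝ) * growth R (j + 1) := by
          have hs : (0 : ℝ) < √((j + 1 : ℕ) : ℝ) := by positivity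
          have hs2 : ((j + 1 : ℕ) : ℝ) = √((j + 1 : ℕ) : ℝ) * √((j + 1 : ℕ) : ℝ) :=
            (Real.mul_self_sqrt (by positivity)).symm
          have e : growth R (j + 1) = R * growth R j / √((j + 1 : ℕ) : ℝ) := by
            unfold growth
            rw [Nat.factorial_succ, Nat.cast_mul, Real.sqrt_mul (by positivity), pow_succ]
            field_simp
          have e2 : ((j + 1 : ℕ) : ℝ) * growth R (j + 1) = √((j + 1 : ℕ) : ℝ) * (R * growth R j) := by
            rw [e]
            nth_rewrite 1 [hs2]
            field_simp
          rw [e2]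
          have := growth_nonneg R j
          gcongr
          nlinarith
        have hp : ((j : ℝ) + R) ^ n ≤ (((j + 1 : ℕ) : ℝ) + R) ^ n := by
          gcongr; linarith
        calc √((j + 1 : ℕ) : ℝ) * ‖landauCoeff n (j + 1 - 1) z‖
            ≤ √((j + 1 : ℕ) : ℝ) * (((j : ℝ) + R) ^ n * growth R j) := by
              gcongr; exact ih j
          _ = ((j : ℝ) + R) ^ n * (√((j + 1 : ℕ) : ℝ) * growth R j) := by ring
          _ ≤ (((j + 1 : ℕ) : ℝ) + R) ^ n * (((j + 1 : ℕ) : ℝ) * growth R (j + 1)) := by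
              have := growth_nonneg R j
              gcongr
          _ = _ := by ring
    have h2 : ‖conj z * landauCoeff n j z‖ ≤ R * (((j : ℝ) + R) ^ n * growth R j) := by
      rw [norm_mul, RCLike.norm_conj]
      have := growth_nonneg R j
      gcongr
      exact ih j
    rw [landauCoeff, norm_div, Complex.norm_real, Real.norm_eq_abs,
      abs_of_nonneg (Real.sqrt_nonneg _)]
    calc _ ≤ ‖(√(j : ℝ) : ℂ) * landauCoeff n (j - 1) z - conj z * landauCoeff n j z‖ :=
          div_le_self (norm_nonneg _) hden
      _ ≤ j * (((j : ℝ) + R) ^ n * growth R j) + R * (((j : ℝ) + R) ^ n * growth R j) :=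
          (norm_sub_le _ _).trans (add_le_add h1 h2)
      _ = _ := by ring

theorem norm_landauCoeff_le {R : ℕ} (hR : 1 ≤ R) {z : ℂ} (hz : ‖z‖ ≤ R) (n j : ℕ) :
    ‖landauCoeff n j z‖ ≤ n.factorial * Real.exp R * growth (3 * R) j := by
  refine (norm_landauCoeff_le_poly hR hz n j).trans ?_
  have h1 : ((j : ℝ) + R) ^ n ≤ n.factorial * Real.exp ((j : ℝ) + R) := by
    have := Real.pow_div_factorial_le_exp ((j : ℝ) + R) (by positivity) n
    rwa [div_le_iff₀' (by positivity)] at this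
  have h2 : Real.exp ((j : ℝ) + R) ≤ Real.exp R * 3 ^ j := by
    rw [Real.exp_add, mul_comm]
    gcongr
    rw [← Real.exp_one_pow]
    gcongr
    exact Real.exp_one_lt_three.le
  rw [growth_mul]
  have := growth_nonneg R j
  calc ((j : ℝ) + R) ^ n * growth R j ≤ n.factorial * (Real.exp R * 3 ^ j) * growth R j := by
        gcongr
        exact h1.trans (by gcongr)
    _ = _ := by push_cast; ring

/-- The commutation relation for the multiplication by `z`. -/
theorem sqrt_mul_landauCoeff_shift (n j : ℕ) (z : ℂ) :
    (√((j : ℝ) + 1) : ℂ) * landauCoeff n (j + 1) z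
      = z * landauCoeff n j z + (√(n : ℝ) : ℂ) * landauCoeff (n - 1) j z := by
  induction n generalizing j with
  | zero =>
    simp only [landauCoeff, Nat.cast_zero, Real.sqrt_zero, Complex.ofReal_zero, zero_mul, add_zero]
    have h : (√((j + 1).factorial : ℝ) : ℂ) = (√((j : ℝ) + 1) : ℂ) * (√(j.factorial : ℝ) : ℂ) := by
      rw [Nat.factorial_succ, Nat.cast_mul, Real.sqrt_mul (by positivity), Complex.ofReal_mul]
      push_cast; rfl
    have h1 := ofReal_sqrt_succ_ne_zero j
    have h2 : (√(j.factorial : ℝ) : ℂ) ≠ 0 := by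
      rw [Complex.ofReal_ne_zero]; positivity
    rw [h, pow_succ]
    field_simp
  | succ n ih =>
    have hn := ofReal_sqrt_succ_ne_zero n
    have hj : (√((j : ℝ) + 1) : ℂ) * (√((j : ℝ) + 1) : ℂ) = (j : ℂ) + 1 := by
      rw [ofReal_sqrt_mul_self (by positivity)]; push_cast; rfl
    have hn2 : (√((n : ℝ) + 1) : ℂ) * (√((n : ℝ) + 1) : ℂ) = (n : ℂ) + 1 := by
      rw [ofReal_sqrt_mul_self (by positivity)]; push_cast; rfl
    have h0 : (j : ℂ) * landauCoeff n j z = z * ((√(j : ℝ) : ℂ) * landauCoeff n (j - 1) z)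
        + (n : ℂ) * landauCoeff n j z + conj z * ((√(n : ℝ) : ℂ) * landauCoeff (n - 1) j z) := by
      have hnn : (√(n : ℝ) : ℂ) * (√(n : ℝ) : ℂ) = (n : ℂ) := by
        rw [ofReal_sqrt_mul_self (by positivity)]; push_cast; rfl
      have hb : (√(n : ℝ) : ℂ) * ((√(j : ℝ) : ℂ) * landauCoeff (n - 1) (j - 1) z)
          = (n : ℂ) * landauCoeff n j z + conj z * ((√(n : ℝ) : ℂ) * landauCoeff (n - 1) j z) := by
        rcases n with _ | m
        · simp
        · have := sqrt_mul_landauCoeff_pred m j z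
          simp only [Nat.add_sub_cancel]
          rw [this, ← hnn]
          push_cast
          ring
      rw [add_assoc, ← hb]
      rcases j with _ | i
      · simp
      · have hi := ih i
        have hii : (√((i : ℝ) + 1) : ℂ) * (√((i : ℝ) + 1) : ℂ) = (i : ℂ) + 1 := by
          rw [ofReal_sqrt_mul_self (by positivity)]; push_cast; rfl
        simp only [Nat.add_sub_cancel]
        push_cast
        rw [← hii]
        linear_combination (√((i : ℝ) + 1) : ℂ) * hi
    have e1 := sqrt_mul_landauCoeff_succ n (j + 1) z
    have e2 := sqrt_mul_landauCoeff_succ n j z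
    simp only [Nat.add_sub_cancel] at e1 ⊢
    apply mul_left_cancel₀ hn
    push_cast at e1 e2 ⊢
    have ihj := ih j
    linear_combination (√((j : ℝ) + 1) : ℂ) * e1 - z * e2 + landauCoeff n j z * hj
      - landauCoeff n j z * hn2 - conj z * ihj + h0

/-- The real-linear map `h ↦ p h + q h̄`. -/
def wirtingerMap (p q : ℂ) : ℂ →L[ℝ] ℂ :=
  p • ContinuousLinearMap.id ℝ ℂ + q • (Complex.conjCLE : ℂ →L[ℝ] ℂ)

@[simp] theorem wirtingerMap_apply (p q h : ℂ) : wirtingerMap p q h = p * h + q * conj h := by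
  simp [wirtingerMap]

theorem norm_wirtingerMap_le (p q : ℂ) : ‖wirtingerMap p q‖ ≤ ‖p‖ + ‖q‖ := by
  refine ContinuousLinearMap.opNorm_le_bound _ (by positivity) fun h => ?_
  rw [wirtingerMap_apply, add_mul]
  refine (norm_add_le _ _).trans (le_of_eq ?_)
  rw [norm_mul, norm_mul, RCLike.norm_conj]

theorem det_wirtingerMap (p q : ℂ) : (wirtingerMap p q).det = ‖p‖ ^ 2 - ‖q‖ ^ 2 := by
  rw [ContinuousLinearMap.det, ← LinearMap.det_toMatrix Complex.basisOneI, Matrix.det_fin_two]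
  simp only [LinearMap.toMatrix_apply, Complex.coe_basisOneI_repr, Complex.coe_basisOneI,
    ContinuousLinearMap.coe_coe, wirtingerMap_apply]
  simp only [Matrix.cons_val_zero, Matrix.cons_val_one, Complex.add_re, Complex.add_im,
    Complex.mul_re, Complex.mul_im, map_one, Complex.conj_I, Complex.one_re, Complex.one_im,
    Complex.I_re, Complex.I_im, Complex.neg_re, Complex.neg_im, Complex.sq_norm,
    Complex.normSq_apply]
  ring

theorem wirtingerDz_eq {f : ℂ → ℂ} {p q z : ℂ} (h : HasFDerivAt f (wirtingerMap p q) z) :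
    wirtingerDz f z = p := by
  rw [wirtingerDz, h.fderiv]
  simp only [wirtingerMap_apply, map_one, Complex.conj_I]
  linear_combination (-p / 2 + q / 2) * Complex.I_mul_I

theorem hasFDerivAt_landauCoeff (n j : ℕ) (z : ℂ) :
    HasFDerivAt (landauCoeff n j) (wirtingerMap ((√(j : ℝ) : ℂ) * landauCoeff n (j - 1) z)
      (-((√(n : ℝ) : ℂ) * landauCoeff (n - 1) j z))) z := by
  induction n generalizing j with
  | zero =>
    have h1 : HasDerivAt (landauCoeff 0 j)
        ((j : ℂ) * z ^ (j - 1) / (√(j.factorial : ℝ) : ℂ)) z := (hasDerivAt_pow j z).div_const _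
    refine (h1.hasFDerivAt.restrictScalars ℝ).congr_fderiv ?_
    ext h
    have e : (j : ℂ) * z ^ (j - 1) / (√(j.factorial : ℝ) : ℂ)
        = (√(j : ℝ) : ℂ) * landauCoeff 0 (j - 1) z := by
      rcases j with _ | i
      · simp
      · have h : (√((i + 1).factorial : ℝ) : ℂ)
            = (√((i : ℝ) + 1) : ℂ) * (√(i.factorial : ℝ) : ℂ) := by
          rw [Nat.factorial_succ, Nat.cast_mul, Real.sqrt_mul (by positivity), Complex.ofReal_mul]
          push_cast; rfl
        have hi : (√((i : ℝ) + 1) : ℂ) * (√((i : ℝ) + 1) : ℂ) = (i : ℂ) + 1 := by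
          rw [ofReal_sqrt_mul_self (by positivity)]; push_cast; rfl
        have h1 := ofReal_sqrt_succ_ne_zero i
        have h2 : (√(i.factorial : ℝ) : ℂ) ≠ 0 := by
          rw [Complex.ofReal_ne_zero]; positivity
        simp only [landauCoeff, Nat.add_sub_cancel]
        rw [h]
        push_cast
        rw [← hi]
        field_simp
    simp [e, mul_comm]
  | succ n ih =>
    have hconj : HasFDerivAt (fun z : ℂ => conj z) (Complex.conjCLE : ℂ →L[ℝ] ℂ) z :=
      Complex.conjCLE.hasFDerivAt
    have h1 := (((ih (j - 1)).const_mul (√(j : ℝ) : ℂ)).sub (hconj.mul (ih j))).mul_const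
      (√((n : ℝ) + 1) : ℂ)⁻¹
    have hfun : landauCoeff (n + 1) j = fun z => ((√(j : ℝ) : ℂ) * landauCoeff n (j - 1) z
        - conj z * landauCoeff n j z) * (√((n : ℝ) + 1) : ℂ)⁻¹ := by
      ext z; rw [landauCoeff, div_eq_mul_inv]
    rw [hfun]
    refine h1.congr_fderiv ?_
    have hn := ofReal_sqrt_succ_ne_zero n
    have hn2 : (√((n : ℝ) + 1) : ℂ) * (√((n : ℝ) + 1) : ℂ) = (n : ℂ) + 1 := by
      rw [ofReal_sqrt_mul_self (by positivity)]; push_cast; rfl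
    have hb : (√(n : ℝ) : ℂ) * ((√(j : ℝ) : ℂ) * landauCoeff (n - 1) (j - 1) z)
          = (n : ℂ) * landauCoeff n j z + conj z * ((√(n : ℝ) : ℂ) * landauCoeff (n - 1) j z) := by
      have hnn : (√(n : ℝ) : ℂ) * (√(n : ℝ) : ℂ) = (n : ℂ) := by
        rw [ofReal_sqrt_mul_self (by positivity)]; push_cast; rfl
      rcases n with _ | m
      · simp
      · have := sqrt_mul_landauCoeff_pred m j z
        simp only [Nat.add_sub_cancel]
        rw [this, ← hnn]
        push_cast
        ring
    have e2 := sqrt_mul_landauCoeff_succ n (j - 1) z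
    have hinv : (√((n : ℝ) + 1) : ℂ)⁻¹ * (√((n : ℝ) + 1) : ℂ) = 1 := inv_mul_cancel₀ hn
    ext h
    simp only [smul_apply, sub_apply,
      add_apply, wirtingerMap_apply, smul_eq_mul, Nat.add_sub_cancel,
      Nat.cast_add, Nat.cast_one]
    apply mul_left_cancel₀ hn
    simp only [ContinuousLinearEquiv.coe_coe, Complex.conjCLE_apply]
    rw [mul_inv_cancel_left₀ hn]
    linear_combination -(√(j : ℝ) : ℂ) * h * e2 - conj h * hb
      + conj h * landauCoeff n j z * hn2

/-- Coefficient sequences `c` for which `∑ c_j z ^ j / √(j!)` is entire. -/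
abbrev EntireSeq : Type := {c : ℕ → ℂ // ∀ R : ℕ, Summable fun j => ‖c j‖ * growth R j}

/-- The function `f_n` with coefficient sequence `c`. -/
def landauField (n : ℕ) (c : EntireSeq) (z : ℂ) : ℂ := ∑' j, c.1 j * landauCoeff n j z

theorem exists_norm_landauCoeff_le (n : ℕ) (r : ℝ) :
    ∃ C : ℝ, ∃ R : ℕ, 0 ≤ C ∧ r < R ∧ ∀ z : ℂ, ‖z‖ ≤ R → ∀ j,
      ‖landauCoeff n j z‖ ≤ C * growth (3 * R) j := by
  obtain ⟨R, hR⟩ := exists_nat_gt (max r 1)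
  refine ⟨n.factorial * Real.exp R, R, by positivity, (le_max_left _ _).trans_lt hR, ?_⟩
  intro z hz j
  have h1 : 1 ≤ R := by
    have : (1 : ℝ) < R := (le_max_right _ _).trans_lt hR
    exact_mod_cast this.le
  exact norm_landauCoeff_le h1 hz n j

theorem summable_norm_mul_landauCoeff (c : EntireSeq) (n : ℕ) (z : ℂ) :
    Summable fun j => ‖c.1 j * landauCoeff n j z‖ := by
  obtain ⟨C, R, hC, hR, h⟩ := exists_norm_landauCoeff_le n ‖z‖
  refine Summable.of_nonneg_of_le (fun j => norm_nonneg _) (fun j => ?_) ((c.2 (3 * R)).mul_left C)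
  rw [norm_mul]
  have := h z hR.le j
  calc _ ≤ ‖c.1 j‖ * (C * growth (3 * R) j) := by gcongr
    _ = _ := by ring

theorem summable_mul_landauCoeff (c : EntireSeq) (n : ℕ) (z : ℂ) :
    Summable fun j => c.1 j * landauCoeff n j z := (summable_norm_mul_landauCoeff c n z).of_norm

theorem wirtingerMap_eq_smul (a p q : ℂ) : a • wirtingerMap p q = wirtingerMap (a * p) (a * q) := by
  ext h; simp; ring

theorem tsum_wirtingerMap {p q : ℕ → ℂ} (hp : Summable p) (hq : Summable q) :
    ∑' j, wirtingerMap (p j) (q j) = wirtingerMap (∑' j, p j) (∑' j, q j) := by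
  simp only [wirtingerMap]
  have h1 : Summable fun j => p j • ContinuousLinearMap.id ℝ ℂ := hp.smul_const _
  have h2 : Summable fun j => q j • (Complex.conjCLE : ℂ →L[ℝ] ℂ) := hq.smul_const _
  rw [h1.tsum_add h2, hp.tsum_smul_const, hq.tsum_smul_const]

theorem hasFDerivAt_landauField (n : ℕ) (c : EntireSeq) (z : ℂ) :
    HasFDerivAt (landauField n c) (wirtingerMap
      ((√((n : ℝ) + 1) : ℂ) * landauField (n + 1) c z + conj z * landauField n c z)
      (-((√(n : ℝ) : ℂ) * landauField (n - 1) c z))) z := by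
  have hs0 := summable_mul_landauCoeff c n z
  have hs1 := summable_mul_landauCoeff c (n + 1) z
  have hs2 := summable_mul_landauCoeff c (n - 1) z
  have hp : ∀ w j, c.1 j * ((√(j : ℝ) : ℂ) * landauCoeff n (j - 1) w)
      = (√((n : ℝ) + 1) : ℂ) * (c.1 j * landauCoeff (n + 1) j w)
        + conj w * (c.1 j * landauCoeff n j w) := by
    intro w j
    rw [sqrt_mul_landauCoeff_pred]; ring
  have hq : ∀ w j, c.1 j * (-((√(n : ℝ) : ℂ) * landauCoeff (n - 1) j w))
      = -((√(n : ℝ) : ℂ) * (c.1 j * landauCoeff (n - 1) j w)) := by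
    intro w j; ring
  obtain ⟨R, hzR⟩ := exists_nat_gt (max ‖z‖ 1)
  have hR1 : 1 ≤ R := by
    have : (1 : ℝ) < R := (le_max_right _ _).trans_lt hzR
    exact_mod_cast this.le
  have hzR : ‖z‖ < R := (le_max_left _ _).trans_lt hzR
  set K : ℝ := √((n : ℝ) + 1) * ((n + 1).factorial * Real.exp R)
    + R * (n.factorial * Real.exp R) + √(n : ℝ) * ((n - 1).factorial * Real.exp R) with hK
  have key := hasFDerivAt_tsum_of_isPreconnected (𝕜 := ℝ)
    (f := fun j w => c.1 j * landauCoeff n j w)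
    (f' := fun j w => wirtingerMap (c.1 j * ((√(j : ℝ) : ℂ) * landauCoeff n (j - 1) w))
      (c.1 j * (-((√(n : ℝ) : ℂ) * landauCoeff (n - 1) j w))))
    (u := fun j => K * (‖c.1 j‖ * growth (3 * R) j)) (s := Metric.ball (0 : ℂ) R) (x₀ := z) (x := z)
    ((c.2 (3 * R)).mul_left K) Metric.isOpen_ball (convex_ball _ _).isPreconnected
    (fun j w _ => by
      rw [← wirtingerMap_eq_smul]
      exact (hasFDerivAt_landauCoeff n j w).const_mul (c.1 j))
    (fun j w hw => by
      have hw : ‖w‖ ≤ R := by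
        rw [Metric.mem_ball, dist_zero_right] at hw; exact hw.le
      refine (norm_wirtingerMap_le _ _).trans ?_
      rw [hp, hq, norm_neg]
      have b1 := norm_landauCoeff_le hR1 hw (n + 1) j
      have b2 := norm_landauCoeff_le hR1 hw n j
      have b3 := norm_landauCoeff_le hR1 hw (n - 1) j
      have hg := growth_nonneg (3 * R) j
      calc _ ≤ √((n : ℝ) + 1) * (‖c.1 j‖ * ‖landauCoeff (n + 1) j w‖)
            + ‖w‖ * (‖c.1 j‖ * ‖landauCoeff n j w‖)
            + √(n : ℝ) * (‖c.1 j‖ * ‖landauCoeff (n - 1) j w‖) := by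
            refine (add_le_add_left (norm_add_le _ _) _).trans (le_of_eq ?_)
            simp only [norm_mul, RCLike.norm_conj, Complex.norm_real, Real.norm_eq_abs,
              abs_of_nonneg (Real.sqrt_nonneg _)]
        _ ≤ √((n : ℝ) + 1) * (‖c.1 j‖ * ((n + 1).factorial * Real.exp R * growth (3 * R) j))
            + R * (‖c.1 j‖ * (n.factorial * Real.exp R * growth (3 * R) j))
            + √(n : ℝ) * (‖c.1 j‖ * ((n - 1).factorial * Real.exp R * growth (3 * R) j)) := by
            gcongr
        _ = _ := by rw [hK]; ring)
    (by rw [Metric.mem_ball, dist_zero_right]; exact hzR) hs0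
    (by rw [Metric.mem_ball, dist_zero_right]; exact hzR)
  refine key.congr_fderiv ?_
  have hs3 : Summable fun j => (√((n : ℝ) + 1) : ℂ) * (c.1 j * landauCoeff (n + 1) j z)
        + conj z * (c.1 j * landauCoeff n j z) := (hs1.mul_left _).add (hs0.mul_left _)
  have hs4 : Summable fun j => -((√(n : ℝ) : ℂ) * (c.1 j * landauCoeff (n - 1) j z)) :=
    (hs2.mul_left _).neg
  simp only [hp, hq]
  rw [tsum_wirtingerMap hs3 hs4, (hs1.mul_left _).tsum_add (hs0.mul_left _), tsum_neg,
    tsum_mul_left, tsum_mul_left, tsum_mul_left]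
  rfl

theorem continuous_landauField (n : ℕ) (c : EntireSeq) : Continuous (landauField n c) :=
  continuous_iff_continuousAt.2 fun z => (hasFDerivAt_landauField n c z).continuousAt

theorem landauRaise_const_mul_landauField (n : ℕ) (c : EntireSeq) (a : ℂ) :
    landauRaise (fun z => a * landauField n c z)
      = fun z => a * (√((n : ℝ) + 1) : ℂ) * landauField (n + 1) c z := by
  ext z
  have h := (hasFDerivAt_landauField n c z).const_mul a
  rw [wirtingerMap_eq_smul] at h
  rw [landauRaise, wirtingerDz_eq h]
  ring

theorem iterate_landauRaise_landauField (n : ℕ) (c : EntireSeq) :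
    landauRaise^[n] (landauField 0 c) = fun z => (√(n.factorial : ℝ) : ℂ) * landauField n c z := by
  induction n with
  | zero => ext z; simp
  | succ n ih =>
    rw [Function.iterate_succ_apply', ih, landauRaise_const_mul_landauField]
    ext z
    rw [Nat.factorial_succ, Nat.cast_mul, Real.sqrt_mul (by positivity), Complex.ofReal_mul]
    push_cast
    ring

theorem landauGaussian_eq_landauField {Ω : Type*} (ζ : ℕ → Ω → ℂ) (ω : Ω) (c : EntireSeq)
    (h : ∀ k, ζ k ω = c.1 k) (n : ℕ) : landauGaussian ζ n ω = landauField n c := by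
  have h0 : gaussianEntire ζ ω = landauField 0 c := by
    ext z
    rw [gaussianEntire, landauField]
    exact tsum_congr fun k => by rw [h k, landauCoeff]
  ext z
  rw [landauGaussian, h0, iterate_landauRaise_landauField, inv_mul_cancel_left₀]
  rw [Complex.ofReal_ne_zero]; positivity

/-- Square-summable sequences dominated by a multiple of some `R ^ j / √(j!)`. -/
def growthSubmodule : Submodule ℂ (lp (fun _ : ℕ => ℂ) 2) where
  carrier := {v | ∃ C : ℝ, ∃ R : ℕ, ∀ j, ‖v j‖ ≤ C * growth R j}
  zero_mem' := ⟨0, 0, fun j => by simp⟩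
  add_mem' := by
    rintro v w ⟨C, R, hv⟩ ⟨C', R', hw⟩
    refine ⟨|C| + |C'|, max R R', fun j => ?_⟩
    have h1 := growth_mono (le_max_left R R') j
    have h2 := growth_mono (le_max_right R R') j
    have h3 := growth_nonneg R j
    have h4 := growth_nonneg R' j
    calc ‖(v + w) j‖ ≤ ‖v j‖ + ‖w j‖ := by
          rw [lp.coeFn_add, Pi.add_apply]; exact norm_add_le _ _
      _ ≤ |C| * growth R j + |C'| * growth R' j :=
          add_le_add ((hv j).trans (by gcongr; exact le_abs_self C))
            ((hw j).trans (by gcongr; exact le_abs_self C'))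
      _ ≤ _ := by rw [add_mul]; gcongr
  smul_mem' := by
    rintro a v ⟨C, R, hv⟩
    refine ⟨‖a‖ * C, R, fun j => ?_⟩
    rw [lp.coeFn_smul, Pi.smul_apply, norm_smul, mul_assoc]
    gcongr
    exact hv j

instance : NormedAddCommGroup growthSubmodule := Submodule.normedAddCommGroup _

instance growthInnerProductSpace : InnerProductSpace ℂ growthSubmodule :=
  Submodule.innerProductSpace _

instance : Inner ℂ growthSubmodule := growthInnerProductSpace.toInner

theorem memℓp_of_growth {v : ℕ → ℂ} {C : ℝ} {R : ℕ} (h : ∀ j, ‖v j‖ ≤ C * growth R j) :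
    Memℓp v 2 := by
  have h1 : Memℓp v 1 := by
    refine memℓp_gen ?_
    simp only [ENNReal.toReal_one, Real.rpow_one]
    exact Summable.of_nonneg_of_le (fun j => norm_nonneg _) h ((summable_growth R).mul_left C)
  exact h1.of_exponent_ge (by norm_num)

/-- The element of `growthSubmodule` with given entries. -/
def growthVec (v : ℕ → ℂ) (h : ∃ C : ℝ, ∃ R : ℕ, ∀ j, ‖v j‖ ≤ C * growth R j) : growthSubmodule :=
  ⟨⟨v, memℓp_of_growth h.choose_spec.choose_spec⟩, h⟩

/-- The sequence `j ↦ φ_{n,j}(z)`. -/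
def landauVec (n : ℕ) (z : ℂ) : growthSubmodule :=
  growthVec (fun j => landauCoeff n j z) (by
    obtain ⟨C, R, _, hR, h⟩ := exists_norm_landauCoeff_le n ‖z‖
    exact ⟨C, 3 * R, h z hR.le⟩)

/-- The pairing `∑ v_j c_j`. -/
def pairing (v : growthSubmodule) (c : EntireSeq) : ℂ := ∑' j, v.1 j * c.1 j

theorem summable_norm_pairing (v : growthSubmodule) (c : EntireSeq) :
    Summable fun j => ‖v.1 j * c.1 j‖ := by
  obtain ⟨C, R, h⟩ := v.2
  refine Summable.of_nonneg_of_le (fun j => norm_nonneg _) (fun j => ?_) ((c.2 R).mul_left C)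
  rw [norm_mul]
  calc _ ≤ (C * growth R j) * ‖c.1 j‖ := by gcongr; exact h j
    _ = _ := by ring

theorem summable_pairing (v : growthSubmodule) (c : EntireSeq) :
    Summable fun j => v.1 j * c.1 j := (summable_norm_pairing v c).of_norm

theorem pairing_add (v w : growthSubmodule) (c : EntireSeq) :
    pairing (v + w) c = pairing v c + pairing w c := by
  rw [pairing, pairing, pairing, ← (summable_pairing v c).tsum_add (summable_pairing w c)]
  exact tsum_congr fun j => add_mul _ _ _

theorem pairing_smul (a : ℂ) (v : growthSubmodule) (c : EntireSeq) :
    pairing (a • v) c = a * pairing v c := by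
  rw [pairing, pairing, ← tsum_mul_left]
  exact tsum_congr fun j => mul_assoc _ _ _

theorem pairing_sub (v w : growthSubmodule) (c : EntireSeq) :
    pairing (v - w) c = pairing v c - pairing w c := by
  rw [pairing, pairing, pairing, ← (summable_pairing v c).tsum_sub (summable_pairing w c)]
  exact tsum_congr fun j => sub_mul _ _ _

theorem pairing_landauVec (n : ℕ) (z : ℂ) (c : EntireSeq) :
    pairing (landauVec n z) c = landauField n c z :=
  tsum_congr fun _ => mul_comm _ _

theorem hasSum_inner_growth (v w : growthSubmodule) :
    HasSum (fun j => conj (v.1 j) * w.1 j) (inner ℂ v w) := by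
  have := lp.hasSum_inner (𝕜 := ℂ) (G := fun _ : ℕ => ℂ) v.1 w.1
  simp only [RCLike.inner_apply] at this
  refine HasSum.congr_fun ?_ (fun _ => mul_comm _ _)
  exact this

theorem inner_landauVec_zero (z : ℂ) :
    inner ℂ (landauVec 0 z) (landauVec 0 z) = (Real.exp (‖z‖ ^ 2) : ℂ) := by
  have h := hasSum_inner_growth (landauVec 0 z) (landauVec 0 z)
  refine h.unique ?_
  have h2 := NormedSpace.expSeries_div_hasSum_exp (𝔸 := ℝ) (‖z‖ ^ 2)
  rw [← Real.exp_eq_exp_ℝ] at h2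
  refine (Complex.hasSum_ofReal.2 h2).congr_fun fun j => ?_
  change conj (landauCoeff 0 j z) * landauCoeff 0 j z = _
  rw [mul_comm, Complex.mul_conj, Complex.normSq_eq_norm_sq, landauCoeff, norm_div, norm_pow,
    Complex.norm_real, Real.norm_eq_abs, abs_of_nonneg (Real.sqrt_nonneg _), div_pow,
    Real.sq_sqrt (by positivity), ← pow_mul, ← pow_mul, mul_comm j 2]

theorem sqrt_mul_inner_landauVec (n m : ℕ) (z : ℂ) :
    (√(n : ℝ) : ℂ) * inner ℂ (landauVec m z) (landauVec (n - 1) z)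
      = (√((m : ℝ) + 1) : ℂ) * inner ℂ (landauVec (m + 1) z) (landauVec n z) := by
  set f : ℕ → ℂ := fun j => conj (landauCoeff m j z) *
    ((√((j : ℝ) + 1) : ℂ) * landauCoeff n (j + 1) z) with hf
  have h1 : HasSum f (z * inner ℂ (landauVec m z) (landauVec n z)
      + (√(n : ℝ) : ℂ) * inner ℂ (landauVec m z) (landauVec (n - 1) z)) := by
    refine (((hasSum_inner_growth (landauVec m z) (landauVec n z)).mul_left z).add
      ((hasSum_inner_growth (landauVec m z) (landauVec (n - 1) z)).mul_left
        (√(n : ℝ) : ℂ))).congr_fun fun j => ?_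
    rw [hf]
    dsimp only
    rw [sqrt_mul_landauCoeff_shift]
    change _ = z * (conj (landauCoeff m j z) * landauCoeff n j z)
      + (√(n : ℝ) : ℂ) * (conj (landauCoeff m j z) * landauCoeff (n - 1) j z)
    ring
  have h2 : HasSum f (z * inner ℂ (landauVec m z) (landauVec n z)
      + (√((m : ℝ) + 1) : ℂ) * inner ℂ (landauVec (m + 1) z) (landauVec n z)) := by
    have h3 := ((hasSum_inner_growth (landauVec m z) (landauVec n z)).mul_left z).add
      ((hasSum_inner_growth (landauVec (m + 1) z) (landauVec n z)).mul_left
        (√((m : ℝ) + 1) : ℂ))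
    have e : ∀ j, z * (conj ((landauVec m z).1 j) * (landauVec n z).1 j)
        + (√((m : ℝ) + 1) : ℂ) * (conj ((landauVec (m + 1) z).1 j) * (landauVec n z).1 j)
        = conj ((√(j : ℝ) : ℂ) * landauCoeff m (j - 1) z) * landauCoeff n j z := by
      intro j
      rw [sqrt_mul_landauCoeff_pred, map_add, map_mul, map_mul, Complex.conj_ofReal,
        Complex.conj_conj]
      change z * (conj (landauCoeff m j z) * landauCoeff n j z) + (√((m : ℝ) + 1) : ℂ) *
        (conj (landauCoeff (m + 1) j z) * landauCoeff n j z) = _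
      ring
    simp only [e] at h3
    rw [← hasSum_nat_add_iff' 1] at h3
    simp only [Finset.range_one, Finset.sum_singleton, Nat.cast_zero, Real.sqrt_zero,
      Complex.ofReal_zero, zero_mul, map_zero, sub_zero] at h3
    refine h3.congr_fun fun j => ?_
    rw [hf]
    simp only [map_mul, Complex.conj_ofReal, Nat.add_sub_cancel]
    push_cast
    ring
  exact add_left_cancel (h1.unique h2)

theorem inner_landauVec (n m : ℕ) (z : ℂ) :
    inner ℂ (landauVec m z) (landauVec n z) = if m = n then (Real.exp (‖z‖ ^ 2) : ℂ) else 0 := by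
  have hz : ∀ k, inner ℂ (landauVec (k + 1) z) (landauVec 0 z) = 0 := by
    intro k
    have := sqrt_mul_inner_landauVec 0 k z
    simp only [Nat.cast_zero, Real.sqrt_zero, Complex.ofReal_zero, zero_mul] at this
    exact (mul_eq_zero.1 this.symm).resolve_left (ofReal_sqrt_succ_ne_zero k)
  induction m generalizing n with
  | zero =>
    rcases n with _ | n
    · simpa using inner_landauVec_zero z
    · rw [← inner_conj_symm, hz]; simp
  | succ m ih =>
    rcases n with _ | n
    · rw [hz]; simp
    · have := sqrt_mul_inner_landauVec (n + 1) m z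
      simp only [Nat.add_sub_cancel] at this
      rw [ih] at this
      by_cases hmn : m = n
      · subst hmn
        simp only [if_true] at this ⊢
        push_cast at this
        push_cast
        exact (mul_left_cancel₀ (ofReal_sqrt_succ_ne_zero m) this).symm
      · simp only [hmn, if_false, mul_zero] at this
        rw [if_neg (by omega)]
        exact (mul_eq_zero.1 this.symm).resolve_left (ofReal_sqrt_succ_ne_zero m)

theorem norm_landauVec_sq (n : ℕ) (z : ℂ) : ‖landauVec n z‖ ^ 2 = Real.exp (‖z‖ ^ 2) := by
  have h := inner_landauVec n n z
  rw [if_pos rfl, inner_self_eq_norm_sq_to_K] at h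
  apply Complex.ofReal_injective
  rw [← h]
  exact Complex.ofReal_pow _ _

theorem landauVec_ne_zero (n : ℕ) (z : ℂ) : landauVec n z ≠ 0 := by
  intro h
  have := norm_landauVec_sq n z
  rw [h, norm_zero] at this
  have := Real.exp_pos (‖z‖ ^ 2)
  simp_all

/-- The operator `v ↦ (√(j+1) v_{j+1})_j`. -/
def lowering : Module.End ℂ (ℕ → ℂ) where
  toFun v j := (√((j : ℝ) + 1) : ℂ) * v (j + 1)
  map_add' v w := by ext j; simp [mul_add]
  map_smul' a v := by ext j; simp; ring

theorem lowering_landauCoeff (n : ℕ) (z : ℂ) :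
    (lowering - algebraMap ℂ (Module.End ℂ (ℕ → ℂ)) z) (fun j => landauCoeff n j z)
      = (√(n : ℝ) : ℂ) • fun j => landauCoeff (n - 1) j z := by
  ext j
  simp only [LinearMap.sub_apply, lowering, LinearMap.coe_mk, AddHom.coe_mk,
    Module.algebraMap_end_apply, Pi.sub_apply, Pi.smul_apply, smul_eq_mul,
    sqrt_mul_landauCoeff_shift]
  ring

theorem landauCoeff_mem_genEigenspace (n : ℕ) (z : ℂ) :
    (fun j => landauCoeff n j z) ∈ Module.End.genEigenspace lowering z ((n + 1 : ℕ) : ℕ∞) := by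
  rw [Module.End.mem_genEigenspace_nat, LinearMap.mem_ker]
  induction n with
  | zero =>
    have := lowering_landauCoeff 0 z
    simp only [Nat.cast_zero, Real.sqrt_zero, Complex.ofReal_zero, zero_smul] at this
    rw [zero_add, pow_one]
    exact this
  | succ n ih =>
    rw [pow_succ, Module.End.mul_apply]
    have := lowering_landauCoeff (n + 1) z
    simp only [Nat.add_sub_cancel] at this
    have h2 : (lowering - z • (1 : Module.End ℂ (ℕ → ℂ))) (fun j => landauCoeff (n + 1) j z)
      = (√((n + 1 : ℕ) : ℝ) : ℂ) • fun j => landauCoeff n j z := this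
    rw [h2, map_smul, ih, smul_zero]

theorem landauVec_ne_smul {n m : ℕ} (hnm : n ≠ m) (z w a : ℂ) :
    landauVec m w ≠ a • landauVec n z := by
  intro h
  have hseq : (fun j => landauCoeff m j w) = a • fun j => landauCoeff n j z := by
    ext j
    exact congrArg (fun v : growthSubmodule => v.1 j) h
  by_cases hzw : z = w
  · subst hzw
    have h1 : inner ℂ (landauVec m z) (landauVec m z) = 0 := by
      nth_rewrite 2 [h]
      rw [inner_smul_right, inner_landauVec, if_neg hnm.symm, mul_zero]
    exact landauVec_ne_zero m z (inner_self_eq_zero.1 h1)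
  · have h1 := landauCoeff_mem_genEigenspace m w
    have h2 : (fun j => landauCoeff m j w) ∈
        Module.End.genEigenspace lowering z ((n + 1 : ℕ) : ℕ∞) := by
      rw [hseq]
      exact Submodule.smul_mem _ _ (landauCoeff_mem_genEigenspace n z)
    have h3 := Submodule.disjoint_def.1
      (Module.End.disjoint_genEigenspace lowering hzw _ _) _ h2 h1
    refine landauVec_ne_zero m w ?_
    ext j
    exact congrFun h3 j

theorem exists_landauCoeff_ne_zero (n : ℕ) (z : ℂ) : ∃ i, landauCoeff n i z ≠ 0 := by
  by_contra! h
  exact landauVec_ne_zero n z (by ext j; exact h j)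

theorem exists_minor_ne_zero {n m : ℕ} (hnm : n ≠ m) (z w : ℂ) :
    ∃ i k, i ≠ k ∧ landauCoeff n i z * landauCoeff m k w
      - landauCoeff n k z * landauCoeff m i w ≠ 0 := by
  by_contra! h
  obtain ⟨i, hi⟩ := exists_landauCoeff_ne_zero n z
  refine landauVec_ne_smul hnm z w (landauCoeff m i w / landauCoeff n i z) ?_
  ext k
  change landauCoeff m k w = landauCoeff m i w / landauCoeff n i z * landauCoeff n k z
  by_cases hik : i = k
  · subst hik; field_simp
  · have := h i k hik
    field_simp
    linear_combination this

/-- The density of the centred complex Gaussian law of variance `s`. -/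
def complexGaussianPDF (s : ℝ) (x : ℂ) : ℝ := (Real.pi * s)⁻¹ * Real.exp (-‖x‖ ^ 2 / s)

theorem complexGaussianPDF_nonneg {s : ℝ} (hs : 0 ≤ s) (x : ℂ) : 0 ≤ complexGaussianPDF s x := by
  have := Real.pi_pos
  unfold complexGaussianPDF; positivity

theorem continuous_complexGaussianPDF (s : ℝ) : Continuous (complexGaussianPDF s) := by
  unfold complexGaussianPDF; fun_prop

theorem complexGaussianPDF_le {s : ℝ} (hs : 0 ≤ s) (x : ℂ) :
    complexGaussianPDF s x ≤ (Real.pi * s)⁻¹ := by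
  have := Real.pi_pos
  unfold complexGaussianPDF
  refine mul_le_of_le_one_right (by positivity) (Real.exp_le_one_iff.2 ?_)
  exact div_nonpos_of_nonpos_of_nonneg (by simp) hs

theorem complexGaussianPDF_zero (s : ℝ) : complexGaussianPDF s 0 = (Real.pi * s)⁻¹ := by
  simp [complexGaussianPDF]

theorem stdComplexGaussian_eq :
    stdComplexGaussian = (volume : Measure ℂ).withDensity
      fun x => ENNReal.ofReal (complexGaussianPDF 1 x) := by
  simp [stdComplexGaussian, complexGaussianPDF]

theorem integral_stdComplexGaussian {F : Type*} [NormedAddCommGroup F] [NormedSpace ℝ F]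
    (g : ℂ → F) : ∫ z, g z ∂stdComplexGaussian = ∫ z, complexGaussianPDF 1 z • g z := by
  rw [stdComplexGaussian_eq, integral_withDensity_eq_integral_toReal_smul
    (continuous_complexGaussianPDF 1).measurable.ennreal_ofReal (ae_of_all _ fun _ => by simp)]
  exact integral_congr_ae (ae_of_all _ fun z => by
    simp only [ENNReal.toReal_ofReal (complexGaussianPDF_nonneg zero_le_one z)])

theorem integral_cexp_stdComplexGaussian (u : ℂ) :
    ∫ z, Complex.exp (((u * z).re : ℂ) * Complex.I) ∂stdComplexGaussian
      = Complex.exp (-(‖u‖ ^ 2 / 4 : ℝ)) := by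
  rw [integral_stdComplexGaussian]
  have h := GaussianFourier.integral_cexp_neg_mul_sq_norm_add (V := ℂ) (b := 1) (by simp) Complex.I (conj u)
  have e : ∀ z : ℂ, complexGaussianPDF 1 z • Complex.exp (((u * z).re : ℂ) * Complex.I)
      = (Real.pi : ℂ)⁻¹ * Complex.exp (-1 * (‖z‖ : ℂ) ^ 2 + Complex.I * (inner ℝ (conj u) z : ℝ)) := by
    intro z
    have : (inner ℝ (conj u) z : ℝ) = (u * z).re := by
      rw [Complex.inner, Complex.conj_conj, mul_comm]
    rw [this, complexGaussianPDF, Complex.real_smul, Complex.exp_add]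
    push_cast
    rw [mul_one, div_one, mul_assoc, neg_one_mul, mul_comm Complex.I]
  simp only [e]
  rw [integral_const_mul, h]
  have hpi : (Real.pi : ℂ) ≠ 0 := by simp [Real.pi_ne_zero]
  rw [Complex.finrank_real_complex, RCLike.norm_conj]
  norm_num
  congr 1
  ring

instance : IsProbabilityMeasure stdComplexGaussian := by
  have h := integral_cexp_stdComplexGaussian 0
  simp only [zero_mul, Complex.zero_re, Complex.ofReal_zero, Complex.exp_zero, norm_zero] at h
  norm_num at h
  refine ⟨?_⟩
  have h2 : (stdComplexGaussian).real Set.univ = 1 := by exact_mod_cast h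
  rwa [measureReal_def, ENNReal.toReal_eq_one_iff] at h2

theorem integral_stdComplexGaussian_norm_sq (f : ℝ → ℝ) :
    ∫ z, f (‖z‖ ^ 2) ∂stdComplexGaussian = ∫ x in Set.Ioi (0 : ℝ), Real.exp (-x) * f x := by
  rw [integral_stdComplexGaussian]
  have h := integral_fun_norm_addHaar (volume : Measure ℂ)
    (fun r => Real.pi⁻¹ * Real.exp (-r ^ 2) * f (r ^ 2))
  have e : ∀ z : ℂ, complexGaussianPDF 1 z • f (‖z‖ ^ 2)
      = Real.pi⁻¹ * Real.exp (-‖z‖ ^ 2) * f (‖z‖ ^ 2) := by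
    intro z; simp [complexGaussianPDF]
  simp only [e]
  rw [h, Complex.finrank_real_complex]
  have hb : (volume : Measure ℂ).real (Metric.ball 0 1) = Real.pi := by
    rw [measureReal_def, Complex.volume_ball]; simp
  rw [hb, ← integral_comp_rpow_Ioi (fun x => Real.exp (-x) * f x) (p := 2) (by norm_num)]
  rw [nsmul_eq_mul, smul_eq_mul, ← integral_const_mul, ← integral_const_mul]
  refine setIntegral_congr_fun measurableSet_Ioi fun x _ => ?_
  have h2 : (2 : ℝ) - 1 = ((1 : ℕ) : ℝ) := by norm_num
  have hx2 : x ^ (2 : ℝ) = x ^ 2 := by exact_mod_cast Real.rpow_natCast x 2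
  simp only [h2, Real.rpow_natCast, hx2, smul_eq_mul]
  have := Real.pi_ne_zero
  norm_num
  field_simp

/-- The coordinates are independent standard complex Gaussian variables. -/
structure IsGaussianSeq (μ : Measure EntireSeq) : Prop where
  indep : iIndepFun (fun k (c : EntireSeq) => c.1 k) μ
  law : ∀ k, μ.map (fun c : EntireSeq => c.1 k) = stdComplexGaussian

theorem measurable_coord (k : ℕ) : Measurable fun c : EntireSeq => c.1 k :=
  (measurable_pi_apply k).comp measurable_subtype_coe

theorem tendsto_sum_pairing (v : growthSubmodule) (c : EntireSeq) :
    Tendsto (fun n => ∑ j ∈ Finset.range n, v.1 j * c.1 j) atTop (𝓝 (pairing v c)) :=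
  (summable_pairing v c).hasSum.tendsto_sum_nat

theorem measurable_pairing (v : growthSubmodule) : Measurable (pairing v) := by
  refine measurable_of_tendsto_metrizable (f := fun n (c : EntireSeq) =>
    ∑ j ∈ Finset.range n, v.1 j * c.1 j) (fun n => ?_)
    (tendsto_pi_nhds.2 fun c => tendsto_sum_pairing v c)
  exact Finset.measurable_sum _ fun j _ => (measurable_coord j).const_mul _

theorem hasSum_norm_sq_growth (v : growthSubmodule) :
    HasSum (fun j => ‖v.1 j‖ ^ 2) (‖v‖ ^ 2) := by
  have h := hasSum_inner_growth v v
  rw [inner_self_eq_norm_sq_to_K] at h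
  have e : ∀ j, conj (v.1 j) * v.1 j = ((‖v.1 j‖ ^ 2 : ℝ) : ℂ) := fun j => by
    rw [mul_comm, Complex.mul_conj, Complex.normSq_eq_norm_sq]
  simp only [e] at h
  exact Complex.hasSum_ofReal.1 (by rw [Complex.ofReal_pow]; exact h)

section Gaussian

variable {μ : Measure EntireSeq} [IsProbabilityMeasure μ]

theorem integral_cexp_sum (hμ : IsGaussianSeq μ) (v : growthSubmodule) (n : ℕ) :
    ∫ c : EntireSeq, Complex.exp (((∑ j ∈ Finset.range n, v.1 j * c.1 j).re : ℂ) * Complex.I) ∂μ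
      = Complex.exp (-((∑ j ∈ Finset.range n, ‖v.1 j‖ ^ 2) / 4 : ℝ)) := by
  have h1 : iIndepFun (fun (k : Finset.range n) (c : EntireSeq) => c.1 (k : ℕ)) μ :=
    hμ.indep.precomp Subtype.val_injective
  have h2 := iIndepFun.integral_fun_prod_comp
    (X := fun (k : Finset.range n) (c : EntireSeq) => c.1 (k : ℕ)) h1 (fun k => (measurable_coord (k : ℕ)).aemeasurable)
    (f := fun k z => Complex.exp (((v.1 (k : ℕ) * z).re : ℂ) * Complex.I))
    (fun k => (Continuous.aestronglyMeasurable (by fun_prop)))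
  have e1 : ∀ c : EntireSeq,
      Complex.exp (((∑ j ∈ Finset.range n, v.1 j * c.1 j).re : ℂ) * Complex.I)
      = ∏ k : Finset.range n, Complex.exp (((v.1 (k : ℕ) * c.1 (k : ℕ)).re : ℂ) * Complex.I) := by
    intro c
    rw [← Complex.exp_sum, ← Finset.sum_mul, Complex.re_sum, Complex.ofReal_sum,
      ← Finset.sum_coe_sort (Finset.range n)]
  have e2 : ∀ k : ℕ, ∫ c : EntireSeq, Complex.exp (((v.1 k * c.1 k).re : ℂ) * Complex.I) ∂μ
      = Complex.exp (-(‖v.1 k‖ ^ 2 / 4 : ℝ)) := by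
    intro k
    rw [← integral_cexp_stdComplexGaussian, ← hμ.law k,
      integral_map (measurable_coord k).aemeasurable
        (Continuous.aestronglyMeasurable (by fun_prop))]
  simp only [e1]
  rw [h2]
  simp only [e2]
  rw [← Complex.exp_sum, Finset.sum_coe_sort (Finset.range n)
    (fun k => (-((‖v.1 k‖ ^ 2 / 4 : ℝ) : ℂ)))]
  congr 1
  rw [Finset.sum_neg_distrib, Finset.sum_div, Complex.ofReal_sum]

theorem integral_cexp_pairing (hμ : IsGaussianSeq μ) (v : growthSubmodule) :
    ∫ c, Complex.exp (((pairing v c).re : ℂ) * Complex.I) ∂μ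
      = Complex.exp (-(‖v‖ ^ 2 / 4 : ℝ)) := by
  have h1 := tendsto_integral_of_dominated_convergence (μ := μ)
    (F := fun n c => Complex.exp (((∑ j ∈ Finset.range n, v.1 j * c.1 j).re : ℂ) * Complex.I))
    (f := fun c => Complex.exp (((pairing v c).re : ℂ) * Complex.I)) (fun _ => 1)
    (fun n => by
      refine Measurable.aestronglyMeasurable ?_
      have : Measurable fun c : EntireSeq => ∑ j ∈ Finset.range n, v.1 j * c.1 j :=
        Finset.measurable_sum _ fun j _ => (measurable_coord j).const_mul _
      have h2 : Continuous fun z : ℂ => Complex.exp ((z.re : ℂ) * Complex.I) := by fun_prop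
      exact h2.measurable.comp this)
    (integrable_const _)
    (fun n => ae_of_all _ fun c => by rw [Complex.norm_exp_ofReal_mul_I])
    (ae_of_all _ fun c => by
      have h2 : Continuous fun z : ℂ => Complex.exp ((z.re : ℂ) * Complex.I) := by fun_prop
      exact (h2.tendsto _).comp (tendsto_sum_pairing v c))
  refine tendsto_nhds_unique h1 ?_
  simp only [integral_cexp_sum hμ]
  have h3 : Continuous fun x : ℝ => Complex.exp (-(x / 4 : ℝ)) := by fun_prop
  exact (h3.tendsto _).comp (hasSum_norm_sq_growth v).tendsto_sum_nat

theorem pairing_sum {ι : Type*} (s : Finset ι) (v : ι → growthSubmodule) (c : EntireSeq) :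
    pairing (∑ i ∈ s, v i) c = ∑ i ∈ s, pairing (v i) c := by
  classical
  induction s using Finset.induction_on with
  | empty => simp [pairing]
  | insert a s ha ih => rw [Finset.sum_insert ha, Finset.sum_insert ha, pairing_add, ih]

theorem exists_dual_eq_re {ι : Type*} [Fintype ι] (L : StrongDual ℝ (ι → ℂ)) :
    ∃ u : ι → ℂ, ∀ x, L x = (∑ i, u i * x i).re := by
  classical
  refine ⟨fun i => L (Pi.single i 1) - Complex.I * L (Pi.single i Complex.I), fun x => ?_⟩
  have hx : x = ∑ i, ((x i).re • (Pi.single i (1 : ℂ) : ι → ℂ)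
      + (x i).im • (Pi.single i Complex.I : ι → ℂ)) := by
    ext k
    simp only [Finset.sum_apply, Pi.add_apply, Pi.smul_apply, Pi.single_apply]
    rw [Finset.sum_eq_single k]
    · simp
    · intro b _ hb
      simp [hb.symm]
    · simp
  conv_lhs => rw [hx]
  rw [map_sum, Complex.re_sum]
  refine Finset.sum_congr rfl fun i _ => ?_
  rw [map_add, map_smul, map_smul]
  simp
  ring

theorem measurable_pairing_family {ι : Type*} (v : ι → growthSubmodule) :
    Measurable fun c i => pairing (v i) c :=
  measurable_pi_lambda _ fun i => measurable_pairing (v i)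

variable {ι κ : Type*} [Fintype ι] [Fintype κ]

theorem charFunDual_map_pairing (hμ : IsGaussianSeq μ) (v : ι → growthSubmodule)
    {L : StrongDual ℝ (ι → ℂ)} {u : ι → ℂ} (hu : ∀ x, L x = (∑ i, u i * x i).re) :
    charFunDual (μ.map fun c i => pairing (v i) c) L
      = Complex.exp (-(‖∑ i, u i • v i‖ ^ 2 / 4 : ℝ)) := by
  rw [charFunDual_apply, integral_map (measurable_pairing_family v).aemeasurable
    (Continuous.aestronglyMeasurable (by fun_prop)), ← integral_cexp_pairing hμ]
  refine integral_congr_ae (ae_of_all _ fun c => ?_)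
  dsimp only
  rw [hu, pairing_sum]
  simp only [pairing_smul]

/-- The joint law of Gaussian pairings is determined by the Gram matrix. -/
theorem map_pairing_eq_of_inner_eq (hμ : IsGaussianSeq μ) {v w : ι → growthSubmodule}
    (h : ∀ i j, inner ℂ (v i) (v j) = inner ℂ (w i) (w j)) :
    μ.map (fun c i => pairing (v i) c) = μ.map (fun c i => pairing (w i) c) := by
  have := Measure.isProbabilityMeasure_map (μ := μ) (measurable_pairing_family v).aemeasurable
  have := Measure.isProbabilityMeasure_map (μ := μ) (measurable_pairing_family w).aemeasurable
  refine Measure.ext_of_charFunDual ?_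
  ext L
  obtain ⟨u, hu⟩ := exists_dual_eq_re L
  rw [charFunDual_map_pairing hμ v hu, charFunDual_map_pairing hμ w hu]
  have : ‖∑ i, u i • v i‖ ^ 2 = ‖∑ i, u i • w i‖ ^ 2 := by
    apply Complex.ofReal_injective
    rw [Complex.ofReal_pow, Complex.ofReal_pow]
    have hin : inner ℂ (∑ i, u i • v i) (∑ i, u i • v i)
        = inner ℂ (∑ i, u i • w i) (∑ i, u i • w i) := by
      simp only [sum_inner, inner_sum, inner_smul_left, inner_smul_right, h]
    rw [inner_self_eq_norm_sq_to_K, inner_self_eq_norm_sq_to_K] at hin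
    exact hin
  rw [this]

/-- Orthogonal families of Gaussian pairings are independent. -/
theorem indepFun_pairing (hμ : IsGaussianSeq μ) {v : ι → growthSubmodule}
    {w : κ → growthSubmodule} (h : ∀ i k, inner ℂ (v i) (w k) = 0) :
    IndepFun (fun c i => pairing (v i) c) (fun c k => pairing (w k) c) μ := by
  rw [indepFun_iff_charFunDual_prod (measurable_pairing_family v).aemeasurable
    (measurable_pairing_family w).aemeasurable]
  intro L
  obtain ⟨u, hu⟩ := exists_dual_eq_re (L.comp (.inl ℝ (ι → ℂ) (κ → ℂ)))
  obtain ⟨s, hs⟩ := exists_dual_eq_re (L.comp (.inr ℝ (ι → ℂ) (κ → ℂ)))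
  rw [charFunDual_map_pairing hμ v hu, charFunDual_map_pairing hμ w hs, ← Complex.exp_add]
  have hL : ∀ x y, L (x, y) = (∑ i, u i * x i).re + (∑ k, s k * y k).re := by
    intro x y
    rw [← hu, ← hs, ← ContinuousLinearMap.comp_inl_add_comp_inr]
  have horth : inner ℂ (∑ i, u i • v i) (∑ k, s k • w k) = 0 := by
    simp only [sum_inner, inner_sum, inner_smul_left, inner_smul_right, h, mul_zero,
      Finset.sum_const_zero]
  have hnorm : ‖∑ i, u i • v i + ∑ k, s k • w k‖ ^ 2
      = ‖∑ i, u i • v i‖ ^ 2 + ‖∑ k, s k • w k‖ ^ 2 := by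
    rw [norm_add_sq (𝕜 := ℂ), horth]; simp
  rw [charFunDual_apply, integral_map ((measurable_pairing_family v).prodMk
    (measurable_pairing_family w)).aemeasurable (Continuous.aestronglyMeasurable (by fun_prop))]
  have := integral_cexp_pairing hμ (∑ i, u i • v i + ∑ k, s k • w k)
  rw [hnorm] at this
  refine Eq.trans ?_ (this.trans ?_)
  · refine integral_congr_ae (ae_of_all _ fun c => ?_)
    dsimp only
    rw [hL, pairing_add, pairing_sum, pairing_sum, Complex.add_re]
    simp only [pairing_smul]
  · congr 1
    push_cast
    ring

end Gaussian

/-- The `k`-th unit sequence. -/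
def unitVec (k : ℕ) : growthSubmodule :=
  growthVec (fun j => if j = k then 1 else 0) ⟨√(k.factorial : ℝ), 1, fun j => by
    by_cases h : j = k
    · subst h
      have : √(j.factorial : ℝ) ≠ 0 := by positivity
      simp [growth, this]
    · simp only [h, if_false, norm_zero]
      exact mul_nonneg (Real.sqrt_nonneg _) (growth_nonneg _ _)⟩

theorem pairing_unitVec (k : ℕ) (c : EntireSeq) : pairing (unitVec k) c = c.1 k := by
  rw [pairing, tsum_eq_single k]
  · simp [unitVec, growthVec]
  · intro j hj; simp [unitVec, growthVec, hj]

theorem inner_unitVec (i k : ℕ) : inner ℂ (unitVec i) (unitVec k) = if i = k then 1 else 0 := by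
  refine (hasSum_inner_growth (unitVec i) (unitVec k)).unique ?_
  have h := hasSum_single (f := fun j => conj ((unitVec i).1 j) * (unitVec k).1 j) k (fun j hj => by
    simp [unitVec, growthVec, hj])
  convert h using 1
  by_cases hik : i = k
  · simp [unitVec, growthVec, hik]
  · simp [unitVec, growthVec, hik, Ne.symm hik]

theorem map_mul_stdComplexGaussian {r : ℝ} (hr : r ≠ 0) :
    stdComplexGaussian.map (fun z => (r : ℂ) * z)
      = (volume : Measure ℂ).withDensity fun x => ENNReal.ofReal (complexGaussianPDF (r ^ 2) x) := by
  have hm : Measurable fun z : ℂ => (r : ℂ) * z := by fun_prop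
  ext s hs
  rw [Measure.map_apply hm hs, stdComplexGaussian_eq, withDensity_apply _ hs,
    withDensity_apply _ (hm hs), ← lintegral_indicator hs, ← lintegral_indicator (hm hs)]
  have hdet : (wirtingerMap r 0).det = r ^ 2 := by
    rw [det_wirtingerMap]; simp
  have hpm : Measurable fun x => ENNReal.ofReal (r ^ 2) * ENNReal.ofReal (complexGaussianPDF (r ^ 2) x) :=
    (continuous_complexGaussianPDF _).measurable.ennreal_ofReal.const_mul _
  have h := lintegral_comp_affine (volume : Measure ℂ) (A := wirtingerMap r 0)
    (by rw [hdet]; positivity) 0 (hpm.indicator hs)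
  have hr2 : (0 : ℝ) < r ^ 2 := by positivity
  calc _ = ∫⁻ η, s.indicator (fun x => ENNReal.ofReal (r ^ 2) *
        ENNReal.ofReal (complexGaussianPDF (r ^ 2) x)) (wirtingerMap r 0 η + 0) := by
        refine lintegral_congr fun η => ?_
        have e : wirtingerMap r 0 η + 0 = r * η := by simp
        rw [e]
        by_cases hη : (r : ℂ) * η ∈ s
        · rw [Set.indicator_of_mem hη, Set.indicator_of_mem (by exact hη),
            ← ENNReal.ofReal_mul hr2.le]
          congr 1
          simp only [complexGaussianPDF, norm_mul, Complex.norm_real, Real.norm_eq_abs, mul_pow,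
            sq_abs]
          have h1 : -(r ^ 2 * ‖η‖ ^ 2) / r ^ 2 = -‖η‖ ^ 2 / 1 := by field_simp
          have := Real.pi_ne_zero
          rw [h1]
          field_simp
        · rw [Set.indicator_of_notMem hη, Set.indicator_of_notMem (by exact hη)]
    _ = _ := by
        rw [h, hdet, abs_of_pos hr2, ← lintegral_const_mul _ (hpm.indicator hs)]
        refine lintegral_congr fun x => ?_
        by_cases hx : x ∈ s
        · rw [Set.indicator_of_mem hx, Set.indicator_of_mem hx, ← mul_assoc,
            ← ENNReal.ofReal_mul (by positivity), inv_mul_cancel₀ hr2.ne']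
          simp
        · simp [hx]

section Law

variable {μ : Measure EntireSeq} [IsProbabilityMeasure μ]

theorem map_pairing (hμ : IsGaussianSeq μ) {v : growthSubmodule} (hv : v ≠ 0) :
    μ.map (pairing v) = (volume : Measure ℂ).withDensity
      fun x => ENNReal.ofReal (complexGaussianPDF (‖v‖ ^ 2) x) := by
  have h := map_pairing_eq_of_inner_eq hμ (ι := Unit) (v := fun _ => v)
    (w := fun _ => (‖v‖ : ℂ) • unitVec 0) (fun _ _ => by
      rw [inner_smul_left, inner_smul_right, inner_unitVec, inner_self_eq_norm_sq_to_K]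
      simp [sq])
  have h2 := congrArg (fun ν => ν.map fun f : Unit → ℂ => f ()) h
  rw [Measure.map_map (measurable_pi_apply _) (measurable_pairing_family _),
    Measure.map_map (measurable_pi_apply _) (measurable_pairing_family _)] at h2
  refine Eq.trans h2 ?_
  rw [← map_mul_stdComplexGaussian (norm_ne_zero_iff.2 hv), ← hμ.law 0,
    Measure.map_map (by fun_prop) (measurable_coord 0)]
  congr 1
  ext c
  exact (pairing_smul _ _ _).trans (congrArg _ (pairing_unitVec 0 c))

/-- The joint density of two linearly independent Gaussian pairings. -/
def pairDensity (s t : ℝ) (κ : ℂ) (x : ℂ × ℂ) : ℝ :=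
  complexGaussianPDF s x.1 * complexGaussianPDF t (x.2 - κ * x.1)

theorem continuous_pairDensity (s t : ℝ) (κ : ℂ) : Continuous (pairDensity s t κ) := by
  have h1 := continuous_complexGaussianPDF s
  have h2 := continuous_complexGaussianPDF t
  unfold pairDensity
  fun_prop

theorem prod_withDensity_complexGaussianPDF (s t : ℝ) (hs : 0 ≤ s) :
    ((volume : Measure ℂ).withDensity fun x => ENNReal.ofReal (complexGaussianPDF s x)).prod
      ((volume : Measure ℂ).withDensity fun x => ENNReal.ofReal (complexGaussianPDF t x))
      = (volume : Measure (ℂ × ℂ)).withDensity fun x => ENNReal.ofReal (pairDensity s t 0 x) := by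
  rw [prod_withDensity (continuous_complexGaussianPDF s).measurable.ennreal_ofReal
    (continuous_complexGaussianPDF t).measurable.ennreal_ofReal]
  congr 1
  ext x
  rw [← ENNReal.ofReal_mul (complexGaussianPDF_nonneg hs _), pairDensity, zero_mul, sub_zero]

theorem measurePreserving_shear (κ : ℂ) :
    MeasurePreserving (fun x : ℂ × ℂ => (x.1, x.2 + κ * x.1)) volume volume := by
  refine MeasurePreserving.skew_product (f := id) (g := fun x y => y + κ * x)
    (MeasurePreserving.id volume) ?_ (ae_of_all _ fun x => map_add_right_eq_self volume (κ * x))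
  have : Continuous (Function.uncurry fun x y : ℂ => y + κ * x) := by
    unfold Function.uncurry; fun_prop
  exact this.measurable

theorem map_pairing_prod (hμ : IsGaussianSeq μ) {a b : growthSubmodule} (κ : ℂ)
    (hab : inner ℂ a (b - κ • a) = 0) (ha : a ≠ 0) (hb : b - κ • a ≠ 0) :
    μ.map (fun c => (pairing a c, pairing b c)) = (volume : Measure (ℂ × ℂ)).withDensity
      fun x => ENNReal.ofReal (pairDensity (‖a‖ ^ 2) (‖b - κ • a‖ ^ 2) κ x) := by
  have hev : Measurable fun f : Unit → ℂ => f () := measurable_pi_apply ()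
  have hind : IndepFun (pairing a) (pairing (b - κ • a)) μ :=
    (indepFun_pairing hμ (ι := Unit) (κ := Unit) (v := fun _ => a) (w := fun _ => b - κ • a)
      (fun _ _ => hab)).comp hev hev
  rw [indepFun_iff_map_prod_eq_prod_map_map (measurable_pairing a).aemeasurable
    (measurable_pairing _).aemeasurable, map_pairing hμ ha, map_pairing hμ hb,
    prod_withDensity_complexGaussianPDF _ _ (by positivity)] at hind
  have hT := measurePreserving_shear κ
  have e : (fun c => (pairing a c, pairing b c))
      = (fun x : ℂ × ℂ => (x.1, x.2 + κ * x.1)) ∘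
        fun c => (pairing a c, pairing (b - κ • a) c) := by
    ext c
    · rfl
    · simp [pairing_sub, pairing_smul]
  rw [e, ← Measure.map_map hT.measurable ((measurable_pairing a).prodMk (measurable_pairing _)),
    hind]
  ext s hs
  rw [Measure.map_apply hT.measurable hs, withDensity_apply _ hs,
    withDensity_apply _ (hT.measurable hs),
    ← hT.setLIntegral_comp_preimage hs
      (continuous_pairDensity _ _ _).measurable.ennreal_ofReal]
  refine lintegral_congr fun x => ?_
  simp [pairDensity]

end Law

section Splitting

/-- Add `η` to the `i`-th coordinate. -/
def addCoord (i : ℕ) (η : ℂ) (c : EntireSeq) : EntireSeq :=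
  ⟨fun j => c.1 j + if j = i then η else 0, fun R => by
    have h : Summable fun j => ‖if j = i then η else 0‖ * growth R j :=
      summable_of_ne_finset_zero (s := {i}) fun j hj => by
        simp only [Finset.mem_singleton] at hj; simp [hj]
    refine Summable.of_nonneg_of_le (fun j => mul_nonneg (norm_nonneg _) (growth_nonneg _ _))
      (fun j => ?_) ((c.2 R).add h)
    rw [← add_mul]
    exact mul_le_mul_of_nonneg_right (norm_add_le _ _) (growth_nonneg _ _)⟩

theorem landauField_addCoord (n i : ℕ) (η : ℂ) (c : EntireSeq) (z : ℂ) :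
    landauField n (addCoord i η c) z = landauCoeff n i z * η + landauField n c z := by
  have h : HasSum (fun j => (if j = i then η else 0) * landauCoeff n j z)
      (landauCoeff n i z * η) := by
    convert hasSum_single (f := fun j => (if j = i then η else 0) * landauCoeff n j z) i
      (fun j hj => by simp [hj]) using 1
    simp [mul_comm]
  rw [landauField, add_comm]
  refine HasSum.tsum_eq ?_
  refine ((summable_mul_landauCoeff c n z).hasSum.add h).congr_fun fun j => ?_
  simp [addCoord, add_mul]

theorem measurable_addCoord (i : ℕ) : Measurable fun x : ℂ × EntireSeq => addCoord i x.1 x.2 := by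
  refine Measurable.subtype_mk (measurable_pi_lambda _ fun j => ?_)
  refine ((measurable_coord j).comp measurable_snd).add ?_
  by_cases h : j = i
  · simpa [h] using measurable_fst
  · simp [h]

/-- Replace the coordinates in `J` by `0`. -/
def zeroOut (J : Finset ℕ) (c : EntireSeq) : EntireSeq :=
  ⟨fun j => if j ∈ J then 0 else c.1 j, fun R => by
    refine Summable.of_nonneg_of_le (fun j => mul_nonneg (norm_nonneg _) (growth_nonneg _ _))
      (fun j => ?_) (c.2 R)
    refine mul_le_mul_of_nonneg_right ?_ (growth_nonneg _ _)
    by_cases h : j ∈ J <;> simp [h]⟩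

theorem measurable_zeroOut (J : Finset ℕ) : Measurable (zeroOut J) := by
  refine Measurable.subtype_mk (measurable_pi_lambda _ fun j => ?_)
  by_cases h : j ∈ J
  · simp [h]
  · simpa [h] using measurable_coord j

theorem addCoord_zeroOut (i : ℕ) (c : EntireSeq) : addCoord i (c.1 i) (zeroOut {i} c) = c := by
  ext j
  by_cases h : j = i <;> simp [addCoord, zeroOut, h]

theorem addCoord_addCoord_zeroOut {i k : ℕ} (hik : i ≠ k) (c : EntireSeq) :
    addCoord i (c.1 i) (addCoord k (c.1 k) (zeroOut {i, k} c)) = c := by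
  ext j
  by_cases h : j = i
  · subst h; simp [addCoord, zeroOut, hik]
  · by_cases h' : j = k
    · subst h'; simp [addCoord, zeroOut, h]
    · simp [addCoord, zeroOut, h, h']

variable {μ : Measure EntireSeq} [IsProbabilityMeasure μ]

theorem measurable_entireSeq {α : Type*} [MeasurableSpace α] {f : α → EntireSeq}
    (h : ∀ j, Measurable fun a => (f a).1 j) : Measurable f :=
  Measurable.subtype_mk (measurable_pi_lambda _ h)

theorem indepFun_zeroOut (hμ : IsGaussianSeq μ) (J : Finset ℕ) :
    IndepFun (fun (c : EntireSeq) (k : J) => c.1 (k : ℕ)) (zeroOut J) μ := by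
  have h := indep_iSup_of_disjoint (m := fun k => MeasurableSpace.comap
    (fun c : EntireSeq => c.1 k) inferInstance) (fun k => (measurable_coord k).comap_le) hμ.indep
    (S := (J : Set ℕ)) (T := (J : Set ℕ)ᶜ) disjoint_compl_right
  rw [IndepFun_iff_Indep]
  refine indep_of_indep_of_le_left (indep_of_indep_of_le_right h ?_) ?_
  · rw [← measurable_iff_comap_le]
    refine @measurable_entireSeq _ (_) _ fun j => ?_
    by_cases hj : j ∈ J
    · simp only [zeroOut, hj, if_true]; exact measurable_const
    · simp only [zeroOut, hj, if_false]
      rw [measurable_iff_comap_le]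
      exact le_iSup₂_of_le j (by simpa using hj) le_rfl
  · rw [← measurable_iff_comap_le]
    refine @measurable_pi_lambda _ _ _ (_) _ _ fun k => ?_
    rw [measurable_iff_comap_le]
    exact le_iSup₂_of_le (k : ℕ) k.2 le_rfl

theorem map_addCoord (hμ : IsGaussianSeq μ) (i : ℕ) :
    (stdComplexGaussian.prod (μ.map (zeroOut {i}))).map (fun x => addCoord i x.1 x.2) = μ := by
  have h : IndepFun (fun c : EntireSeq => c.1 i) (zeroOut {i}) μ :=
    (indepFun_zeroOut hμ {i}).comp
      (measurable_pi_apply (⟨i, by simp⟩ : ({i} : Finset ℕ))) measurable_id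
  rw [indepFun_iff_map_prod_eq_prod_map_map (measurable_coord i).aemeasurable
    (measurable_zeroOut _).aemeasurable, hμ.law] at h
  rw [← h, Measure.map_map (measurable_addCoord i) ((measurable_coord i).prodMk
    (measurable_zeroOut _))]
  have : ((fun x : ℂ × EntireSeq => addCoord i x.1 x.2) ∘ fun c : EntireSeq =>
      (c.1 i, zeroOut {i} c)) = id := by
    ext1 c; exact addCoord_zeroOut i c
  rw [this, Measure.map_id]

theorem measurable_addCoord_addCoord (i k : ℕ) : Measurable fun x : (ℂ × ℂ) × EntireSeq =>
    addCoord i x.1.1 (addCoord k x.1.2 x.2) :=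
  (measurable_addCoord i).comp ((measurable_fst.comp measurable_fst).prodMk
    ((measurable_addCoord k).comp ((measurable_snd.comp measurable_fst).prodMk measurable_snd)))

theorem map_addCoord_addCoord (hμ : IsGaussianSeq μ) {i k : ℕ} (hik : i ≠ k) :
    ((stdComplexGaussian.prod stdComplexGaussian).prod (μ.map (zeroOut {i, k}))).map
      (fun x => addCoord i x.1.1 (addCoord k x.1.2 x.2)) = μ := by
  have h : IndepFun (fun c : EntireSeq => (c.1 i, c.1 k)) (zeroOut {i, k}) μ :=
    (indepFun_zeroOut hμ {i, k}).comp (φ := fun f => (f ⟨i, by simp⟩, f ⟨k, by simp⟩)) (ψ := id)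
      ((measurable_pi_apply _).prodMk (measurable_pi_apply _)) measurable_id
  have h2 := hμ.indep.indepFun hik
  have hm : Measurable fun c : EntireSeq => (c.1 i, c.1 k) :=
    (measurable_coord i).prodMk (measurable_coord k)
  rw [indepFun_iff_map_prod_eq_prod_map_map (measurable_coord i).aemeasurable
    (measurable_coord k).aemeasurable, hμ.law, hμ.law] at h2
  rw [indepFun_iff_map_prod_eq_prod_map_map hm.aemeasurable
    (measurable_zeroOut _).aemeasurable, h2] at h
  rw [← h, Measure.map_map (measurable_addCoord_addCoord i k) (hm.prodMk (measurable_zeroOut _))]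
  have : ((fun x : (ℂ × ℂ) × EntireSeq => addCoord i x.1.1 (addCoord k x.1.2 x.2)) ∘
      fun c : EntireSeq => ((c.1 i, c.1 k), zeroOut {i, k} c)) = id := by
    ext1 c; exact addCoord_addCoord_zeroOut hik c
  rw [this, Measure.map_id]

end Splitting

section Moments

theorem integral_exp_neg_mul_pow (n : ℕ) :
    ∫ x in Set.Ioi (0 : ℝ), Real.exp (-x) * x ^ n = n.factorial := by
  rw [← Real.Gamma_nat_eq_factorial, Real.Gamma_eq_integral (by positivity)]
  refine setIntegral_congr_fun measurableSet_Ioi fun x _ => ?_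
  simp

theorem integrable_norm_pow_four : Integrable (fun z : ℂ => ‖z‖ ^ 4) stdComplexGaussian := by
  refine Integrable.of_integral_ne_zero ?_
  have h := integral_stdComplexGaussian_norm_sq (fun x => x ^ 2)
  rw [integral_exp_neg_mul_pow] at h
  have e : ∀ z : ℂ, (‖z‖ ^ 2) ^ 2 = ‖z‖ ^ 4 := fun z => by ring
  simp only [e] at h
  rw [h]; norm_num

/-- The dominating series `∑ |c_j| R ^ j / √(j!)`. -/
def growthSum (R : ℕ) (c : EntireSeq) : ℝ := ∑' j, ‖c.1 j‖ * growth R j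

theorem growthSum_nonneg (R : ℕ) (c : EntireSeq) : 0 ≤ growthSum R c :=
  tsum_nonneg fun _ => mul_nonneg (norm_nonneg _) (growth_nonneg _ _)

theorem measurable_growthSum (R : ℕ) : Measurable (growthSum R) := by
  refine measurable_of_tendsto_metrizable (f := fun n (c : EntireSeq) =>
    ∑ j ∈ Finset.range n, ‖c.1 j‖ * growth R j) (fun n => ?_)
    (tendsto_pi_nhds.2 fun c => (c.2 R).hasSum.tendsto_sum_nat)
  exact Finset.measurable_sum _ fun j _ => (measurable_coord j).norm.mul_const _

theorem norm_pairing_le {v : growthSubmodule} {C : ℝ} {R : ℕ}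
    (h : ∀ j, ‖v.1 j‖ ≤ C * growth R j) (c : EntireSeq) :
    ‖pairing v c‖ ≤ C * growthSum R c := by
  rw [growthSum, ← tsum_mul_left]
  refine (norm_tsum_le_tsum_norm (summable_norm_pairing v c)).trans
    ((summable_norm_pairing v c).tsum_le_tsum (fun j => ?_) ((c.2 R).mul_left C))
  rw [norm_mul]
  calc _ ≤ (C * growth R j) * ‖c.1 j‖ := by gcongr; exact h j
    _ = _ := by ring

theorem growthSum_pow_four_le (R : ℕ) (c : EntireSeq) :
    ENNReal.ofReal (growthSum R c ^ 4)
      ≤ 16 * ∑' j, ENNReal.ofReal (‖c.1 j‖ ^ 4 * growth (2 * R) j ^ 4) := by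
  set T := ∑' j, ENNReal.ofReal (‖c.1 j‖ ^ 4 * growth (2 * R) j ^ 4) with hT
  have h1 : ∀ j, ENNReal.ofReal (‖c.1 j‖ * growth R j) ≤ T ^ (1 / 4 : ℝ) * (2 : ℝ≥0∞)⁻¹ ^ j := by
    intro j
    have hg : growth R j = growth (2 * R) j * (2⁻¹) ^ j := by
      rw [growth_mul, mul_comm, ← mul_assoc, ← mul_pow]; norm_num
    have hle : ENNReal.ofReal (‖c.1 j‖ * growth (2 * R) j) ^ (4 : ℝ) ≤ T := by
      refine le_trans (le_of_eq ?_) (ENNReal.le_tsum j)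
      rw [ENNReal.ofReal_rpow_of_nonneg (mul_nonneg (norm_nonneg _) (growth_nonneg _ _))
        (by norm_num), ← mul_pow]
      norm_cast
    have hle2 : ENNReal.ofReal (‖c.1 j‖ * growth (2 * R) j) ≤ T ^ (1 / 4 : ℝ) := by
      have := ENNReal.rpow_le_rpow hle (z := (1 / 4 : ℝ)) (by norm_num)
      rwa [← ENNReal.rpow_mul, mul_one_div_cancel (by norm_num), ENNReal.rpow_one] at this
    rw [hg, ← mul_assoc, ENNReal.ofReal_mul (mul_nonneg (norm_nonneg _) (growth_nonneg _ _)),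
      ENNReal.ofReal_pow (by norm_num), ENNReal.ofReal_inv_of_pos (by norm_num)]
    gcongr
    norm_num
  have h2 : ENNReal.ofReal (growthSum R c) ≤ T ^ (1 / 4 : ℝ) * 2 := by
    rw [growthSum, ENNReal.ofReal_tsum_of_nonneg
      (fun j => mul_nonneg (norm_nonneg _) (growth_nonneg _ _)) (c.2 R)]
    refine (ENNReal.tsum_le_tsum h1).trans (le_of_eq ?_)
    rw [ENNReal.tsum_mul_left, ENNReal.tsum_geometric, ENNReal.one_sub_inv_two, inv_inv]
  calc ENNReal.ofReal (growthSum R c ^ 4) = ENNReal.ofReal (growthSum R c) ^ 4 :=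
        ENNReal.ofReal_pow (growthSum_nonneg R c) 4
    _ ≤ (T ^ (1 / 4 : ℝ) * 2) ^ 4 := by gcongr
    _ = _ := by
      rw [mul_pow, ← ENNReal.rpow_natCast (T ^ (1 / 4 : ℝ)) 4, ← ENNReal.rpow_mul]
      norm_num
      rw [mul_comm]

variable {μ : Measure EntireSeq} [IsProbabilityMeasure μ]

theorem integrable_growthSum_pow_four (hμ : IsGaussianSeq μ) (R : ℕ) :
    Integrable (fun c => growthSum R c ^ 4) μ := by
  refine ⟨((measurable_growthSum R).pow_const 4).aestronglyMeasurable, ?_⟩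
  rw [hasFiniteIntegral_iff_ofReal (ae_of_all _ fun c => pow_nonneg (growthSum_nonneg R c) 4)]
  refine (lintegral_mono (growthSum_pow_four_le R)).trans_lt ?_
  set M := ∫⁻ z, ENNReal.ofReal (‖z‖ ^ 4) ∂stdComplexGaussian with hM
  have hMfin : M < ∞ :=
    (hasFiniteIntegral_iff_ofReal (ae_of_all _ fun z => by positivity)).1 integrable_norm_pow_four.2
  have hmj : ∀ j, Measurable fun c : EntireSeq => ENNReal.ofReal (‖c.1 j‖ ^ 4) := fun j =>
    ((measurable_coord j).norm.pow_const 4).ennreal_ofReal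
  have hmom : ∀ j, ∫⁻ c : EntireSeq, ENNReal.ofReal (‖c.1 j‖ ^ 4 * growth (2 * R) j ^ 4) ∂μ
      = M * ENNReal.ofReal (growth (2 * R) j ^ 4) := by
    intro j
    have : ∀ c : EntireSeq, ENNReal.ofReal (‖c.1 j‖ ^ 4 * growth (2 * R) j ^ 4)
        = ENNReal.ofReal (‖c.1 j‖ ^ 4) * ENNReal.ofReal (growth (2 * R) j ^ 4) := fun c =>
      ENNReal.ofReal_mul (by positivity)
    simp only [this]
    rw [lintegral_mul_const _ (hmj j), hM, ← hμ.law j, lintegral_map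
      (measurable_norm.pow_const 4).ennreal_ofReal (measurable_coord j)]
  rw [lintegral_const_mul _ (Measurable.tsum fun j =>
    (((measurable_coord j).norm.pow_const 4).mul_const _).ennreal_ofReal),
    lintegral_tsum fun j => (((measurable_coord j).norm.pow_const 4).mul_const
      _).ennreal_ofReal.aemeasurable]
  simp only [hmom]
  rw [ENNReal.tsum_mul_left]
  have hs : Summable fun j => growth (2 * R) j ^ 4 := by
    refine Summable.of_nonneg_of_le (fun j => pow_nonneg (growth_nonneg _ _) 4) (fun j => ?_)
      ((summable_growth (2 * R)).mul_left (Real.exp (((2 * R : ℕ) : ℝ) ^ 2) ^ 3))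
    have h1 := growth_le_exp (2 * R) j
    have h2 := growth_nonneg (2 * R) j
    calc growth (2 * R) j ^ 4 = growth (2 * R) j ^ 3 * growth (2 * R) j := by ring
      _ ≤ _ := by gcongr
  rw [← ENNReal.ofReal_tsum_of_nonneg (fun j => pow_nonneg (growth_nonneg _ _) 4) hs]
  exact ENNReal.mul_lt_top (by norm_num) (ENNReal.mul_lt_top hMfin ENNReal.ofReal_lt_top)

end Moments

theorem IndepFun.comp_measurePreserving {α β γ δ : Type*} [MeasurableSpace α] [MeasurableSpace β]
    [MeasurableSpace γ] [MeasurableSpace δ] {Q : Measure α} [IsProbabilityMeasure Q] {m : α → β}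
    (hm : Measurable m) {X : β → γ} {Y : β → δ} (hX : Measurable X) (hY : Measurable Y)
    (h : IndepFun X Y (Q.map m)) : IndepFun (fun a => X (m a)) (fun a => Y (m a)) Q := by
  have := Measure.isProbabilityMeasure_map (μ := Q) hm.aemeasurable
  rw [indepFun_iff_map_prod_eq_prod_map_map hX.aemeasurable hY.aemeasurable,
    Measure.map_map (hX.prodMk hY) hm, Measure.map_map hX hm, Measure.map_map hY hm] at h
  exact (indepFun_iff_map_prod_eq_prod_map_map (hX.comp hm).aemeasurable
    (hY.comp hm).aemeasurable).2 h

/-- The Kac–Rice formula for a random field which is affine in finitely many coordinates. -/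
theorem lintegral_encard_zeros_eq {E Ω R : Type*} [NormedAddCommGroup E] [NormedSpace ℝ E]
    [FiniteDimensional ℝ E] [MeasurableSpace E] [BorelSpace E] [MeasurableSpace Ω]
    [MeasurableSpace R] (vol : Measure E) [vol.IsAddHaarMeasure]
    {μ : Measure Ω} {ν : Measure R} [IsProbabilityMeasure ν]
    {p : E → ℝ} (hp : Continuous p) (hp0 : ∀ x, 0 ≤ p x) {C : ℝ} (hpC : ∀ x, p x ≤ C)
    [IsProbabilityMeasure (vol.withDensity fun x => ENNReal.ofReal (p x))]
    {m : E × R → Ω} (hm : Measurable m)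
    (hmap : ((vol.withDensity fun x => ENNReal.ofReal (p x)).prod ν).map m = μ)
    {F : Ω → E → E} (hFc : ∀ c, Continuous (F c)) (hFm : ∀ t, Measurable fun c => F c t)
    {A : E → E →L[ℝ] E} {h : R → E → E} (hF : ∀ x t, F (m x) t = A t x.1 + h x.2 t)
    {N : Set E} (hAm : Measurable A) (hhm : Measurable fun x : R × E => h x.1 x.2)
    (hA : ∀ t ∈ N, DifferentiableAt ℝ A t) (hdet : ∀ t ∈ N, (A t).det ≠ 0)
    (hh : ∀ r, ∀ t ∈ N, DifferentiableAt ℝ (h r) t)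
    {D : Ω → E → ℝ} (hDm : Measurable fun x : Ω × E => D x.1 x.2)
    (hD : ∀ c t, F c t = 0 → D c t = |(fderiv ℝ (F c) t).det|)
    {G : E → Ω → ℝ} (hGm : ∀ t, Measurable (G t)) (hG0 : ∀ t c, 0 ≤ G t c)
    (hGc : ∀ t r, Continuous fun η => G t (m (η, r)))
    (hGD : ∀ t c, F c t = 0 → G t c = D c t)
    (hind : ∀ t ∈ N, IndepFun (fun c => F c t) (G t) μ)
    {q : E → E → ℝ} (hq : ∀ t, Continuous (q t))
    (hlaw : ∀ t ∈ N, μ.map (fun c => F c t) = vol.withDensity fun x => ENNReal.ofReal (q t x))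
    {U : Set E} (hU : IsOpen U) (hUN : U ⊆ N) :
    ∫⁻ c, (({t | t ∈ U ∧ F c t = 0}.encard : ℕ∞) : ℝ≥0∞) ∂μ
      = ∫⁻ t in U, ENNReal.ofReal (q t 0) * ∫⁻ c, ENNReal.ofReal (G t c) ∂μ ∂vol := by
  set γ := vol.withDensity fun x => ENNReal.ofReal (p x) with hγ
  have hcm := measurable_encard_zeros hFc hFm hU
  have hFeq : ∀ x : E × R, F (m x) = fun t => A t x.1 + h x.2 t := fun x => funext (hF x)
  have e0 : ∀ x : E × R, {t | t ∈ U ∧ F (m x) t = 0} = {t | t ∈ U ∧ A t x.1 + h x.2 t = 0} := by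
    intro x; simp only [hF]
  have hcm2 := hcm.comp hm
  rw [← hmap, lintegral_map hcm hm]
  have h1 := lintegral_encard_zeros_prod vol ν (p := fun x => ENNReal.ofReal (p x))
    hp.measurable.ennreal_ofReal (fun _ => ENNReal.ofReal_lt_top) hU.measurableSet hAm hhm
    (fun t ht => hA t (hUN ht)) (fun t ht => hdet t (hUN ht)) (fun r t ht => hh r t (hUN ht))
    (D := fun η r t => ENNReal.ofReal (D (m (η, r)) t))
    (hDm.comp ((hm.comp (measurable_fst.prodMk (measurable_fst.comp measurable_snd))).prodMk
      (measurable_snd.comp measurable_snd))).ennreal_ofReal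
    (fun η r t _ h0 => by
      rw [hD _ _ ((hF (η, r) t).trans h0), hFeq (η, r)])
    (by
      simp only [← e0]
      exact hcm2.aemeasurable)
  simp only [e0]
  rw [h1]
  refine setLIntegral_congr_fun hU.measurableSet fun t ht => ?_
  have hdt := hdet t (hUN ht)
  have hht : Measurable fun r => h r t := hhm.comp (measurable_id.prodMk measurable_const)
  have h2 := lintegral_affineZero_eq vol ν hp hp0 hpC (hq t) hdt hht
    (G := fun η r => G t (m (η, r))) ((hGm t).comp hm) (fun _ _ => hG0 _ _) (hGc t)
    (by
      have := IndepFun.comp_measurePreserving (Q := γ.prod ν) hm (hFm t) (hGm t)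
        (by rw [hmap]; exact hind t (hUN ht))
      simp only [hF] at this
      exact this)
    (by
      rw [← hlaw t (hUN ht), ← hmap, Measure.map_map (hFm t) hm]
      congr 1
      ext1 x
      exact (hF x t).symm)
  rw [lintegral_map (hGm t).ennreal_ofReal hm]
  refine Eq.trans (lintegral_congr fun r => ?_) h2
  rw [hGD]
  exact (hF (affineZero (A t) (h r t), r) t).trans (apply_affineZero hdt _)

/-- At a zero of `f_n`, the `∂_z`-derivative of `f_n` is the pairing with this vector. -/
def raiseVec (n : ℕ) (z : ℂ) : growthSubmodule := (√((n : ℝ) + 1) : ℂ) • landauVec (n + 1) z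

/-- At a zero of `f_n`, the `∂_z̄`-derivative of `f_n` is minus the pairing with this vector. -/
def lowerVec (n : ℕ) (z : ℂ) : growthSubmodule := (√(n : ℝ) : ℂ) • landauVec (n - 1) z

/-- The difference of squared moduli of two pairings. -/
def pairingJac (v w : growthSubmodule) (c : EntireSeq) : ℝ := ‖pairing v c‖ ^ 2 - ‖pairing w c‖ ^ 2

theorem measurable_pairingJac (v w : growthSubmodule) : Measurable (pairingJac v w) :=
  ((measurable_pairing v).norm.pow_const 2).sub ((measurable_pairing w).norm.pow_const 2)

theorem pairing_raiseVec (n : ℕ) (z : ℂ) (c : EntireSeq) :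
    pairing (raiseVec n z) c = (√((n : ℝ) + 1) : ℂ) * landauField (n + 1) c z := by
  rw [raiseVec, pairing_smul, pairing_landauVec]

theorem pairing_lowerVec (n : ℕ) (z : ℂ) (c : EntireSeq) :
    pairing (lowerVec n z) c = (√(n : ℝ) : ℂ) * landauField (n - 1) c z := by
  rw [lowerVec, pairing_smul, pairing_landauVec]

theorem inner_landauVec_raiseVec (n : ℕ) (z : ℂ) :
    inner ℂ (landauVec n z) (raiseVec n z) = 0 := by
  rw [raiseVec, inner_smul_right, inner_landauVec, if_neg (by omega), mul_zero]

theorem inner_landauVec_lowerVec (n : ℕ) (z : ℂ) :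
    inner ℂ (landauVec n z) (lowerVec n z) = 0 := by
  rw [lowerVec, inner_smul_right, inner_landauVec]
  rcases n with _ | n
  · simp
  · rw [if_neg (by omega), mul_zero]

theorem det_fderiv_landauField {n : ℕ} {c : EntireSeq} {z : ℂ} (h : landauField n c z = 0) :
    (fderiv ℝ (landauField n c) z).det = pairingJac (raiseVec n z) (lowerVec n z) c := by
  rw [(hasFDerivAt_landauField n c z).fderiv, det_wirtingerMap, pairingJac, pairing_raiseVec,
    pairing_lowerVec, h, mul_zero, add_zero, norm_neg]

theorem measurable_landauField_uncurry (n : ℕ) :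
    Measurable fun x : EntireSeq × ℂ => landauField n x.1 x.2 := by
  have h : Measurable (Function.uncurry fun (z : ℂ) (c : EntireSeq) => landauField n c z) :=
    measurable_uncurry_of_continuous_of_measurable (fun c => continuous_landauField n c)
      fun z => by simpa only [← pairing_landauVec] using measurable_pairing (landauVec n z)
  exact h.comp measurable_swap

theorem measurable_landauField (n : ℕ) (z : ℂ) : Measurable fun c => landauField n c z := by
  simpa only [← pairing_landauVec] using measurable_pairing (landauVec n z)

theorem measurable_pairingJac_uncurry (n : ℕ) : Measurable fun x : EntireSeq × ℂ =>
    pairingJac (raiseVec n x.2) (lowerVec n x.2) x.1 := by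
  simp only [pairingJac, pairing_raiseVec, pairing_lowerVec]
  exact (((measurable_landauField_uncurry _).const_mul _).norm.pow_const 2).sub
    (((measurable_landauField_uncurry _).const_mul _).norm.pow_const 2)

theorem pairing_addCoord (v : growthSubmodule) (i : ℕ) (η : ℂ) (c : EntireSeq) :
    pairing v (addCoord i η c) = v.1 i * η + pairing v c := by
  have h : HasSum (fun j => v.1 j * (if j = i then η else 0)) (v.1 i * η) := by
    convert hasSum_single (f := fun j => v.1 j * (if j = i then η else 0)) i
      (fun j hj => by simp [hj]) using 1
    simp
  rw [add_comm]
  refine HasSum.tsum_eq ?_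
  refine ((summable_pairing v c).hasSum.add h).congr_fun fun j => ?_
  simp [addCoord, mul_add]

theorem differentiable_landauCoeff (n j : ℕ) : Differentiable ℝ (landauCoeff n j) := fun z =>
  (hasFDerivAt_landauCoeff n j z).differentiableAt

theorem pos_of_norm_growth {v : growthSubmodule} (hv : v ≠ 0) : 0 < ‖v‖ ^ 2 := by
  have := norm_pos_iff.2 hv
  positivity

section OnePoint

variable {μ : Measure EntireSeq} [IsProbabilityMeasure μ]

theorem indepFun_pairing_pairingJac (hμ : IsGaussianSeq μ) {a v w : growthSubmodule}
    (h1 : inner ℂ a v = 0) (h2 : inner ℂ a w = 0) :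
    IndepFun (pairing a) (fun c => |pairingJac v w c|) μ := by
  have h := indepFun_pairing hμ (ι := Unit) (κ := Fin 2) (v := fun _ => a) (w := ![v, w])
    (fun _ k => by fin_cases k <;> assumption)
  have hm : Measurable fun f : Fin 2 → ℂ => |‖f 0‖ ^ 2 - ‖f 1‖ ^ 2| := by
    have : Continuous fun f : Fin 2 → ℂ => |‖f 0‖ ^ 2 - ‖f 1‖ ^ 2| := by fun_prop
    exact this.measurable
  exact h.comp (measurable_pi_apply ()) hm

/-- The Kac–Rice formula for the zeros of `f_n`. -/
theorem lintegral_encard_landauField (hμ : IsGaussianSeq μ) (n i : ℕ) {U : Set ℂ} (hU : IsOpen U)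
    (hUi : ∀ z ∈ U, landauCoeff n i z ≠ 0) :
    ∫⁻ c, (({z | z ∈ U ∧ landauField n c z = 0}.encard : ℕ∞) : ℝ≥0∞) ∂μ
      = ∫⁻ z in U, ENNReal.ofReal (complexGaussianPDF (‖landauVec n z‖ ^ 2) 0) *
        ∫⁻ c, ENNReal.ofReal |pairingJac (raiseVec n z) (lowerVec n z) c| ∂μ := by
  have hst := stdComplexGaussian_eq
  have : IsProbabilityMeasure ((volume : Measure ℂ).withDensity
      fun x => ENNReal.ofReal (complexGaussianPDF 1 x)) := hst ▸ inferInstance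
  have := Measure.isProbabilityMeasure_map (μ := μ) (measurable_zeroOut {i}).aemeasurable
  have hco : ∀ z, Continuous fun c : ℂ => landauCoeff n i z * c := fun z => by fun_prop
  have hwc : Continuous fun p : ℂ => wirtingerMap p 0 := by
    unfold wirtingerMap; fun_prop
  refine lintegral_encard_zeros_eq (volume : Measure ℂ) (continuous_complexGaussianPDF 1)
    (complexGaussianPDF_nonneg zero_le_one) (complexGaussianPDF_le zero_le_one)
    (m := fun x : ℂ × EntireSeq => addCoord i x.1 x.2) (measurable_addCoord i)
    (by rw [← hst]; exact map_addCoord hμ i)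
    (F := fun c z => landauField n c z) (continuous_landauField n) (measurable_landauField n)
    (A := fun z => wirtingerMap (landauCoeff n i z) 0) (h := fun r z => landauField n r z)
    (fun x t => by simp [landauField_addCoord])
    (N := {z | landauCoeff n i z ≠ 0})
    (hwc.measurable.comp (differentiable_landauCoeff n i).continuous.measurable)
    (measurable_landauField_uncurry n)
    (fun z _ => by
      unfold wirtingerMap
      exact ((differentiable_landauCoeff n i z).smul_const _).add_const _)
    (fun z hz => by
      rw [det_wirtingerMap, norm_zero]
      have := norm_pos_iff.2 hz
      exact ne_of_gt (by nlinarith))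
    (fun r z _ => (hasFDerivAt_landauField n r z).differentiableAt)
    (D := fun c z => |pairingJac (raiseVec n z) (lowerVec n z) c|)
    (measurable_pairingJac_uncurry n).abs
    (fun c z h0 => by rw [det_fderiv_landauField h0])
    (G := fun z c => |pairingJac (raiseVec n z) (lowerVec n z) c|)
    (fun z => (measurable_pairingJac _ _).abs) (fun _ _ => abs_nonneg _)
    (fun z r => by
      simp only [pairingJac, pairing_addCoord]
      fun_prop)
    (fun _ _ _ => rfl)
    (fun z _ => ?_) (q := fun z x => complexGaussianPDF (‖landauVec n z‖ ^ 2) x)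
    (fun z => continuous_complexGaussianPDF _) (fun z _ => ?_) hU hUi
  · simpa only [← pairing_landauVec] using indepFun_pairing_pairingJac hμ
      (inner_landauVec_raiseVec n z) (inner_landauVec_lowerVec n z)
  · simp only [← pairing_landauVec]
    exact map_pairing hμ (landauVec_ne_zero n z)

end OnePoint

section Projection

variable {V : Type*} [NormedAddCommGroup V] [InnerProductSpace ℂ V]

/-- The component of `x` orthogonal to `a`. -/
def orthPart (a x : V) : V := x - (inner ℂ a x / inner ℂ a a) • a

theorem inner_orthPart {a : V} (ha : a ≠ 0) (x : V) : inner ℂ a (orthPart a x) = 0 := by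
  rw [orthPart, inner_sub_right, inner_smul_right,
    div_mul_cancel₀ _ (inner_self_ne_zero.2 ha), sub_self]

/-- The component of `x` orthogonal to `a` and `b`. -/
def orthPart₂ (a b x : V) : V := orthPart (orthPart a b) (orthPart a x)

theorem inner_left_orthPart₂ {a : V} (ha : a ≠ 0) (b x : V) : inner ℂ a (orthPart₂ a b x) = 0 := by
  rw [orthPart₂, orthPart, inner_sub_right, inner_smul_right, inner_orthPart ha, inner_orthPart ha]
  simp

theorem inner_right_orthPart₂ {a b : V} (ha : a ≠ 0) (hb : orthPart a b ≠ 0) (x : V) :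
    inner ℂ b (orthPart₂ a b x) = 0 := by
  have h : b = orthPart a b + (inner ℂ a b / inner ℂ a a) • a := by simp [orthPart]
  calc inner ℂ b (orthPart₂ a b x)
      = inner ℂ (orthPart a b + (inner ℂ a b / inner ℂ a a) • a) (orthPart₂ a b x) := by rw [← h]
    _ = 0 := by
      rw [inner_add_left, inner_smul_left, inner_left_orthPart₂ ha, orthPart₂, inner_orthPart hb]
      simp

theorem orthPart_eq_self {a x : V} (h : inner ℂ a x = 0) : orthPart a x = x := by
  simp [orthPart, h]

end Projection

theorem pairing_orthPart (a x : growthSubmodule) (c : EntireSeq) :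
    pairing (orthPart a x) c = pairing x c - inner ℂ a x / inner ℂ a a * pairing a c := by
  rw [orthPart, pairing_sub, pairing_smul]

theorem pairing_orthPart₂_of_zero {a b : growthSubmodule} {c : EntireSeq} (ha : pairing a c = 0)
    (hb : pairing b c = 0) (x : growthSubmodule) : pairing (orthPart₂ a b x) c = pairing x c := by
  rw [orthPart₂, pairing_orthPart, pairing_orthPart, pairing_orthPart, ha, hb]
  simp

theorem orthPart_landauVec_ne_zero {n m : ℕ} (hnm : n ≠ m) (z w : ℂ) :
    orthPart (landauVec n z) (landauVec m w) ≠ 0 := fun h =>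
  landauVec_ne_smul hnm z w _ (sub_eq_zero.1 h)

section TwoPoint

/-- The real-linear map of `ℂ × ℂ` given by a complex `2 × 2` matrix. -/
def pairMap (a b c d : ℂ) : ℂ × ℂ →L[ℝ] ℂ × ℂ :=
  ((a • ContinuousLinearMap.fst ℝ ℂ ℂ + b • ContinuousLinearMap.snd ℝ ℂ ℂ).prod
    (c • ContinuousLinearMap.fst ℝ ℂ ℂ + d • ContinuousLinearMap.snd ℝ ℂ ℂ))

theorem pairMap_apply (a b c d : ℂ) (x : ℂ × ℂ) :
    pairMap a b c d x = (a * x.1 + b * x.2, c * x.1 + d * x.2) := by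
  simp [pairMap]

theorem det_pairMap_ne_zero {a b c d : ℂ} (h : a * d - b * c ≠ 0) :
    (pairMap a b c d).det ≠ 0 := by
  set Δ := a * d - b * c with hΔ
  have hcomp : (pairMap a b c d).comp (pairMap (d / Δ) (-b / Δ) (-c / Δ) (a / Δ))
      = ContinuousLinearMap.id ℝ (ℂ × ℂ) := by
    refine ContinuousLinearMap.ext fun x => ?_
    rw [ContinuousLinearMap.comp_apply, pairMap_apply, pairMap_apply]
    refine Prod.ext ?_ ?_
    · simp only [ContinuousLinearMap.id_apply]
      field_simp
      rw [hΔ]; ring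
    · simp only [ContinuousLinearMap.id_apply]
      field_simp
      rw [hΔ]; ring
  intro h0
  have h1 : ((pairMap a b c d).comp (pairMap (d / Δ) (-b / Δ) (-c / Δ) (a / Δ))).det
      = (pairMap a b c d).det * (pairMap (d / Δ) (-b / Δ) (-c / Δ) (a / Δ)).det :=
    LinearMap.det_comp _ _
  rw [hcomp, h0, zero_mul] at h1
  have h2 : (ContinuousLinearMap.id ℝ (ℂ × ℂ)).det = 1 := LinearMap.det_id
  rw [h2] at h1
  exact one_ne_zero h1

theorem pairMap_eq_sum (a b c d : ℂ) : pairMap a b c d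
    = a • pairMap 1 0 0 0 + b • pairMap 0 1 0 0 + c • pairMap 0 0 1 0 + d • pairMap 0 0 0 1 := by
  refine ContinuousLinearMap.ext fun x => ?_
  simp [pairMap_apply]

variable {μ : Measure EntireSeq} [IsProbabilityMeasure μ]

theorem indepFun_prod_pairingJac (hμ : IsGaussianSeq μ) {a b : growthSubmodule}
    {x : Fin 4 → growthSubmodule} (h1 : ∀ k, inner ℂ a (x k) = 0) (h2 : ∀ k, inner ℂ b (x k) = 0) :
    IndepFun (fun c => (pairing a c, pairing b c))
      (fun c => |pairingJac (x 0) (x 1) c| * |pairingJac (x 2) (x 3) c|) μ := by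
  have h := indepFun_pairing hμ (ι := Fin 2) (κ := Fin 4) (v := ![a, b]) (w := x)
    (fun i k => by fin_cases i; exacts [h1 k, h2 k])
  have hm : Measurable fun f : Fin 4 → ℂ =>
      |‖f 0‖ ^ 2 - ‖f 1‖ ^ 2| * |‖f 2‖ ^ 2 - ‖f 3‖ ^ 2| := by
    have : Continuous fun f : Fin 4 → ℂ =>
      |‖f 0‖ ^ 2 - ‖f 1‖ ^ 2| * |‖f 2‖ ^ 2 - ‖f 3‖ ^ 2| := by fun_prop
    exact this.measurable
  have hm2 : Measurable fun f : Fin 2 → ℂ => (f 0, f 1) :=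
    (measurable_pi_apply 0).prodMk (measurable_pi_apply 1)
  exact h.comp hm2 hm

/-- The vectors whose pairings give the derivatives of `(f_n(z), f_m(w))` at a zero, projected
off the span of those giving the values. -/
def residualVec (n m : ℕ) (t : ℂ × ℂ) (k : Fin 4) : growthSubmodule :=
  orthPart₂ (landauVec n t.1) (landauVec m t.2)
    ((![raiseVec n t.1, lowerVec n t.1, raiseVec m t.2, lowerVec m t.2] : Fin 4 → growthSubmodule) k)

/-- The product of the conditional Jacobians of `f_n` at `z` and `f_m` at `w`. -/
def conditionalJac (n m : ℕ) (t : ℂ × ℂ) (c : EntireSeq) : ℝ :=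
  |pairingJac (residualVec n m t 0) (residualVec n m t 1) c| *
    |pairingJac (residualVec n m t 2) (residualVec n m t 3) c|

theorem measurable_conditionalJac (n m : ℕ) (t : ℂ × ℂ) : Measurable (conditionalJac n m t) :=
  (measurable_pairingJac _ _).abs.mul (measurable_pairingJac _ _).abs

theorem conditionalJac_nonneg (n m : ℕ) (t : ℂ × ℂ) (c : EntireSeq) : 0 ≤ conditionalJac n m t c :=
  mul_nonneg (abs_nonneg _) (abs_nonneg _)

/-- The Kac–Rice formula for the pairs of zeros of `f_n` and `f_m`. -/
theorem lintegral_encard_landauField_prod (hμ : IsGaussianSeq μ) {n m : ℕ} (hnm : n ≠ m) {i k : ℕ}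
    (hik : i ≠ k) {U : Set (ℂ × ℂ)} (hU : IsOpen U)
    (hUi : ∀ t ∈ U, landauCoeff n i t.1 * landauCoeff m k t.2
      - landauCoeff n k t.1 * landauCoeff m i t.2 ≠ 0) :
    ∫⁻ c, (({t : ℂ × ℂ | t ∈ U ∧ (landauField n c t.1, landauField m c t.2) = 0}.encard : ℕ∞) :
        ℝ≥0∞) ∂μ
      = ∫⁻ t in U, ENNReal.ofReal (pairDensity (‖landauVec n t.1‖ ^ 2)
          (‖orthPart (landauVec n t.1) (landauVec m t.2)‖ ^ 2)
          (inner ℂ (landauVec n t.1) (landauVec m t.2) / inner ℂ (landauVec n t.1) (landauVec n t.1))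
          0) * ∫⁻ c, ENNReal.ofReal (conditionalJac n m t c) ∂μ := by
  have hst : stdComplexGaussian.prod stdComplexGaussian = (volume : Measure (ℂ × ℂ)).withDensity
      fun x => ENNReal.ofReal (pairDensity 1 1 0 x) := by
    rw [stdComplexGaussian_eq, prod_withDensity_complexGaussianPDF 1 1 zero_le_one]
  have : IsProbabilityMeasure ((volume : Measure (ℂ × ℂ)).withDensity
      fun x => ENNReal.ofReal (pairDensity 1 1 0 x)) := hst ▸ inferInstance
  have := Measure.isProbabilityMeasure_map (μ := μ) (measurable_zeroOut {i, k}).aemeasurable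
  have : (volume : Measure (ℂ × ℂ)).IsAddHaarMeasure :=
    Measure.prod.instIsAddHaarMeasure volume volume
  have hp0 : ∀ x, 0 ≤ pairDensity 1 1 0 x := fun x =>
    mul_nonneg (complexGaussianPDF_nonneg zero_le_one _) (complexGaussianPDF_nonneg zero_le_one _)
  have hpC : ∀ x, pairDensity 1 1 0 x ≤ (Real.pi * 1)⁻¹ * (Real.pi * 1)⁻¹ := fun x =>
    mul_le_mul (complexGaussianPDF_le zero_le_one _) (complexGaussianPDF_le zero_le_one _)
      (complexGaussianPDF_nonneg zero_le_one _) (by have := Real.pi_pos; positivity)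
  have hd1 : ∀ j, Differentiable ℝ fun t : ℂ × ℂ => landauCoeff n j t.1 := fun j =>
    (differentiable_landauCoeff n j).comp differentiable_fst
  have hd2 : ∀ j, Differentiable ℝ fun t : ℂ × ℂ => landauCoeff m j t.2 := fun j =>
    (differentiable_landauCoeff m j).comp differentiable_snd
  have hA : Differentiable ℝ fun t : ℂ × ℂ => pairMap (landauCoeff n i t.1) (landauCoeff n k t.1)
      (landauCoeff m i t.2) (landauCoeff m k t.2) := by
    have e : (fun t : ℂ × ℂ => pairMap (landauCoeff n i t.1) (landauCoeff n k t.1)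
      (landauCoeff m i t.2) (landauCoeff m k t.2)) = fun t : ℂ × ℂ =>
        landauCoeff n i t.1 • pairMap 1 0 0 0 + landauCoeff n k t.1 • pairMap 0 1 0 0
        + landauCoeff m i t.2 • pairMap 0 0 1 0 + landauCoeff m k t.2 • pairMap 0 0 0 1 :=
      funext fun t => pairMap_eq_sum _ _ _ _
    rw [e]
    exact ((((hd1 i).smul_const _).add ((hd1 k).smul_const _)).add
      ((hd2 i).smul_const _)).add ((hd2 k).smul_const _)
  have hfd : ∀ c (t : ℂ × ℂ), HasFDerivAt (fun t : ℂ × ℂ => (landauField n c t.1, landauField m c t.2))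
      ((fderiv ℝ (landauField n c) t.1).prodMap (fderiv ℝ (landauField m c) t.2)) t := fun c t =>
    HasFDerivAt.prodMap t (hasFDerivAt_landauField n c t.1).differentiableAt.hasFDerivAt
      (hasFDerivAt_landauField m c t.2).differentiableAt.hasFDerivAt
  refine lintegral_encard_zeros_eq (volume : Measure (ℂ × ℂ)) (continuous_pairDensity 1 1 0) hp0 hpC
    (m := fun x : (ℂ × ℂ) × EntireSeq => addCoord i x.1.1 (addCoord k x.1.2 x.2))
    (measurable_addCoord_addCoord i k)
    (by rw [← hst]; exact map_addCoord_addCoord hμ hik)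
    (F := fun c t => (landauField n c t.1, landauField m c t.2))
    (fun c => ((continuous_landauField n c).comp continuous_fst).prodMk
      ((continuous_landauField m c).comp continuous_snd))
    (fun t => (measurable_landauField n t.1).prodMk (measurable_landauField m t.2))
    (A := fun t => pairMap (landauCoeff n i t.1) (landauCoeff n k t.1)
      (landauCoeff m i t.2) (landauCoeff m k t.2))
    (h := fun r t => (landauField n r t.1, landauField m r t.2))
    (fun x t => by
      simp only [landauField_addCoord, pairMap_apply, Prod.mk_add_mk]
      refine Prod.ext ?_ ?_ <;> simp <;> ring)
    (N := {t | landauCoeff n i t.1 * landauCoeff m k t.2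
      - landauCoeff n k t.1 * landauCoeff m i t.2 ≠ 0})
    hA.continuous.measurable
    (((measurable_landauField_uncurry n).comp (measurable_fst.prodMk
      (measurable_fst.comp measurable_snd))).prodMk
      ((measurable_landauField_uncurry m).comp (measurable_fst.prodMk
      (measurable_snd.comp measurable_snd))))
    (fun t _ => hA t) (fun t ht => det_pairMap_ne_zero ht)
    (fun r t _ => (hfd r t).differentiableAt)
    (D := fun c t => |pairingJac (raiseVec n t.1) (lowerVec n t.1) c| *
      |pairingJac (raiseVec m t.2) (lowerVec m t.2) c|)
    (((measurable_pairingJac_uncurry n).comp (measurable_fst.prodMk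
      (measurable_fst.comp measurable_snd))).abs.mul
      ((measurable_pairingJac_uncurry m).comp (measurable_fst.prodMk
      (measurable_snd.comp measurable_snd))).abs)
    (fun c t h0 => by
      have h1 : landauField n c t.1 = 0 := congrArg Prod.fst h0
      have h2 : landauField m c t.2 = 0 := congrArg Prod.snd h0
      rw [(hfd c t).fderiv, ← det_fderiv_landauField h1, ← det_fderiv_landauField h2, ← abs_mul]
      congr 1
      exact (LinearMap.det_prodMap _ _).symm)
    (G := conditionalJac n m) (measurable_conditionalJac n m) (conditionalJac_nonneg n m)
    (fun t r => by
      simp only [conditionalJac, pairingJac, pairing_addCoord]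
      fun_prop)
    (fun t c h0 => ?_)
    (fun t _ => ?_) (q := fun t x => pairDensity (‖landauVec n t.1‖ ^ 2)
          (‖orthPart (landauVec n t.1) (landauVec m t.2)‖ ^ 2)
          (inner ℂ (landauVec n t.1) (landauVec m t.2) / inner ℂ (landauVec n t.1) (landauVec n t.1))
          x)
    (fun t => continuous_pairDensity _ _ _) (fun t _ => ?_) hU hUi
  · have h1 : pairing (landauVec n t.1) c = 0 := by
      rw [pairing_landauVec]; exact congrArg Prod.fst h0
    have h2 : pairing (landauVec m t.2) c = 0 := by
      rw [pairing_landauVec]; exact congrArg Prod.snd h0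
    simp only [conditionalJac, pairingJac, residualVec, pairing_orthPart₂_of_zero h1 h2]
    rfl
  · have ha := landauVec_ne_zero n t.1
    have hb := orthPart_landauVec_ne_zero hnm t.1 t.2
    have := indepFun_prod_pairingJac hμ (a := landauVec n t.1) (b := landauVec m t.2)
      (x := residualVec n m t) (fun k => inner_left_orthPart₂ ha _ _)
      (fun k => inner_right_orthPart₂ ha hb _)
    simp only [pairing_landauVec] at this
    exact this
  · simp only [← pairing_landauVec]
    exact map_pairing_prod hμ _ (inner_orthPart (landauVec_ne_zero n t.1) _)
      (landauVec_ne_zero n t.1) (orthPart_landauVec_ne_zero hnm t.1 t.2)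

end TwoPoint

theorem growthSum_mono {R R' : ℕ} (h : R ≤ R') (c : EntireSeq) : growthSum R c ≤ growthSum R' c :=
  (c.2 R).tsum_le_tsum (fun j => mul_le_mul_of_nonneg_left (growth_mono h j) (norm_nonneg _)) (c.2 R')

/-- The conjugate of a sequence of moderate growth, as a sequence of coefficients. -/
def conjSeq (v : growthSubmodule) : EntireSeq :=
  ⟨fun j => conj (v.1 j), fun R => by
    obtain ⟨C, R', h⟩ := v.2
    refine Summable.of_nonneg_of_le
      (fun j => mul_nonneg (norm_nonneg _) (growth_nonneg _ _)) (fun j => ?_)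
      ((summable_growth R').mul_left (|C| * Real.exp ((R : ℝ) ^ 2)))
    rw [RCLike.norm_conj]
    have h1 := growth_le_exp R j
    have h2 := growth_nonneg R j
    have h3 := growth_nonneg R' j
    calc ‖v.1 j‖ * growth R j ≤ (|C| * growth R' j) * Real.exp ((R : ℝ) ^ 2) := by
          refine mul_le_mul ((h j).trans ?_) h1 h2 (by positivity)
          gcongr
          exact le_abs_self C
      _ = _ := by ring⟩

theorem pairing_conjSeq (v w : growthSubmodule) : pairing v (conjSeq w) = inner ℂ w v := by
  rw [← (hasSum_inner_growth w v).tsum_eq]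
  exact tsum_congr fun j => mul_comm _ _

theorem continuous_landauVec (n : ℕ) : Continuous (landauVec n) := by
  refine continuous_iff_continuousAt.2 fun z₀ => ?_
  rw [ContinuousAt, tendsto_iff_norm_sub_tendsto_zero]
  have hsq : ∀ z, ‖landauVec n z - landauVec n z₀‖ ^ 2 = Real.exp (‖z‖ ^ 2)
      - 2 * (landauField n (conjSeq (landauVec n z₀)) z).re + Real.exp (‖z₀‖ ^ 2) := by
    intro z
    rw [@norm_sub_sq ℂ, norm_landauVec_sq, norm_landauVec_sq, ← inner_re_symm, ← pairing_conjSeq,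
      pairing_landauVec]
    rfl
  have hc : Continuous fun z => Real.exp (‖z‖ ^ 2)
      - 2 * (landauField n (conjSeq (landauVec n z₀)) z).re + Real.exp (‖z₀‖ ^ 2) := by
    have := continuous_landauField n (conjSeq (landauVec n z₀))
    have h2 := Complex.continuous_re.comp this
    exact ((by fun_prop : Continuous fun z : ℂ => Real.exp (‖z‖ ^ 2)).sub
      (h2.const_mul 2)).add continuous_const
  have h0 : Tendsto (fun z => ‖landauVec n z - landauVec n z₀‖ ^ 2) (𝓝 z₀) (𝓝 0) := by
    simp only [hsq]
    have := hc.tendsto z₀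
    rwa [← hsq z₀, sub_self, norm_zero, zero_pow two_ne_zero] at this
  have h1 := h0.sqrt
  simpa using h1

section Tame

variable {T : Type*} [TopologicalSpace T]

/-- A family of vectors which varies continuously, whose pairings vary continuously, with a locally
uniform growth bound. -/
structure TameAt (v : T → growthSubmodule) (t₀ : T) : Prop where
  cont : ContinuousAt v t₀
  pair : ∀ c, ContinuousAt (fun t => pairing (v t) c) t₀
  bound : ∃ K : ℝ, ∃ R : ℕ, 0 ≤ K ∧ ∀ᶠ t in 𝓝 t₀, ∀ c, ‖pairing (v t) c‖ ≤ K * growthSum R c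

variable {v w : T → growthSubmodule} {t₀ : T}

theorem TameAt.smul {a : T → ℂ} (ha : ContinuousAt a t₀) (hv : TameAt v t₀) :
    TameAt (fun t => a t • v t) t₀ := by
  refine ⟨ha.smul hv.cont, fun c => ?_, ?_⟩
  · simp only [pairing_smul]
    exact ha.mul (hv.pair c)
  · obtain ⟨K, R, hK, h⟩ := hv.bound
    have h2 : ∀ᶠ t in 𝓝 t₀, ‖a t‖ < ‖a t₀‖ + 1 :=
      ha.norm.eventually_lt continuousAt_const (lt_add_one _)
    refine ⟨(‖a t₀‖ + 1) * K, R, by positivity, ?_⟩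
    filter_upwards [h, h2] with t h h2 c
    rw [pairing_smul, norm_mul, mul_assoc]
    exact mul_le_mul h2.le (h c) (norm_nonneg _) (by positivity)

theorem TameAt.sub (hv : TameAt v t₀) (hw : TameAt w t₀) : TameAt (fun t => v t - w t) t₀ := by
  refine ⟨hv.cont.sub hw.cont, fun c => ?_, ?_⟩
  · simp only [pairing_sub]
    exact (hv.pair c).sub (hw.pair c)
  · obtain ⟨K, R, hK, h⟩ := hv.bound
    obtain ⟨K', R', hK', h'⟩ := hw.bound
    refine ⟨K + K', max R R', by positivity, ?_⟩
    filter_upwards [h, h'] with t h h' c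
    rw [pairing_sub, add_mul]
    refine (norm_sub_le _ _).trans (add_le_add ((h c).trans ?_) ((h' c).trans ?_))
    · exact mul_le_mul_of_nonneg_left (growthSum_mono (le_max_left _ _) c) hK
    · exact mul_le_mul_of_nonneg_left (growthSum_mono (le_max_right _ _) c) hK'

theorem TameAt.orthPart (hv : TameAt v t₀) (hw : TameAt w t₀) (h0 : v t₀ ≠ 0) :
    TameAt (fun t => orthPart (v t) (w t)) t₀ :=
  hw.sub (hv.smul ((hv.cont.inner (𝕜 := ℂ) hw.cont).div (hv.cont.inner (𝕜 := ℂ) hv.cont)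
    (inner_self_ne_zero.2 h0)))

theorem TameAt.orthPart₂ {x : T → growthSubmodule} (hv : TameAt v t₀) (hw : TameAt w t₀)
    (hx : TameAt x t₀) (h0 : v t₀ ≠ 0) (h1 : _root_.orthPart (v t₀) (w t₀) ≠ 0) :
    TameAt (fun t => orthPart₂ (v t) (w t) (x t)) t₀ :=
  (hv.orthPart hw h0).orthPart (hv.orthPart hx h0) h1

theorem tameAt_landauVec (n : ℕ) {g : T → ℂ} (hg : ContinuousAt g t₀) :
    TameAt (fun t => landauVec n (g t)) t₀ := by
  refine ⟨(continuous_landauVec n).continuousAt.comp hg, fun c => ?_, ?_⟩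
  · simp only [pairing_landauVec]
    exact (continuous_landauField n c).continuousAt.comp hg
  · obtain ⟨C, R, hC, hR, h⟩ := exists_norm_landauCoeff_le n ‖g t₀‖
    have h2 : ∀ᶠ t in 𝓝 t₀, ‖g t‖ < R := hg.norm.eventually_lt continuousAt_const hR
    refine ⟨C, 3 * R, hC, ?_⟩
    filter_upwards [h2] with t h2 c
    exact norm_pairing_le (h _ h2.le) c

theorem TameAt.exists_common_bound {ι : Type*} [Fintype ι] {v : ι → T → growthSubmodule}
    (hv : ∀ i, TameAt (v i) t₀) :
    ∃ K : ℝ, ∃ R : ℕ, 0 ≤ K ∧ ∀ᶠ t in 𝓝 t₀, ∀ i c, ‖pairing (v i t) c‖ ≤ K * growthSum R c := by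
  choose K R hK h using fun i => (hv i).bound
  refine ⟨∑ i, K i, ∑ i, R i, Finset.sum_nonneg fun i _ => hK i, ?_⟩
  filter_upwards [eventually_all.2 h] with t h i c
  refine (h i c).trans (mul_le_mul
    (Finset.single_le_sum (f := K) (fun i _ => hK i) (Finset.mem_univ i))
    (growthSum_mono (Finset.single_le_sum (f := R) (fun i _ => Nat.zero_le _) (Finset.mem_univ i)) c)
    (growthSum_nonneg _ _) (Finset.sum_nonneg fun i _ => hK i))

end Tame

theorem tameAt_residualVec {n m : ℕ} (hnm : n ≠ m) (k : Fin 4) (t₀ : ℂ × ℂ) :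
    TameAt (fun t => residualVec n m t k) t₀ := by
  have h1 : ∀ l, TameAt (fun t : ℂ × ℂ => landauVec l t.1) t₀ := fun l =>
    tameAt_landauVec l continuous_fst.continuousAt
  have h2 : ∀ l, TameAt (fun t : ℂ × ℂ => landauVec l t.2) t₀ := fun l =>
    tameAt_landauVec l continuous_snd.continuousAt
  refine (h1 n).orthPart₂ (h2 m) ?_ (landauVec_ne_zero _ _) (orthPart_landauVec_ne_zero hnm _ _)
  fin_cases k
  · exact (h1 _).smul continuousAt_const
  · exact (h1 _).smul continuousAt_const
  · exact (h2 _).smul continuousAt_const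
  · exact (h2 _).smul continuousAt_const

theorem abs_pairingJac_le {v w : growthSubmodule} {c : EntireSeq} {B : ℝ}
    (hv : ‖pairing v c‖ ≤ B) (hw : ‖pairing w c‖ ≤ B) : |pairingJac v w c| ≤ B ^ 2 := by
  have h1 := norm_nonneg (pairing v c)
  have h2 := norm_nonneg (pairing w c)
  rw [pairingJac, abs_le]
  constructor <;> nlinarith

theorem exists_conditionalJac_le {n m : ℕ} (hnm : n ≠ m) (t₀ : ℂ × ℂ) :
    ∃ K : ℝ, ∃ R : ℕ, ∀ᶠ t in 𝓝 t₀, ∀ c, conditionalJac n m t c ≤ K * growthSum R c ^ 4 := by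
  obtain ⟨K, R, hK, h⟩ := TameAt.exists_common_bound fun k => tameAt_residualVec hnm k t₀
  refine ⟨K ^ 4, R, ?_⟩
  filter_upwards [h] with t h c
  calc conditionalJac n m t c ≤ (K * growthSum R c) ^ 2 * (K * growthSum R c) ^ 2 :=
        mul_le_mul (abs_pairingJac_le (h 0 c) (h 1 c)) (abs_pairingJac_le (h 2 c) (h 3 c))
          (abs_nonneg _) (by positivity)
    _ = _ := by ring

section Intensity

variable {μ : Measure EntireSeq} [IsProbabilityMeasure μ]

theorem integrable_conditionalJac (hμ : IsGaussianSeq μ) {n m : ℕ} (hnm : n ≠ m) (t : ℂ × ℂ) :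
    Integrable (conditionalJac n m t) μ := by
  obtain ⟨K, R, h⟩ := exists_conditionalJac_le hnm t
  refine ((integrable_growthSum_pow_four hμ R).const_mul K).mono'
    (measurable_conditionalJac n m t).aestronglyMeasurable (ae_of_all _ fun c => ?_)
  rw [Real.norm_of_nonneg (conditionalJac_nonneg n m t c)]
  exact h.self_of_nhds c

theorem continuous_integral_conditionalJac (hμ : IsGaussianSeq μ) {n m : ℕ} (hnm : n ≠ m) :
    Continuous fun t => ∫ c, conditionalJac n m t c ∂μ := by
  refine continuous_iff_continuousAt.2 fun t₀ => ?_
  obtain ⟨K, R, h⟩ := exists_conditionalJac_le hnm t₀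
  refine continuousAt_of_dominated (bound := fun c => K * growthSum R c ^ 4)
    (Eventually.of_forall fun t => (measurable_conditionalJac n m t).aestronglyMeasurable)
    (h.mono fun t h => ae_of_all _ fun c => ?_) ((integrable_growthSum_pow_four hμ R).const_mul K)
    (ae_of_all _ fun c => ?_)
  · rw [Real.norm_of_nonneg (conditionalJac_nonneg n m t c)]
    exact h c
  · have h1 : ∀ k, ContinuousAt (fun t => ‖pairing (residualVec n m t k) c‖ ^ 2) t₀ := fun k =>
      ((tameAt_residualVec hnm k t₀).pair c).norm.pow 2
    exact ((h1 0).sub (h1 1)).abs.mul ((h1 2).sub (h1 3)).abs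

variable (μ) in
/-- The two-point intensity of the zeros of `f_n` and `f_m`, by the Kac–Rice formula. -/
def pairIntensity (n m : ℕ) (t : ℂ × ℂ) : ℝ :=
  pairDensity (‖landauVec n t.1‖ ^ 2) (‖orthPart (landauVec n t.1) (landauVec m t.2)‖ ^ 2)
    (inner ℂ (landauVec n t.1) (landauVec m t.2) / inner ℂ (landauVec n t.1) (landauVec n t.1)) 0 *
      ∫ c, conditionalJac n m t c ∂μ

theorem pairDensity_zero (s t : ℝ) (κ : ℂ) :
    pairDensity s t κ 0 = (Real.pi * s)⁻¹ * (Real.pi * t)⁻¹ := by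
  simp [pairDensity, complexGaussianPDF_zero]

theorem pairIntensity_nonneg (n m : ℕ) (t : ℂ × ℂ) : 0 ≤ pairIntensity μ n m t := by
  rw [pairIntensity, pairDensity_zero]
  have := Real.pi_pos
  exact mul_nonneg (by positivity) (integral_nonneg (conditionalJac_nonneg n m t))

theorem continuous_pairIntensity (hμ : IsGaussianSeq μ) {n m : ℕ} (hnm : n ≠ m) :
    Continuous (pairIntensity μ n m) := by
  have h1 : Continuous fun t : ℂ × ℂ => landauVec n t.1 :=
    (continuous_landauVec n).comp continuous_fst
  have h2 : Continuous fun t : ℂ × ℂ => landauVec m t.2 :=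
    (continuous_landauVec m).comp continuous_snd
  have h3 : Continuous fun t : ℂ × ℂ => orthPart (landauVec n t.1) (landauVec m t.2) :=
    h2.sub (((h1.inner (𝕜 := ℂ) h2).div (h1.inner (𝕜 := ℂ) h1)
      fun t => inner_self_ne_zero.2 (landauVec_ne_zero _ _)).smul h1)
  unfold pairIntensity
  simp only [pairDensity_zero]
  refine Continuous.mul (Continuous.mul ?_ ?_) (continuous_integral_conditionalJac hμ hnm)
  · exact ((h1.norm.pow 2).const_mul _).inv₀ fun t =>
      (mul_pos Real.pi_pos (pos_of_norm_growth (landauVec_ne_zero _ _))).ne'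
  · exact ((h3.norm.pow 2).const_mul _).inv₀ fun t =>
      (mul_pos Real.pi_pos (pos_of_norm_growth (orthPart_landauVec_ne_zero hnm _ _))).ne'

theorem exists_open_setLIntegral_ne_top {E : Type*} [TopologicalSpace E] [MeasurableSpace E]
    {ν : Measure E} [IsLocallyFiniteMeasure ν] {ρ : E → ℝ} (hρ : Continuous ρ) (t : E) :
    ∃ N : Set E, IsOpen N ∧ t ∈ N ∧ ∫⁻ t in N, ENNReal.ofReal (ρ t) ∂ν ≠ ∞ := by
  obtain ⟨V, hV, hVo, hVf⟩ := ν.exists_isOpen_measure_lt_top t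
  refine ⟨V ∩ {s | ρ s < ρ t + 1}, hVo.inter (isOpen_lt hρ continuous_const),
    ⟨hV, show ρ t < ρ t + 1 from lt_add_one _⟩, ?_⟩
  refine ((setLIntegral_mono (g := fun _ => ENNReal.ofReal (ρ t + 1)) measurable_const
    fun s hs => ENNReal.ofReal_le_ofReal (le_of_lt hs.2)).trans_lt ?_).ne
  rw [setLIntegral_const]
  exact ENNReal.mul_lt_top ENNReal.ofReal_lt_top
    ((measure_mono Set.inter_subset_left).trans_lt hVf)

theorem count_landauField_prod (hμ : IsGaussianSeq μ) {n m : ℕ} (hnm : n ≠ m) {S : Set (ℂ × ℂ)}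
    (hS : MeasurableSet S) :
    AEMeasurable (fun c => zeroPairCount (landauField n c) (landauField m c) S) μ ∧
      ∫⁻ c, zeroPairCount (landauField n c) (landauField m c) S ∂μ
        = ∫⁻ t in S, ENNReal.ofReal (pairIntensity μ n m t) := by
  refine lintegral_encard_inter_of_local μ volume
    (Z := fun c => {t : ℂ × ℂ | landauField n c t.1 = 0 ∧ landauField m c t.2 = 0})
    (fun t => ?_) hS
  obtain ⟨i, k, hik, hne⟩ := exists_minor_ne_zero hnm t.1 t.2
  obtain ⟨N, hN, htN, hfin⟩ := exists_open_setLIntegral_ne_top (ν := (volume : Measure (ℂ × ℂ)))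
    (continuous_pairIntensity hμ hnm) t
  have hd1 : ∀ j, Continuous fun t : ℂ × ℂ => landauCoeff n j t.1 := fun j =>
    (differentiable_landauCoeff n j).continuous.comp continuous_fst
  have hd2 : ∀ j, Continuous fun t : ℂ × ℂ => landauCoeff m j t.2 := fun j =>
    (differentiable_landauCoeff m j).continuous.comp continuous_snd
  have hopen : IsOpen {t : ℂ × ℂ | landauCoeff n i t.1 * landauCoeff m k t.2
      - landauCoeff n k t.1 * landauCoeff m i t.2 ≠ 0} :=
    isOpen_ne_fun (((hd1 i).mul (hd2 k)).sub ((hd1 k).mul (hd2 i))) continuous_const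
  refine ⟨N ∩ {t : ℂ × ℂ | landauCoeff n i t.1 * landauCoeff m k t.2
      - landauCoeff n k t.1 * landauCoeff m i t.2 ≠ 0}, hN.inter hopen, ⟨htN, hne⟩,
    ((lintegral_mono_set Set.inter_subset_left).trans_lt (lt_top_iff_ne_top.2 hfin)).ne,
    fun U hUN hU => ?_⟩
  have hset : ∀ c, U ∩ {t : ℂ × ℂ | landauField n c t.1 = 0 ∧ landauField m c t.2 = 0}
      = {t | t ∈ U ∧ (landauField n c t.1, landauField m c t.2) = 0} := by
    intro c; ext t; simp [Prod.ext_iff]; tauto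
  simp only [hset]
  refine ⟨(measurable_encard_zeros (F := fun (c : EntireSeq) (t : ℂ × ℂ) =>
    (landauField n c t.1, landauField m c t.2))
    (fun c => ((continuous_landauField n c).comp continuous_fst).prodMk
      ((continuous_landauField m c).comp continuous_snd))
    (fun t => (measurable_landauField n t.1).prodMk (measurable_landauField m t.2)) hU).aemeasurable,
    ?_⟩
  rw [lintegral_encard_landauField_prod hμ hnm hik hU fun t ht => (hUN ht).2]
  refine lintegral_congr fun t => ?_
  rw [← ofReal_integral_eq_lintegral_ofReal (integrable_conditionalJac hμ hnm t)
    (ae_of_all _ (conditionalJac_nonneg n m t)), pairIntensity, ENNReal.ofReal_mul]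
  rw [pairDensity_zero]
  have := Real.pi_pos
  positivity

end Intensity

section ExponentialMoments

theorem integrableOn_exp_neg_mul_pow {s : ℝ} (hs : 0 < s) (k : ℕ) :
    IntegrableOn (fun x : ℝ => Real.exp (-(s * x)) * x ^ k) (Set.Ioi 0) := by
  have h := integrableOn_rpow_mul_exp_neg_mul_rpow (p := 1) (s := k) (b := s)
    (by have : (0:ℝ) ≤ k := by positivity
        linarith) zero_lt_one hs
  refine h.congr_fun (fun x _ => ?_) measurableSet_Ioi
  simp only [Real.rpow_natCast, Real.rpow_one]
  rw [mul_comm, neg_mul]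

theorem integral_exp_neg_mul_pow_Ioi {s : ℝ} (hs : 0 < s) (k : ℕ) :
    ∫ x in Set.Ioi (0 : ℝ), Real.exp (-(s * x)) * x ^ k = k.factorial / s ^ (k + 1) := by
  have h := Real.integral_rpow_mul_exp_neg_mul_Ioi (a := (k : ℝ) + 1) (r := s) (by positivity) hs
  have e : ∀ x : ℝ, x ^ ((k : ℝ) + 1 - 1) * Real.exp (-(s * x)) = Real.exp (-(s * x)) * x ^ k := by
    intro x
    rw [add_sub_cancel_right, Real.rpow_natCast, mul_comm]
  simp only [e] at h
  rw [h, Real.Gamma_nat_eq_factorial, ← Nat.cast_succ, Real.rpow_natCast, div_pow, one_pow]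
  simp only [Nat.succ_eq_add_one]
  ring

/-- The mean of `|A - b Y|` for `Y` exponential with mean one. -/
def expAbsMean (A b : ℝ) : ℝ := A - b + 2 * b * Real.exp (-(A / b))

theorem integral_exp_neg_mul_abs_sub {A b : ℝ} (hA : 0 ≤ A) (hb : 0 ≤ b) :
    ∫ y in Set.Ioi (0 : ℝ), Real.exp (-y) * |A - b * y| = expAbsMean A b := by
  have h0 := integral_exp_neg_mul_pow_Ioi one_pos 0
  have h1 := integral_exp_neg_mul_pow_Ioi one_pos 1
  have i0 := integrableOn_exp_neg_mul_pow one_pos 0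
  have i1 := integrableOn_exp_neg_mul_pow one_pos 1
  simp only [one_mul, pow_zero, mul_one, pow_one, Nat.factorial, one_pow, Nat.cast_one,
    div_one, zero_add] at h0 h1 i0 i1
  have ilin : IntegrableOn (fun y => A * Real.exp (-y) - b * (Real.exp (-y) * y)) (Set.Ioi 0) :=
    (i0.const_mul A).sub (i1.const_mul b)
  have hlin : ∫ y in Set.Ioi (0 : ℝ), (A * Real.exp (-y) - b * (Real.exp (-y) * y)) = A - b := by
    rw [integral_sub (i0.const_mul A) (i1.const_mul b), integral_const_mul, integral_const_mul,
      h0, h1, mul_one, mul_one]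
  rcases hb.eq_or_lt with rfl | hb
  · simp only [zero_mul, sub_zero, abs_of_nonneg hA, integral_mul_const, h0, expAbsMean]
    ring
  have hs : 0 ≤ A / b := by positivity
  have hF : ∀ y ∈ Set.Ioi (A / b), HasDerivAt (fun y => -(Real.exp (-y) * (b * y - A + b)))
      (Real.exp (-y) * (b * y - A)) y := by
    intro y _
    have h2 : HasDerivAt (fun y : ℝ => Real.exp (-y)) (-Real.exp (-y)) y := by
      simpa using (hasDerivAt_neg y).exp
    have h3 : HasDerivAt (fun y : ℝ => b * y - A + b) b y := by
      simpa using (((hasDerivAt_id y).const_mul b).sub_const A).add_const b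
    refine (h2.fun_mul h3).fun_neg.congr_deriv ?_
    ring
  have itail : IntegrableOn (fun y => Real.exp (-y) * (b * y - A)) (Set.Ioi (A / b)) := by
    refine IntegrableOn.mono_set ?_ (Set.Ioi_subset_Ioi hs)
    refine ilin.neg.congr_fun (fun y _ => ?_) measurableSet_Ioi
    simp only [Pi.neg_apply]; ring
  have hlim : Tendsto (fun y => -(Real.exp (-y) * (b * y - A + b))) atTop (𝓝 0) := by
    have t1 := Real.tendsto_pow_mul_exp_neg_atTop_nhds_zero 1
    have t0 := Real.tendsto_pow_mul_exp_neg_atTop_nhds_zero 0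
    have := ((t1.const_mul b).add (t0.const_mul (b - A))).neg
    simp only [mul_zero, add_zero, neg_zero] at this
    refine this.congr fun y => ?_
    ring
  have htail : ∫ y in Set.Ioi (A / b), Real.exp (-y) * (b * y - A) = b * Real.exp (-(A / b)) := by
    rw [integral_Ioi_of_hasDerivAt_of_tendsto (by fun_prop) hF itail hlim]
    field_simp
    ring
  have hind : ∀ y, Real.exp (-y) * |A - b * y| = (A * Real.exp (-y) - b * (Real.exp (-y) * y))
      + 2 * (Set.Ioi (A / b)).indicator (fun y => Real.exp (-y) * (b * y - A)) y := by
    intro y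
    by_cases hy : A / b < y
    · rw [Set.indicator_of_mem (by exact hy), abs_of_nonpos]
      · ring
      · rw [div_lt_iff₀ hb] at hy; linarith
    · rw [Set.indicator_of_notMem (by exact hy), abs_of_nonneg]
      · ring
      · rw [not_lt, le_div_iff₀ hb] at hy; linarith
  have iind : IntegrableOn (fun y => 2 * (Set.Ioi (A / b)).indicator
      (fun y => Real.exp (-y) * (b * y - A)) y) (Set.Ioi 0) :=
    ((integrable_indicator_iff measurableSet_Ioi).2 itail).integrableOn.const_mul 2
  simp only [hind]
  rw [integral_add ilin iind, hlin, integral_const_mul,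
    setIntegral_indicator measurableSet_Ioi, Set.inter_eq_self_of_subset_right
      (Set.Ioi_subset_Ioi hs), htail, expAbsMean]
  ring

theorem integral_exp_neg_mul_prod {α β γ θ α' β' γ' θ' : ℝ} (hθ : 0 ≤ θ) (hθ' : 0 ≤ θ') :
    ∫ x in Set.Ioi (0 : ℝ), Real.exp (-x) * ((α * x + β + γ * Real.exp (-(θ * x))) *
        (α' * x + β' + γ' * Real.exp (-(θ' * x))))
      = 2 * α * α' + α * β' + β * α' + β * β' + γ' * (α / (1 + θ') ^ 2 + β / (1 + θ'))
        + γ * (α' / (1 + θ) ^ 2 + β' / (1 + θ)) + γ * γ' / (1 + θ + θ') := by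
  let m : ℝ → ℕ → ℝ → ℝ := fun s k x => Real.exp (-(s * x)) * x ^ k
  have e : ∀ x : ℝ, Real.exp (-x) * ((α * x + β + γ * Real.exp (-(θ * x))) *
        (α' * x + β' + γ' * Real.exp (-(θ' * x))))
      = ∑ i : Fin 8, (![α * α', α * β' + β * α', β * β', γ' * α, γ' * β, γ * α', γ * β', γ * γ'] i)
        * m (![1, 1, 1, 1 + θ', 1 + θ', 1 + θ, 1 + θ, 1 + θ + θ'] i) (![2, 1, 0, 1, 0, 1, 0, 0] i) x := by
    intro x
    simp only [Fin.sum_univ_succ, m]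
    have e1 : ∀ s : ℝ, Real.exp (-((1 + s) * x)) = Real.exp (-x) * Real.exp (-(s * x)) := fun s => by
      rw [← Real.exp_add]; ring_nf
    have e2 : Real.exp (-((1 + θ + θ') * x))
        = Real.exp (-x) * Real.exp (-(θ * x)) * Real.exp (-(θ' * x)) := by
      rw [← Real.exp_add, ← Real.exp_add]; ring_nf
    simp [e1, e2]
    ring
  have hpos : ∀ i, 0 < (![1, 1, 1, 1 + θ', 1 + θ', 1 + θ, 1 + θ, 1 + θ + θ'] : Fin 8 → ℝ) i := by
    intro i; fin_cases i <;> simp <;> positivity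
  simp only [e]
  rw [integral_finsetSum _ fun i _ => (integrableOn_exp_neg_mul_pow (hpos i) _).const_mul _]
  simp only [integral_const_mul, integral_exp_neg_mul_pow_Ioi (hpos _)]
  simp only [Fin.sum_univ_succ]
  simp
  ring

theorem integral_exp_neg_mul_expAbsMean {a b d e : ℝ} (ha : 0 ≤ a) (hb : 0 ≤ b) (hd : 0 ≤ d)
    (he : 0 ≤ e) :
    ∫ x in Set.Ioi (0 : ℝ), Real.exp (-x) * (expAbsMean (a * x) b * expAbsMean (d * x) e)
      = 2 * a * d - a * e - b * d + b * e + 2 * e * (a / (1 + d / e) ^ 2 - b / (1 + d / e))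
        + 2 * b * (d / (1 + a / b) ^ 2 - e / (1 + a / b)) + 4 * b * e / (1 + a / b + d / e) := by
  have h := integral_exp_neg_mul_prod (α := a) (β := -b) (γ := 2 * b) (θ := a / b) (α' := d)
    (β' := -e) (γ' := 2 * e) (θ' := d / e) (by positivity) (by positivity)
  refine Eq.trans (integral_congr_ae (ae_of_all _ fun x => ?_)) (h.trans ?_)
  · simp only [expAbsMean, mul_div_right_comm, sub_eq_add_neg]
  · ring

end ExponentialMoments

section GaussianMoments

variable {μ : Measure EntireSeq} [IsProbabilityMeasure μ]

theorem tameAt_const {T : Type*} [TopologicalSpace T] (v : growthSubmodule) (t₀ : T) :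
    TameAt (fun _ => v) t₀ := by
  obtain ⟨C, R, h⟩ := v.2
  refine ⟨continuousAt_const, fun c => continuousAt_const, |C|, R, abs_nonneg C,
    Eventually.of_forall fun _ => norm_pairing_le fun j => (h j).trans ?_⟩
  exact mul_le_mul_of_nonneg_right (le_abs_self C) (growth_nonneg R j)

theorem integrable_abs_pairingJac_mul (hμ : IsGaussianSeq μ) (v : Fin 4 → growthSubmodule) :
    Integrable (fun c => |pairingJac (v 0) (v 1) c| * |pairingJac (v 2) (v 3) c|) μ := by
  obtain ⟨K, R, hK, h⟩ := TameAt.exists_common_bound fun k => tameAt_const (v k) ()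
  refine ((integrable_growthSum_pow_four hμ R).const_mul (K ^ 4)).mono'
    ((measurable_pairingJac _ _).abs.mul (measurable_pairingJac _ _).abs).aestronglyMeasurable
    (ae_of_all _ fun c => ?_)
  rw [Real.norm_of_nonneg (mul_nonneg (abs_nonneg _) (abs_nonneg _))]
  have h := h.self_of_nhds
  calc _ ≤ (K * growthSum R c) ^ 2 * (K * growthSum R c) ^ 2 :=
        mul_le_mul (abs_pairingJac_le (h 0 c) (h 1 c)) (abs_pairingJac_le (h 2 c) (h 3 c))
          (abs_nonneg _) (by positivity)
    _ = _ := by ring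

theorem integrable_abs_pairingJac (hμ : IsGaussianSeq μ) (v w : growthSubmodule) :
    Integrable (fun c => |pairingJac v w c|) μ := by
  refine ((integrable_const (1 : ℝ)).add (integrable_abs_pairingJac_mul hμ ![v, w, v, w])).mono'
    (measurable_pairingJac _ _).abs.aestronglyMeasurable (ae_of_all _ fun c => ?_)
  simp only [Real.norm_eq_abs, abs_abs, Pi.add_apply]
  show |pairingJac v w c| ≤ 1 + |pairingJac v w c| * |pairingJac v w c|
  nlinarith [sq_nonneg (|pairingJac v w c| - 1), abs_nonneg (pairingJac v w c)]

theorem map_coord_prod (hμ : IsGaussianSeq μ) :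
    μ.map (fun c : EntireSeq => (c.1 0, (c.1 1, c.1 2)))
      = stdComplexGaussian.prod (stdComplexGaussian.prod stdComplexGaussian) := by
  have h1 : IndepFun (fun c : EntireSeq => c.1 1) (fun c : EntireSeq => c.1 2) μ :=
    hμ.indep.indepFun (by norm_num)
  have h2 : IndepFun (fun c : EntireSeq => (c.1 1, c.1 2)) (fun c : EntireSeq => c.1 0) μ :=
    hμ.indep.indepFun_prodMk measurable_coord 1 2 0 (by norm_num) (by norm_num)
  have hm := (measurable_coord 1).prodMk (measurable_coord 2)
  rw [(indepFun_iff_map_prod_eq_prod_map_map (measurable_coord 0).aemeasurable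
    hm.aemeasurable).1 h2.symm, (indepFun_iff_map_prod_eq_prod_map_map
    (measurable_coord 1).aemeasurable (measurable_coord 2).aemeasurable).1 h1]
  simp only [hμ.law]

theorem integral_coord_mul (hμ : IsGaussianSeq μ) {F G : ℂ → ℂ → ℝ}
    (hF : Continuous fun x : ℂ × ℂ => F x.1 x.2) (hG : Continuous fun x : ℂ × ℂ => G x.1 x.2)
    (hint : Integrable (fun c : EntireSeq => F (c.1 0) (c.1 1) * G (c.1 0) (c.1 2)) μ) :
    ∫ c : EntireSeq, F (c.1 0) (c.1 1) * G (c.1 0) (c.1 2) ∂μ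
      = ∫ x, (∫ y, F x y ∂stdComplexGaussian) * (∫ y, G x y ∂stdComplexGaussian)
          ∂stdComplexGaussian := by
  have hm : Measurable fun c : EntireSeq => (c.1 0, (c.1 1, c.1 2)) :=
    (measurable_coord 0).prodMk ((measurable_coord 1).prodMk (measurable_coord 2))
  have hc : Continuous fun x : ℂ × ℂ × ℂ => F x.1 x.2.1 * G x.1 x.2.2 :=
    (hF.comp (continuous_fst.prodMk (continuous_fst.comp continuous_snd))).mul
      (hG.comp (continuous_fst.prodMk (continuous_snd.comp continuous_snd)))
  have h1 := integral_map (μ := μ) hm.aemeasurable hc.aestronglyMeasurable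
  have h2 := (integrable_map_measure (μ := μ) hc.aestronglyMeasurable hm.aemeasurable).2 hint
  rw [map_coord_prod hμ] at h1 h2
  rw [← h1, integral_prod _ h2]
  exact integral_congr_ae (ae_of_all _ fun x => integral_prod_mul (F x) (G x))

/-- The mean of `|a S - b T| |e U - d S|` for independent exponential variables of mean one. -/
def contactMoment (a b d e : ℝ) : ℝ :=
  2 * a * d - a * e - b * d + b * e + 2 * e * (a / (1 + d / e) ^ 2 - b / (1 + d / e))
    + 2 * b * (d / (1 + a / b) ^ 2 - e / (1 + a / b)) + 4 * b * e / (1 + a / b + d / e)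

theorem integral_abs_sub_stdComplexGaussian {A b : ℝ} (hA : 0 ≤ A) (hb : 0 ≤ b) :
    ∫ y, |A - b * ‖y‖ ^ 2| ∂stdComplexGaussian = expAbsMean A b := by
  rw [integral_stdComplexGaussian_norm_sq fun s => |A - b * s|,
    integral_exp_neg_mul_abs_sub hA hb]

theorem pairingJac_smul_unitVec (α β : ℂ) (i k : ℕ) (c : EntireSeq) :
    pairingJac (α • unitVec i) (β • unitVec k) c
      = ‖α‖ ^ 2 * ‖c.1 i‖ ^ 2 - ‖β‖ ^ 2 * ‖c.1 k‖ ^ 2 := by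
  simp only [pairingJac, pairing_smul, pairing_unitVec, norm_mul, mul_pow]

theorem integral_pairingJac_unitVec_mul (hμ : IsGaussianSeq μ) (α : Fin 4 → ℂ) :
    ∫ c, |pairingJac (α 0 • unitVec 0) (α 1 • unitVec 1) c| *
        |pairingJac (α 2 • unitVec 2) (α 3 • unitVec 0) c| ∂μ
      = contactMoment (‖α 0‖ ^ 2) (‖α 1‖ ^ 2) (‖α 3‖ ^ 2) (‖α 2‖ ^ 2) := by
  have hint := integrable_abs_pairingJac_mul hμ
    ![α 0 • unitVec 0, α 1 • unitVec 1, α 2 • unitVec 2, α 3 • unitVec 0]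
  replace hint : Integrable (fun c => |pairingJac (α 0 • unitVec 0) (α 1 • unitVec 1) c| *
        |pairingJac (α 2 • unitVec 2) (α 3 • unitVec 0) c|) μ := hint
  simp only [pairingJac_smul_unitVec] at hint ⊢
  rw [integral_coord_mul hμ (F := fun x y => |‖α 0‖ ^ 2 * ‖x‖ ^ 2 - ‖α 1‖ ^ 2 * ‖y‖ ^ 2|)
    (G := fun x y => |‖α 2‖ ^ 2 * ‖y‖ ^ 2 - ‖α 3‖ ^ 2 * ‖x‖ ^ 2|) (by fun_prop) (by fun_prop) hint]
  have e1 : ∀ x : ℂ, ∫ y, |‖α 0‖ ^ 2 * ‖x‖ ^ 2 - ‖α 1‖ ^ 2 * ‖y‖ ^ 2| ∂stdComplexGaussian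
      = expAbsMean (‖α 0‖ ^ 2 * ‖x‖ ^ 2) (‖α 1‖ ^ 2) := fun x =>
    integral_abs_sub_stdComplexGaussian (by positivity) (by positivity)
  have e2 : ∀ x : ℂ, ∫ y, |‖α 2‖ ^ 2 * ‖y‖ ^ 2 - ‖α 3‖ ^ 2 * ‖x‖ ^ 2| ∂stdComplexGaussian
      = expAbsMean (‖α 3‖ ^ 2 * ‖x‖ ^ 2) (‖α 2‖ ^ 2) := fun x => by
    simp only [abs_sub_comm (‖α 2‖ ^ 2 * _)]
    exact integral_abs_sub_stdComplexGaussian (by positivity) (by positivity)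
  simp only [e1, e2]
  rw [integral_stdComplexGaussian_norm_sq fun s => expAbsMean (‖α 0‖ ^ 2 * s) (‖α 1‖ ^ 2) *
    expAbsMean (‖α 3‖ ^ 2 * s) (‖α 2‖ ^ 2)]
  exact integral_exp_neg_mul_expAbsMean (by positivity) (by positivity) (by positivity)
    (by positivity)

theorem integral_pairingJac_unitVec (hμ : IsGaussianSeq μ) (α β : ℂ) :
    ∫ c, |pairingJac (α • unitVec 0) (β • unitVec 1) c| ∂μ
      = ‖α‖ ^ 2 - ‖β‖ ^ 2 + 2 * ‖β‖ ^ 2 / (1 + ‖α‖ ^ 2 / ‖β‖ ^ 2) := by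
  have hint := integrable_abs_pairingJac hμ (α • unitVec 0) (β • unitVec 1)
  simp only [pairingJac_smul_unitVec] at hint ⊢
  have h := integral_coord_mul hμ (F := fun x y => |‖α‖ ^ 2 * ‖x‖ ^ 2 - ‖β‖ ^ 2 * ‖y‖ ^ 2|)
    (G := fun x y => 1) (by fun_prop) (by fun_prop) (by simpa only [mul_one] using hint)
  have e1 : ∀ x : ℂ, ∫ y, |‖α‖ ^ 2 * ‖x‖ ^ 2 - ‖β‖ ^ 2 * ‖y‖ ^ 2| ∂stdComplexGaussian
      = expAbsMean (‖α‖ ^ 2 * ‖x‖ ^ 2) (‖β‖ ^ 2) := fun x =>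
    integral_abs_sub_stdComplexGaussian (by positivity) (by positivity)
  simp only [mul_one, e1, integral_const, probReal_univ, smul_eq_mul] at h
  rw [h, integral_stdComplexGaussian_norm_sq fun s => expAbsMean (‖α‖ ^ 2 * s) (‖β‖ ^ 2)]
  have h2 := integral_exp_neg_mul_expAbsMean (a := ‖α‖ ^ 2) (b := ‖β‖ ^ 2) (d := 1) (e := 0)
    (by positivity) (by positivity) zero_le_one le_rfl
  have h3 := integral_exp_neg_mul_prod (α := ‖α‖ ^ 2) (β := -‖β‖ ^ 2) (γ := 2 * ‖β‖ ^ 2)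
    (θ := ‖α‖ ^ 2 / ‖β‖ ^ 2) (α' := 0) (β' := 1) (γ' := 0) (θ' := 0) (by positivity) le_rfl
  refine Eq.trans (integral_congr_ae (ae_of_all _ fun x => ?_)) (h3.trans ?_)
  · simp only [expAbsMean, mul_div_right_comm]
    ring
  · ring

theorem integral_comp_pairing_eq (hμ : IsGaussianSeq μ) {ι : Type*} [Fintype ι]
    {v w : ι → growthSubmodule} (h : ∀ i j, inner ℂ (v i) (v j) = inner ℂ (w i) (w j))
    {F : (ι → ℂ) → ℝ} (hF : Continuous F) :
    ∫ c, F (fun i => pairing (v i) c) ∂μ = ∫ c, F (fun i => pairing (w i) c) ∂μ := by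
  rw [← integral_map (measurable_pairing_family v).aemeasurable hF.aestronglyMeasurable,
    ← integral_map (measurable_pairing_family w).aemeasurable hF.aestronglyMeasurable,
    map_pairing_eq_of_inner_eq hμ h]

theorem inner_smul_landauVec_eq {ι : Type*} (z : ℂ) {α : ι → ℂ} {p q : ι → ℕ}
    (h : ∀ i j, α i = 0 ∨ α j = 0 ∨ (p i = p j ↔ q i = q j)) (i j : ι) :
    inner ℂ (α i • landauVec (p i) z) (α j • landauVec (p j) z)
      = inner ℂ ((α i * (√(Real.exp (‖z‖ ^ 2)) : ℂ)) • unitVec (q i))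
          ((α j * (√(Real.exp (‖z‖ ^ 2)) : ℂ)) • unitVec (q j)) := by
  rw [inner_smul_left, inner_smul_right, inner_smul_left, inner_smul_right, inner_landauVec,
    inner_unitVec]
  rcases h i j with h | h | h
  · simp [h]
  · simp [h]
  · have e : ((√(Real.exp (‖z‖ ^ 2)) : ℝ) : ℂ) * ((√(Real.exp (‖z‖ ^ 2)) : ℝ) : ℂ)
        = (Real.exp (‖z‖ ^ 2) : ℂ) := by
      rw [← Complex.ofReal_mul, Real.mul_self_sqrt (Real.exp_pos _).le]
    by_cases hq : q i = q j
    · rw [if_pos (h.2 hq), if_pos hq, map_mul, Complex.conj_ofReal, ← e]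
      ring
    · rw [if_neg (fun hp => hq (h.1 hp)), if_neg hq]
      simp

theorem norm_mul_sqrt_exp_sq (α : ℂ) (s : ℝ) :
    ‖α * (√(Real.exp s) : ℂ)‖ ^ 2 = Real.exp s * ‖α‖ ^ 2 := by
  rw [norm_mul, mul_pow, Complex.norm_real, Real.norm_eq_abs, sq_abs,
    Real.sq_sqrt (Real.exp_pos s).le, mul_comm]

theorem contactMoment_smul {s : ℝ} (hs : s ≠ 0) (a b d e : ℝ) :
    contactMoment (s * a) (s * b) (s * d) (s * e) = s ^ 2 * contactMoment a b d e := by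
  simp only [contactMoment, mul_div_mul_left _ _ hs]
  ring

theorem integral_pairingJac_landauVec_mul (hμ : IsGaussianSeq μ) (z : ℂ) {α : Fin 4 → ℂ}
    {p : Fin 4 → ℕ} (h : ∀ i j, α i = 0 ∨ α j = 0 ∨
      (p i = p j ↔ (![0, 1, 2, 0] : Fin 4 → ℕ) i = (![0, 1, 2, 0] : Fin 4 → ℕ) j)) :
    ∫ c, |pairingJac (α 0 • landauVec (p 0) z) (α 1 • landauVec (p 1) z) c| *
        |pairingJac (α 2 • landauVec (p 2) z) (α 3 • landauVec (p 3) z) c| ∂μ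
      = Real.exp (‖z‖ ^ 2) ^ 2 *
        contactMoment (‖α 0‖ ^ 2) (‖α 1‖ ^ 2) (‖α 3‖ ^ 2) (‖α 2‖ ^ 2) := by
  have h1 := integral_comp_pairing_eq hμ (inner_smul_landauVec_eq z h)
    (F := fun f => |‖f 0‖ ^ 2 - ‖f 1‖ ^ 2| * |‖f 2‖ ^ 2 - ‖f 3‖ ^ 2|) (by fun_prop)
  have h2 := integral_pairingJac_unitVec_mul hμ fun i => α i * (√(Real.exp (‖z‖ ^ 2)) : ℂ)
  simp only [norm_mul_sqrt_exp_sq, contactMoment_smul (Real.exp_pos _).ne'] at h2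
  exact h1.trans h2

theorem integral_pairingJac_landauVec (hμ : IsGaussianSeq μ) (z α β : ℂ) {p q : ℕ}
    (h : α = 0 ∨ β = 0 ∨ p ≠ q) :
    ∫ c, |pairingJac (α • landauVec p z) (β • landauVec q z) c| ∂μ
      = Real.exp (‖z‖ ^ 2) *
        (‖α‖ ^ 2 - ‖β‖ ^ 2 + 2 * ‖β‖ ^ 2 / (1 + ‖α‖ ^ 2 / ‖β‖ ^ 2)) := by
  have h1 := integral_comp_pairing_eq hμ (inner_smul_landauVec_eq z (α := ![α, β]) (p := ![p, q])
    (q := ![0, 1]) (fun i j => by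
      fin_cases i <;> fin_cases j <;> simp <;> tauto))
    (F := fun f => |‖f 0‖ ^ 2 - ‖f 1‖ ^ 2|) (by fun_prop)
  have h2 := integral_pairingJac_unitVec hμ (α * (√(Real.exp (‖z‖ ^ 2)) : ℂ))
    (β * (√(Real.exp (‖z‖ ^ 2)) : ℂ))
  simp only [norm_mul_sqrt_exp_sq, mul_div_mul_left _ _ (Real.exp_pos _).ne'] at h2
  refine h1.trans (h2.trans ?_)
  ring

/-- The mean zero density of `f_n`, multiplied by `π`. -/
def levelDensity (n : ℕ) : ℝ := n + 1 / 2 + 1 / (4 * n + 2)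

theorem levelDensity_pos (n : ℕ) : 0 < levelDensity n := by
  unfold levelDensity; positivity

theorem norm_ofReal_sqrt_sq {x : ℝ} (hx : 0 ≤ x) : ‖(√x : ℂ)‖ ^ 2 = x := by
  rw [Complex.norm_real, Real.norm_eq_abs, sq_abs, Real.sq_sqrt hx]

theorem integral_pairingJac_raiseVec (hμ : IsGaussianSeq μ) (n : ℕ) (z : ℂ) :
    ∫ c, |pairingJac (raiseVec n z) (lowerVec n z) c| ∂μ
      = Real.exp (‖z‖ ^ 2) * levelDensity n := by
  rw [raiseVec, lowerVec, integral_pairingJac_landauVec hμ z _ _ (Or.inr (Or.inr (by omega))),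
    norm_ofReal_sqrt_sq (by positivity), norm_ofReal_sqrt_sq (by positivity), levelDensity]
  rcases n with _ | n
  · norm_num
  · push_cast
    have : (0 : ℝ) ≤ n := by positivity
    field_simp
    ring

end GaussianMoments

section Diagonal

theorem orthPart_smul_landauVec (n p : ℕ) (z α : ℂ) :
    orthPart (landauVec n z) (α • landauVec p z) = (if p = n then 0 else α) • landauVec p z := by
  by_cases h : p = n
  · subst h
    rw [if_pos rfl, orthPart, inner_smul_right,
      mul_div_cancel_right₀ _ (inner_self_ne_zero.2 (landauVec_ne_zero p z)), sub_self, zero_smul]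
  · rw [if_neg h]
    exact orthPart_eq_self (by rw [inner_smul_right, inner_landauVec, if_neg (Ne.symm h), mul_zero])

theorem orthPart_landauVec {n m : ℕ} (hnm : n ≠ m) (z : ℂ) :
    orthPart (landauVec n z) (landauVec m z) = landauVec m z :=
  orthPart_eq_self (by rw [inner_landauVec, if_neg hnm])

theorem orthPart₂_smul_landauVec {n m : ℕ} (hnm : n ≠ m) (p : ℕ) (z α : ℂ) :
    orthPart₂ (landauVec n z) (landauVec m z) (α • landauVec p z)
      = (if p = n ∨ p = m then 0 else α) • landauVec p z := by
  rw [orthPart₂, orthPart_landauVec hnm, orthPart_smul_landauVec, orthPart_smul_landauVec]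
  by_cases h1 : p = n <;> by_cases h2 : p = m <;> simp [h1, h2]

variable {μ : Measure EntireSeq} [IsProbabilityMeasure μ]

/-- The count of zeros of `f_n` has constant intensity. -/
theorem count_landauField (hμ : IsGaussianSeq μ) (n : ℕ) {S : Set ℂ} (hS : MeasurableSet S) :
    AEMeasurable (fun c => zeroCount (landauField n c) S) μ ∧
      ∫⁻ c, zeroCount (landauField n c) S ∂μ
        = ∫⁻ _ in S, ENNReal.ofReal (Real.pi⁻¹ * levelDensity n) := by
  refine lintegral_encard_inter_of_local μ volume (Z := fun c => {z : ℂ | landauField n c z = 0})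
    (fun z => ?_) hS
  obtain ⟨i, hne⟩ := exists_landauCoeff_ne_zero n z
  obtain ⟨N, hN, hzN, hfin⟩ := exists_open_setLIntegral_ne_top (ν := (volume : Measure ℂ))
    (continuous_const (y := Real.pi⁻¹ * levelDensity n)) z
  refine ⟨N ∩ {z | landauCoeff n i z ≠ 0}, hN.inter (isOpen_ne_fun
    (differentiable_landauCoeff n i).continuous continuous_const), ⟨hzN, hne⟩,
    ((lintegral_mono_set Set.inter_subset_left).trans_lt (lt_top_iff_ne_top.2 hfin)).ne,
    fun U hUN hU => ⟨(measurable_encard_zeros (continuous_landauField n)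
      (measurable_landauField n) hU).aemeasurable, ?_⟩⟩
  refine (lintegral_encard_landauField hμ n i hU fun t ht => (hUN ht).2).trans
    (lintegral_congr fun t => ?_)
  rw [← ofReal_integral_eq_lintegral_ofReal (integrable_abs_pairingJac hμ _ _)
    (ae_of_all _ fun c => abs_nonneg _), integral_pairingJac_raiseVec hμ, complexGaussianPDF_zero,
    norm_landauVec_sq, ← ENNReal.ofReal_mul]
  · congr 1
    have := Real.pi_pos
    have := Real.exp_pos (‖t‖ ^ 2)
    field_simp
  · have := Real.pi_pos
    positivity

theorem pairIntensity_diag {n m : ℕ} (hnm : n ≠ m) (z : ℂ) :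
    pairIntensity μ n m (z, z) = (Real.pi * Real.exp (‖z‖ ^ 2))⁻¹ ^ 2 *
      ∫ c, conditionalJac n m (z, z) c ∂μ := by
  rw [pairIntensity, pairDensity_zero, orthPart_landauVec hnm, norm_landauVec_sq, norm_landauVec_sq,
    pow_two (Real.pi * _)⁻¹]

theorem orthPart₂_raiseVec {n m : ℕ} (hnm : n ≠ m) (l : ℕ) (z : ℂ) :
    orthPart₂ (landauVec n z) (landauVec m z) (raiseVec l z)
      = (if l + 1 = n ∨ l + 1 = m then 0 else (√((l : ℝ) + 1) : ℂ)) • landauVec (l + 1) z :=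
  orthPart₂_smul_landauVec hnm _ _ _

theorem orthPart₂_lowerVec {n m : ℕ} (hnm : n ≠ m) (l : ℕ) (z : ℂ) :
    orthPart₂ (landauVec n z) (landauVec m z) (lowerVec l z)
      = (if l = n + 1 ∨ l = m + 1 then 0 else (√(l : ℝ) : ℂ)) • landauVec (l - 1) z := by
  rw [lowerVec, orthPart₂_smul_landauVec hnm]
  rcases l with _ | l
  · simp
  · simp

theorem conditionalJac_diag (n m : ℕ) (z : ℂ) (c : EntireSeq) : conditionalJac n m (z, z) c
    = |pairingJac (orthPart₂ (landauVec n z) (landauVec m z) (raiseVec n z))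
        (orthPart₂ (landauVec n z) (landauVec m z) (lowerVec n z)) c| *
      |pairingJac (orthPart₂ (landauVec n z) (landauVec m z) (raiseVec m z))
        (orthPart₂ (landauVec n z) (landauVec m z) (lowerVec m z)) c| := rfl

theorem inv_pi_mul_exp_sq_mul (s M : ℝ) :
    (Real.pi * Real.exp s)⁻¹ ^ 2 * (Real.exp s ^ 2 * M) = Real.pi⁻¹ ^ 2 * M := by
  have := Real.exp_pos s
  field_simp

theorem pairIntensity_diag_one (hμ : IsGaussianSeq μ) (n : ℕ) (z : ℂ) :
    pairIntensity μ n (n + 1) (z, z) = Real.pi⁻¹ ^ 2 * (n * (n + 2)) := by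
  have hnm : n ≠ n + 1 := by omega
  rw [pairIntensity_diag hnm]
  simp only [conditionalJac_diag, orthPart₂_raiseVec hnm, orthPart₂_lowerVec hnm, or_true,
    true_or, if_true]
  rw [if_neg (by omega), if_neg (by omega)]
  have h := integral_pairingJac_landauVec_mul hμ z
    (α := ![0, (√(n : ℝ) : ℂ), (√(((n + 1 : ℕ) : ℝ) + 1) : ℂ), 0])
    (p := ![n + 1, n - 1, n + 1 + 1, n + 1 - 1])
    (fun i j => by fin_cases i <;> fin_cases j <;> simp <;> omega)
  refine (congrArg _ h).trans ?_
  rw [inv_pi_mul_exp_sq_mul]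
  congr 1
  simp only [Matrix.cons_val, norm_zero]
  rw [norm_ofReal_sqrt_sq (by positivity), norm_ofReal_sqrt_sq (by positivity), contactMoment]
  push_cast
  simp
  ring

theorem pairIntensity_diag_two (hμ : IsGaussianSeq μ) (n : ℕ) (z : ℂ) :
    pairIntensity μ n (n + 2) (z, z) = Real.pi⁻¹ ^ 2 *
      contactMoment (n + 1) n (n + 2) (n + 3) := by
  have hnm : n ≠ n + 2 := by omega
  rw [pairIntensity_diag hnm]
  simp only [conditionalJac_diag, orthPart₂_raiseVec hnm, orthPart₂_lowerVec hnm]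
  rw [if_neg (by omega), if_neg (by omega), if_neg (by omega), if_neg (by omega)]
  have h := integral_pairingJac_landauVec_mul hμ z
    (α := ![(√((n : ℝ) + 1) : ℂ), (√(n : ℝ) : ℂ), (√(((n + 2 : ℕ) : ℝ) + 1) : ℂ),
      (√((n + 2 : ℕ) : ℝ) : ℂ)])
    (p := ![n + 1, n - 1, n + 2 + 1, n + 2 - 1])
    (fun i j => by fin_cases i <;> fin_cases j <;> simp <;> omega)
  refine (congrArg _ h).trans ?_
  rw [inv_pi_mul_exp_sq_mul]
  congr 1
  simp only [Matrix.cons_val]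
  rw [norm_ofReal_sqrt_sq (by positivity), norm_ofReal_sqrt_sq (by positivity),
    norm_ofReal_sqrt_sq (by positivity), norm_ofReal_sqrt_sq (by positivity)]
  congr 1 <;> push_cast <;> ring

theorem integral_pairingJac_mul_of_orthogonal (hμ : IsGaussianSeq μ) {v w : Fin 2 → growthSubmodule}
    (h : ∀ i k, inner ℂ (v i) (w k) = 0) :
    ∫ c, |pairingJac (v 0) (v 1) c| * |pairingJac (w 0) (w 1) c| ∂μ
      = (∫ c, |pairingJac (v 0) (v 1) c| ∂μ) * ∫ c, |pairingJac (w 0) (w 1) c| ∂μ := by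
  have hm : Measurable fun f : Fin 2 → ℂ => |‖f 0‖ ^ 2 - ‖f 1‖ ^ 2| := by
    have : Continuous fun f : Fin 2 → ℂ => |‖f 0‖ ^ 2 - ‖f 1‖ ^ 2| := by fun_prop
    exact this.measurable
  exact ((indepFun_pairing hμ h).comp hm hm).integral_fun_mul_eq_mul_integral
    (measurable_pairingJac _ _).abs.aestronglyMeasurable
    (measurable_pairingJac _ _).abs.aestronglyMeasurable

theorem pairIntensity_diag_of_three_le (hμ : IsGaussianSeq μ) (n : ℕ) {k : ℕ} (hk : 3 ≤ k) (z : ℂ) :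
    pairIntensity μ n (n + k) (z, z) = Real.pi⁻¹ ^ 2 * (levelDensity n * levelDensity (n + k)) := by
  have hnm : n ≠ n + k := by omega
  rw [pairIntensity_diag hnm]
  simp only [conditionalJac_diag, orthPart₂_raiseVec hnm, orthPart₂_lowerVec hnm]
  rw [if_neg (by omega), if_neg (by omega), if_neg (by omega), if_neg (by omega)]
  have h := integral_pairingJac_mul_of_orthogonal hμ (v := ![raiseVec n z, lowerVec n z])
    (w := ![raiseVec (n + k) z, lowerVec (n + k) z]) fun i j => by
      fin_cases i <;> fin_cases j <;>
        simp only [raiseVec, lowerVec, inner_smul_left, inner_smul_right, inner_landauVec,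
          Fin.zero_eta, Fin.mk_one, Matrix.cons_val_zero, Matrix.cons_val_one] <;>
        rw [if_neg (by omega)] <;> simp
  refine (congrArg _ h).trans ?_
  simp only [Matrix.cons_val_zero, Matrix.cons_val_one]
  rw [integral_pairingJac_raiseVec hμ, integral_pairingJac_raiseVec hμ, mul_mul_mul_comm, ← sq,
    inv_pi_mul_exp_sq_mul]

end Diagonal

section ContactValues

theorem levelDensity_add_one (n : ℕ) :
    levelDensity (n + 1) = (n : ℝ) + 3 / 2 + 1 / (4 * n + 6) := by
  rw [levelDensity]; push_cast; ring_nf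

theorem levelDensity_add_two (n : ℕ) :
    levelDensity (n + 2) = (n : ℝ) + 5 / 2 + 1 / (4 * n + 10) := by
  rw [levelDensity]; push_cast; ring_nf

theorem contactMoment_eq (n : ℕ) : contactMoment (n + 1) n (n + 2) (n + 3)
    = (n : ℝ) ^ 2 + 3 * n + 1 + 2 / (3 * ((n : ℝ) ^ 2 + 3 * n + 1)) *
      ((n : ℝ) ^ 4 * (n + 2) ^ 2 / (2 * n + 1) ^ 2 +
        ((n : ℝ) + 1) ^ 2 * (n + 3) ^ 4 / (2 * n + 5) ^ 2) := by
  rcases n with _ | n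
  · norm_num [contactMoment]
  · generalize (((n + 1 : ℕ) : ℝ)) = x, (show (0 : ℝ) < ((n + 1 : ℕ) : ℝ) by positivity) = hx
    have e1 : 1 + (x + 1) / x = (2 * x + 1) / x := by field_simp; ring
    have e2 : 1 + (x + 2) / (x + 3) = (2 * x + 5) / (x + 3) := by field_simp; ring
    have e3 : 1 + (x + 1) / x + (x + 2) / (x + 3) = 3 * (x ^ 2 + 3 * x + 1) / (x * (x + 3)) := by
      field_simp; ring
    rw [contactMoment, e3, e1, e2]
    field_simp
    ring

theorem contactRatio_one_lt_one (n : ℕ) : (n : ℝ) * (n + 2) /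
    (((n : ℝ) + 1 / 2 + 1 / (4 * n + 2)) * ((n : ℝ) + 3 / 2 + 1 / (4 * n + 6))) < 1 := by
  have h1 : 0 < 1 / (4 * (n : ℝ) + 2) := by positivity
  have h2 : 0 < 1 / (4 * (n : ℝ) + 6) := by positivity
  rw [div_lt_one (by positivity)]
  have : (0 : ℝ) ≤ n := by positivity
  nlinarith [mul_pos h1 h2, mul_nonneg this h1.le, mul_nonneg this h2.le]

/-- The contact value of the pair correlation for `k = 2`. -/
def contactRatioTwo (x : ℝ) : ℝ :=
  (x ^ 2 + 3 * x + 1 + 2 / (3 * (x ^ 2 + 3 * x + 1)) *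
    (x ^ 4 * (x + 2) ^ 2 / (2 * x + 1) ^ 2 + (x + 1) ^ 2 * (x + 3) ^ 4 / (2 * x + 5) ^ 2)) /
  ((x + 1 / 2 + 1 / (4 * x + 2)) * (x + 5 / 2 + 1 / (4 * x + 10)))

theorem contactRatioTwo_eq {x : ℝ} (hx : 0 ≤ x) : contactRatioTwo x
    = (237 + 1998 * x + 7047 * x ^ 2 + 13434 * x ^ 3 + 15073 * x ^ 4 + 9972 * x ^ 5 + 3796 * x ^ 6
      + 768 * x ^ 7 + 64 * x ^ 8) / (3 * (65 + 531 * x + 1797 * x ^ 2 + 3348 * x ^ 3 + 3744 * x ^ 4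
      + 2484 * x ^ 5 + 948 * x ^ 6 + 192 * x ^ 7 + 16 * x ^ 8)) := by
  have e1 : x + 1 / 2 + 1 / (4 * x + 2) = (2 * x ^ 2 + 2 * x + 1) / (2 * x + 1) := by
    rw [show 4 * x + 2 = 2 * (2 * x + 1) by ring]
    field_simp; ring
  have e2 : x + 5 / 2 + 1 / (4 * x + 10) = (2 * x ^ 2 + 10 * x + 13) / (2 * x + 5) := by
    rw [show 4 * x + 10 = 2 * (2 * x + 5) by ring]
    field_simp; ring
  have e3 : 65 + 531 * x + 1797 * x ^ 2 + 3348 * x ^ 3 + 3744 * x ^ 4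
      + 2484 * x ^ 5 + 948 * x ^ 6 + 192 * x ^ 7 + 16 * x ^ 8 = (x ^ 2 + 3 * x + 1) * (2 * x + 1) *
      (2 * x + 5) * (2 * x ^ 2 + 2 * x + 1) * (2 * x ^ 2 + 10 * x + 13) := by ring
  rw [contactRatioTwo, e1, e2, e3]
  field_simp
  ring

theorem one_lt_contactRatioTwo {x : ℝ} (hx : 0 ≤ x) : 1 < contactRatioTwo x := by
  rw [contactRatioTwo_eq hx, one_lt_div (by positivity), ← sub_pos]
  ring_nf
  positivity

theorem isBigO_inv_cube {f : ℕ → ℝ} {C : ℝ} (a b : ℝ → ℝ)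
    (h : ∀ x : ℝ, 0 < x → 0 < b x ∧ |a x| * x ^ 3 ≤ C * b x)
    (hf : ∀ n : ℕ, 0 < n → f n = a n / b n) : f =O[atTop] fun n : ℕ => 1 / (n : ℝ) ^ 3 := by
  refine Asymptotics.IsBigO.of_bound C ?_
  filter_upwards [eventually_gt_atTop 0] with n hn
  have hn' : (0 : ℝ) < n := by exact_mod_cast hn
  obtain ⟨hb, hab⟩ := h n hn'
  rw [hf n hn, norm_div, Real.norm_eq_abs, Real.norm_of_nonneg hb.le,
    Real.norm_of_nonneg (by positivity), mul_one_div, div_le_div_iff₀ hb (by positivity)]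
  exact hab

theorem contactRatio_one_isBigO : (fun n : ℕ => (n : ℝ) * (n + 2) /
      (((n : ℝ) + 1 / 2 + 1 / (4 * n + 2)) * ((n : ℝ) + 3 / 2 + 1 / (4 * n + 6)))
      - (1 - 5 / (4 * (n : ℝ) ^ 2))) =O[atTop] fun n : ℕ => 1 / (n : ℝ) ^ 3 := by
  refine isBigO_inv_cube (C := 10) (fun x => 25 + 80 * x + 100 * x ^ 2 + 40 * x ^ 3)
    (fun x => 4 * x ^ 2 * ((2 * x ^ 2 + 2 * x + 1) * (2 * x ^ 2 + 6 * x + 5)))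
    (fun x hx => ⟨by positivity, ?_⟩) fun n hn => ?_
  · rw [abs_of_nonneg (by positivity), ← sub_nonneg]
    ring_nf
    positivity
  · have hx : (0 : ℝ) < n := by exact_mod_cast hn
    generalize (n : ℝ) = x at hx
    have e1 : x + 1 / 2 + 1 / (4 * x + 2) = (2 * x ^ 2 + 2 * x + 1) / (2 * x + 1) := by
      rw [show 4 * x + 2 = 2 * (2 * x + 1) by ring]
      field_simp; ring
    have e2 : x + 3 / 2 + 1 / (4 * x + 6) = (2 * x ^ 2 + 6 * x + 5) / (2 * x + 3) := by
      rw [show 4 * x + 6 = 2 * (2 * x + 3) by ring]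
      field_simp; ring
    rw [e1, e2]
    field_simp
    ring

theorem contactRatio_two_isBigO : (fun n : ℕ => contactRatioTwo n
      - (4 / 3 + 1 / (12 * (n : ℝ) ^ 2))) =O[atTop] fun n : ℕ => 1 / (n : ℝ) ^ 3 := by
  refine isBigO_inv_cube (C := 10) (fun x => -(65 + 531 * x + 1889 * x ^ 2 + 3852 * x ^ 3
      + 4308 * x ^ 4 + 2316 * x ^ 5 + 560 * x ^ 6 + 48 * x ^ 7))
    (fun x => 12 * x ^ 2 * (65 + 531 * x + 1797 * x ^ 2 + 3348 * x ^ 3 + 3744 * x ^ 4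
      + 2484 * x ^ 5 + 948 * x ^ 6 + 192 * x ^ 7 + 16 * x ^ 8))
    (fun x hx => ⟨by positivity, ?_⟩) fun n hn => ?_
  · rw [abs_neg, abs_of_nonneg (by positivity), ← sub_nonneg]
    ring_nf
    positivity
  · have hx : (0 : ℝ) < n := by exact_mod_cast hn
    generalize (n : ℝ) = x at hx
    rw [contactRatioTwo_eq hx.le]
    have hD : 0 < 65 + 531 * x + 1797 * x ^ 2 + 3348 * x ^ 3 + 3744 * x ^ 4
      + 2484 * x ^ 5 + 948 * x ^ 6 + 192 * x ^ 7 + 16 * x ^ 8 := by positivity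
    rw [div_add_div _ _ (by norm_num) (by positivity), div_sub_div _ _ (by positivity)
      (by positivity), div_eq_div_iff (by positivity) (by positivity)]
    ring

end ContactValues

section Transfer

variable {Ω : Type*} [MeasurableSpace Ω] {P : Measure Ω} {ζ : ℕ → Ω → ℂ}

theorem lintegral_enorm_stdComplexGaussian_lt_top : ∫⁻ z, ‖z‖ₑ ∂stdComplexGaussian < ∞ := by
  have h : Integrable (fun z : ℂ => z) stdComplexGaussian := by
    refine ((integrable_const (1 : ℝ)).add integrable_norm_pow_four).mono'
      measurable_id.aestronglyMeasurable (ae_of_all _ fun z => ?_)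
    simp only [Pi.add_apply]
    nlinarith [sq_nonneg (‖z‖ ^ 2 - 1), sq_nonneg (‖z‖ - 1), norm_nonneg z]
  exact h.2

theorem ae_summable_mul_growth (hlaw : ∀ k, HasLaw (ζ k) stdComplexGaussian P) :
    ∀ᵐ ω ∂P, ∀ R : ℕ, Summable fun k => ‖ζ k ω‖ * growth R k := by
  refine ae_all_iff.2 fun R => ?_
  have hm : ∀ k, AEMeasurable (fun ω => ‖ζ k ω‖ₑ * ENNReal.ofReal (growth R k)) P := fun k =>
    (hlaw k).aemeasurable.enorm.mul_const _
  have h1 : ∀ k, ∫⁻ ω, ‖ζ k ω‖ₑ * ENNReal.ofReal (growth R k) ∂P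
      = (∫⁻ z, ‖z‖ₑ ∂stdComplexGaussian) * ENNReal.ofReal (growth R k) := fun k => by
    rw [lintegral_mul_const'' _ (hlaw k).aemeasurable.enorm, ← (hlaw k).map_eq,
      lintegral_map' measurable_enorm.aemeasurable (hlaw k).aemeasurable]
  have h2 : ∫⁻ ω, ∑' k, ‖ζ k ω‖ₑ * ENNReal.ofReal (growth R k) ∂P ≠ ∞ := by
    rw [lintegral_tsum hm]
    simp only [h1]
    rw [ENNReal.tsum_mul_left, ← ENNReal.ofReal_tsum_of_nonneg (growth_nonneg R) (summable_growth R)]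
    exact (ENNReal.mul_lt_top lintegral_enorm_stdComplexGaussian_lt_top ENNReal.ofReal_lt_top).ne
  filter_upwards [ae_lt_top' (AEMeasurable.tsum hm) h2] with ω hω
  have := ENNReal.summable_toReal hω.ne
  refine this.congr fun k => ?_
  rw [ENNReal.toReal_mul, toReal_enorm, ENNReal.toReal_ofReal (growth_nonneg R k)]

/-- Almost surely the coefficients form an element of `EntireSeq`, whose law is Gaussian. -/
theorem exists_entireSeq [IsProbabilityMeasure P]
    (hlaw : ∀ k, HasLaw (ζ k) stdComplexGaussian P) (hindep : iIndepFun ζ P) :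
    ∃ Z : Ω → EntireSeq, Measurable Z ∧ (∀ᵐ ω ∂P, ∀ k, ζ k ω = (Z ω).1 k) ∧
      IsGaussianSeq (P.map Z) := by
  classical
  let ξ : ℕ → Ω → ℂ := fun k => (hlaw k).aemeasurable.mk (ζ k)
  have hξ : ∀ k, Measurable (ξ k) := fun k => (hlaw k).aemeasurable.measurable_mk
  have hξζ : ∀ᵐ ω ∂P, ∀ k, ζ k ω = ξ k ω := ae_all_iff.2 fun k => (hlaw k).aemeasurable.ae_eq_mk
  let A : Set Ω := {ω | ∀ R : ℕ, Summable fun k => ‖ξ k ω‖ * growth R k}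
  have hA : MeasurableSet A := by
    have e : A = ⋂ R : ℕ, {ω | ∑' k, ENNReal.ofReal (‖ξ k ω‖ * growth R k) < ∞} := by
      ext ω
      simp only [Set.mem_iInter]
      refine forall_congr' fun R => ⟨fun h => ?_, fun h => ?_⟩
      · change ∑' k, ENNReal.ofReal (‖ξ k ω‖ * growth R k) < ∞
        rw [← ENNReal.ofReal_tsum_of_nonneg
          (fun k => mul_nonneg (norm_nonneg _) (growth_nonneg R k)) h]
        exact ENNReal.ofReal_lt_top
      · refine (ENNReal.summable_toReal (ne_of_lt h)).congr fun k => ?_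
        rw [ENNReal.toReal_ofReal (mul_nonneg (norm_nonneg _) (growth_nonneg R k))]
    rw [e]
    exact MeasurableSet.iInter fun R => measurableSet_lt
      (Measurable.tsum fun k => ((hξ k).norm.mul_const _).ennreal_ofReal) measurable_const
  let Z : Ω → EntireSeq := fun ω =>
    ⟨fun k => A.indicator (ξ k) ω, fun R => by
      by_cases h : ω ∈ A
      · simpa only [Set.indicator_of_mem h] using h R
      · simp [Set.indicator_of_notMem h]⟩
  have hZ : Measurable Z := measurable_entireSeq fun j => (hξ j).indicator hA
  have hZζ : ∀ᵐ ω ∂P, ∀ k, ζ k ω = (Z ω).1 k := by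
    filter_upwards [hξζ, ae_summable_mul_growth hlaw] with ω h1 h2 k
    have : ω ∈ A := by
      intro R
      simpa only [← h1] using h2 R
    exact (h1 k).trans (Set.indicator_of_mem this _).symm
  have := Measure.isProbabilityMeasure_map (μ := P) hZ.aemeasurable
  have hmap : ∀ k, (P.map Z).map (fun c : EntireSeq => c.1 k) = P.map (fun ω => (Z ω).1 k) :=
    fun k => Measure.map_map (measurable_coord k) hZ
  refine ⟨Z, hZ, hZζ, ?_, fun k => ?_⟩
  · have h1 : iIndepFun (fun k ω => (Z ω).1 k) P := iIndepFun.congr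
      (fun k => by filter_upwards [hZζ] with ω h using h k) hindep
    have h2 := (iIndepFun_iff_map_fun_eq_infinitePi_map fun k => (measurable_coord k).comp hZ).1 h1
    refine (iIndepFun_iff_map_fun_eq_infinitePi_map measurable_coord).2 ?_
    rw [Measure.map_map (measurable_pi_lambda _ measurable_coord) hZ]
    simp only [hmap]
    exact h2
  · rw [hmap k, ← (hlaw k).map_eq]
    exact Measure.map_congr (by filter_upwards [hZζ] with ω h using (h k).symm)

theorem isOnePointIntensity_landauGaussian [IsProbabilityMeasure P]
    (hlaw : ∀ k, HasLaw (ζ k) stdComplexGaussian P)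
    (hindep : iIndepFun ζ P) (n : ℕ) :
    IsOnePointIntensity P (landauGaussian ζ n) fun _ => Real.pi⁻¹ * levelDensity n := by
  obtain ⟨Z, hZ, hZζ, hμ⟩ := exists_entireSeq hlaw hindep
  have := Measure.isProbabilityMeasure_map (μ := P) hZ.aemeasurable
  have h : ∀ S, (fun ω => zeroCount (landauGaussian ζ n ω) S) =ᵐ[P]
      fun ω => zeroCount (landauField n (Z ω)) S := fun S => by
    filter_upwards [hZζ] with ω h
    rw [landauGaussian_eq_landauField ζ ω (Z ω) h]
  refine ⟨continuous_const, fun z => ?_, fun S hS => ?_, fun S hS => ?_⟩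
  · have := levelDensity_pos n
    have := Real.pi_pos
    positivity
  · exact ((count_landauField hμ n hS).1.comp_measurable hZ).congr (h S).symm
  · rw [lintegral_congr_ae (h S), ← (count_landauField hμ n hS).2,
      lintegral_map' (count_landauField hμ n hS).1 hZ.aemeasurable]

theorem isTwoPointIntensity_landauGaussian [IsProbabilityMeasure P]
    (hlaw : ∀ k, HasLaw (ζ k) stdComplexGaussian P)
    (hindep : iIndepFun ζ P) : ∃ μ : Measure EntireSeq, IsProbabilityMeasure μ ∧ IsGaussianSeq μ ∧
      ∀ n m : ℕ, n ≠ m → IsTwoPointIntensity P (landauGaussian ζ n) (landauGaussian ζ m)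
        (pairIntensity μ n m) := by
  obtain ⟨Z, hZ, hZζ, hμ⟩ := exists_entireSeq hlaw hindep
  have := Measure.isProbabilityMeasure_map (μ := P) hZ.aemeasurable
  refine ⟨P.map Z, this, hμ, fun n m hnm => ?_⟩
  have h : ∀ S, (fun ω => zeroPairCount (landauGaussian ζ n ω) (landauGaussian ζ m ω) S) =ᵐ[P]
      fun ω => zeroPairCount (landauField n (Z ω)) (landauField m (Z ω)) S := fun S => by
    filter_upwards [hZζ] with ω h
    rw [landauGaussian_eq_landauField ζ ω (Z ω) h, landauGaussian_eq_landauField ζ ω (Z ω) h]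
  refine ⟨(continuous_pairIntensity hμ hnm).continuousOn, pairIntensity_nonneg n m, fun S hS => ?_,
    fun S hS => ?_⟩
  · exact ((count_landauField_prod hμ hnm hS).1.comp_measurable hZ).congr (h S).symm
  · rw [lintegral_congr_ae (h S), ← (count_landauField_prod hμ hnm hS).2,
      lintegral_map' (count_landauField_prod hμ hnm hS).1 hZ.aemeasurable]

theorem eqOn_of_setLIntegral_eq {E : Type*} [TopologicalSpace E] [MeasurableSpace E]
    [OpensMeasurableSpace E] {ν : Measure E} [SigmaFinite ν] [ν.IsOpenPosMeasure] {f g : E → ℝ}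
    {U : Set E} (hU : IsOpen U) (hf : ContinuousOn f U) (hg : ContinuousOn g U)
    (hf0 : ∀ x, 0 ≤ f x) (hg0 : ∀ x, 0 ≤ g x)
    (h : ∀ S, MeasurableSet S → ∫⁻ x in S, ENNReal.ofReal (f x) ∂ν
      = ∫⁻ x in S, ENNReal.ofReal (g x) ∂ν) : Set.EqOn f g U := by
  refine Measure.eqOn_open_of_ae_eq (μ := ν) ?_ hU hf hg
  have := ae_eq_of_forall_setLIntegral_eq_of_sigmaFinite₀ (μ := ν.restrict U)
    (hf.aemeasurable hU.measurableSet).ennreal_ofReal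
    (hg.aemeasurable hU.measurableSet).ennreal_ofReal fun S hS _ => by
      rw [Measure.restrict_restrict hS, h _ (hS.inter hU.measurableSet)]
  filter_upwards [this] with x hx
  exact (ENNReal.ofReal_eq_ofReal_iff (hf0 x) (hg0 x)).1 hx

theorem IsOnePointIntensity.unique {f : Ω → ℂ → ℂ} {ρ ρ' : ℂ → ℝ} (h : IsOnePointIntensity P f ρ)
    (h' : IsOnePointIntensity P f ρ') : ρ = ρ' := by
  have := eqOn_of_setLIntegral_eq (ν := volume) isOpen_univ h.continuous.continuousOn
    h'.continuous.continuousOn h.nonneg h'.nonneg fun S hS =>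
      (h.lintegral_count S hS).symm.trans (h'.lintegral_count S hS)
  exact funext fun z => this (Set.mem_univ z)

theorem IsTwoPointIntensity.eqOn {f g : Ω → ℂ → ℂ} {ρ ρ' : ℂ × ℂ → ℝ}
    (h : IsTwoPointIntensity P f g ρ) (h' : IsTwoPointIntensity P f g ρ') :
    Set.EqOn ρ ρ' {p | p.1 ≠ p.2} :=
  eqOn_of_setLIntegral_eq (ν := volume) (isOpen_ne_fun continuous_fst continuous_snd)
    h.continuousOn h'.continuousOn h.nonneg h'.nonneg fun S hS =>
      (h.lintegral_count S hS).symm.trans (h'.lintegral_count S hS)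

theorem tendsto_normalizedPairCorrelation {μ : Measure EntireSeq} [IsProbabilityMeasure μ]
    (hμ : IsGaussianSeq μ) {n m : ℕ} (hnm : n ≠ m) {ρ : ℂ × ℂ → ℝ}
    (hρ : Set.EqOn ρ (pairIntensity μ n m) {p | p.1 ≠ p.2}) (z : ℂ) :
    Tendsto (fun w => normalizedPairCorrelation (fun _ => Real.pi⁻¹ * levelDensity n)
        (fun _ => Real.pi⁻¹ * levelDensity m) ρ z w) (𝓝[≠] z)
      (𝓝 (pairIntensity μ n m (z, z) /
        (Real.pi⁻¹ ^ 2 * (levelDensity n * levelDensity m)))) := by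
  have h1 : Tendsto (fun w => pairIntensity μ n m (z, w)) (𝓝[≠] z)
      (𝓝 (pairIntensity μ n m (z, z))) :=
    (((continuous_pairIntensity hμ hnm).comp (by fun_prop : Continuous fun w => (z, w))).tendsto
      z).mono_left nhdsWithin_le_nhds
  refine (h1.div_const _).congr' ?_
  filter_upwards [self_mem_nhdsWithin] with w hw
  rw [normalizedPairCorrelation, hρ (show z ≠ w from Ne.symm hw)]
  congr 1
  ring

end Transfer
end

theorem theorem2p1 {Ω : Type*} [MeasurableSpace Ω] (P : Measure Ω) [IsProbabilityMeasure P]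
    (ζ : ℕ → Ω → ℂ) (hlaw : ∀ k, HasLaw (ζ k) stdComplexGaussian P) (hindep : iIndepFun ζ P) :
    -- the intensities exist
    (∀ n : ℕ, ∃ ρ : ℂ → ℝ, IsOnePointIntensity P (landauGaussian ζ n) ρ) ∧
    (∀ n k : ℕ, 1 ≤ k → ∃ ρ : ℂ × ℂ → ℝ,
      IsTwoPointIntensity P (landauGaussian ζ n) (landauGaussian ζ (n + k)) ρ) ∧
    -- and the pair correlations formed from them have the stated contact limits
    ∀ (ρ₁ : ℕ → ℂ → ℝ) (ρ₂ : ℕ → ℕ → ℂ × ℂ → ℝ),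
      (∀ n, IsOnePointIntensity P (landauGaussian ζ n) (ρ₁ n)) →
      (∀ n k, 1 ≤ k →
        IsTwoPointIntensity P (landauGaussian ζ n) (landauGaussian ζ (n + k)) (ρ₂ n k)) →
      (∀ n z, 0 < ρ₁ n z) ∧
      ∃ G : ℕ → ℕ → ℂ → ℝ,
        (∀ n k z, 1 ≤ k →
          Tendsto (fun w => normalizedPairCorrelation (ρ₁ n) (ρ₁ (n + k)) (ρ₂ n k) z w)
            (𝓝[≠] z) (𝓝 (G n k z))) ∧
        -- `k = 1`
        (∀ (n : ℕ) (z : ℂ),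
          G n 1 z = (n : ℝ) * (n + 2) /
            (((n : ℝ) + 1 / 2 + 1 / (4 * n + 2)) * ((n : ℝ) + 3 / 2 + 1 / (4 * n + 6))) ∧
          G n 1 z < 1) ∧
        (∀ z : ℂ, (fun n : ℕ => G n 1 z - (1 - 5 / (4 * (n : ℝ) ^ 2)))
          =O[atTop] fun n : ℕ => 1 / (n : ℝ) ^ 3) ∧
        -- `k = 2`
        (∀ (n : ℕ) (z : ℂ),
          G n 2 z = ((n : ℝ) ^ 2 + 3 * n + 1 + 2 / (3 * ((n : ℝ) ^ 2 + 3 * n + 1)) *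
              ((n : ℝ) ^ 4 * (n + 2) ^ 2 / (2 * n + 1) ^ 2 +
                ((n : ℝ) + 1) ^ 2 * (n + 3) ^ 4 / (2 * n + 5) ^ 2)) /
            (((n : ℝ) + 1 / 2 + 1 / (4 * n + 2)) * ((n : ℝ) + 5 / 2 + 1 / (4 * n + 10))) ∧
          1 < G n 2 z) ∧
        (∀ z : ℂ, (fun n : ℕ => G n 2 z - (4 / 3 + 1 / (12 * (n : ℝ) ^ 2)))
          =O[atTop] fun n : ℕ => 1 / (n : ℝ) ^ 3) ∧
        -- `k ≥ 3`
        (∀ (n k : ℕ) (z : ℂ), 3 ≤ k → G n k z = 1) := by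
  obtain ⟨μ, hμp, hμ, h2⟩ := isTwoPointIntensity_landauGaussian hlaw hindep
  have h1 := isOnePointIntensity_landauGaussian hlaw hindep
  refine ⟨fun n => ⟨_, h1 n⟩, fun n k hk => ⟨_, h2 n (n + k) (by omega)⟩, ?_⟩
  intro ρ₁ ρ₂ hρ₁ hρ₂
  have e1 : ∀ n, ρ₁ n = fun _ => Real.pi⁻¹ * levelDensity n := fun n => (hρ₁ n).unique (h1 n)
  have hpi : Real.pi⁻¹ ^ 2 ≠ 0 := by have := Real.pi_pos; positivity
  have hG : ∀ n k z M, pairIntensity μ n (n + k) (z, z) = Real.pi⁻¹ ^ 2 * M →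
      pairIntensity μ n (n + k) (z, z) / (Real.pi⁻¹ ^ 2 * (levelDensity n * levelDensity (n + k)))
        = M / (levelDensity n * levelDensity (n + k)) := fun n k z M h => by
    rw [h, mul_div_mul_left _ _ hpi]
  have hG1 : ∀ (n : ℕ) (z : ℂ), pairIntensity μ n (n + 1) (z, z) /
      (Real.pi⁻¹ ^ 2 * (levelDensity n * levelDensity (n + 1))) = (n : ℝ) * (n + 2) /
        (((n : ℝ) + 1 / 2 + 1 / (4 * n + 2)) * ((n : ℝ) + 3 / 2 + 1 / (4 * n + 6))) := fun n z => by
    rw [hG n 1 z _ (pairIntensity_diag_one hμ n z), levelDensity_add_one, levelDensity]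
  have hG2 : ∀ (n : ℕ) (z : ℂ), pairIntensity μ n (n + 2) (z, z) /
      (Real.pi⁻¹ ^ 2 * (levelDensity n * levelDensity (n + 2))) = contactRatioTwo n := fun n z => by
    rw [hG n 2 z _ (pairIntensity_diag_two hμ n z), contactMoment_eq, levelDensity_add_two,
      levelDensity, contactRatioTwo]
  refine ⟨fun n z => ?_, fun n k z => pairIntensity μ n (n + k) (z, z) /
    (Real.pi⁻¹ ^ 2 * (levelDensity n * levelDensity (n + k))), fun n k z hk => ?_,
    fun n z => ⟨hG1 n z, ?_⟩, fun z => ?_, fun n z => ⟨hG2 n z, ?_⟩, fun z => ?_,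
    fun n k z hk => ?_⟩
  · rw [e1]
    exact mul_pos (inv_pos.2 Real.pi_pos) (levelDensity_pos n)
  · rw [e1, e1]
    exact tendsto_normalizedPairCorrelation hμ (by omega)
      ((hρ₂ n k hk).eqOn (h2 n (n + k) (by omega))) z
  · exact (hG1 n z).trans_lt (contactRatio_one_lt_one n)
  · simp only [hG1]
    exact contactRatio_one_isBigO
  · exact (one_lt_contactRatioTwo (Nat.cast_nonneg n)).trans_eq (hG2 n z).symm
  · simp only [hG2]
    exact contactRatio_two_isBigO
  · refine (hG n k z _ (pairIntensity_diag_of_three_le hμ n hk z)).trans ?_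
    exact div_self (mul_pos (levelDensity_pos n) (levelDensity_pos (n + k))).ne'
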